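/- Let $\overline\Sigma$ be a compact connected oriented surface with a triangulation $\mathcal T$ whose set of vertices is $V$, and let $\Sigma=\overline\Sigma\setminus V$. Suppose that $\mathcal T$ is locally planar: the edges of $\mathcal T$ form no one-cycle and no two-cycle (no edge has equal endpoints, and no two different edges have the same endpoints), and $\Sigma$ is not the three-punctured sphere. Fix an edge $e$ of $\mathcal T$. A *multicurve* is a disjoint union of finitely many simple loops in $\Sigma$ and simple arcs in $\overline\Sigma$ whose endpoints are in $V$ and whose interiors are in $\Sigma$; the union is embedded, so that at most one end of one arc is at any vertex. It is *reduced* if it is in general position with respect to $\mathcal T$ (edges of $\mathcal T$ being allowed as components), has no turn-backs in any triangle (so that every other piece of it in a triangle joins two different sides, or a vertex and the opposite side), and no component bounds a disk in $\overline\Sigma$ with at most one point of $V$. Let $\mathsf{RMC}$ be the set of isotopy classes of reduced multicurves (including $\emptyset$), each represented by a reduced multicurve, and for $j=0,1,2$ let $\mathsf{RMC}^j$ be the set of those that share exactly $j$ endpoints with $e$. For $\alpha\in\mathsf{RMC}$, not containing $e$ as a component, the *positive resolution* $P\alpha$ is the reduced multicurve isotopic to the one obtained from $e\cup\alpha$ as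 follows. At every interior crossing of $e$ and $\alpha$, each of the two halves of $e$ is connected to that half of $\alpha$ which comes next to it in counterclockwise direction. At every common endpoint $v$ of $e$ and $\alpha$, the ends of $e$ and $\alpha$ at $v$ are connected to each other by a curve close to $v$ that passes through the sector at $v$ swept out by turning $e$ counterclockwise to $\alpha$. In particular, $P\alpha=\alpha\sqcup e$ if $e$ and $\alpha$ are disjoint, endpoints included. If $e$ is a component of $\alpha$, then $P\alpha$ is obtained from $\alpha$ by replacing this component by the boundary of a small neighbourhood of $e$. The *negative resolution* $N\alpha$ is defined with clockwise in place of counterclockwise throughout; if $e$ is a component of $\alpha$, then the negative resolution is $-2$ times $\alpha\setminus e$, and $N\alpha$ denotes the reduced multicurve $\alpha\setminus e$. Then for $j=0,1,2$ these rules define maps $$P:\mathsf{RMC}^j\to\mathsf{RMC}^{2-j},\qquad N:\mathsf{RMC}^j\to\mathsf{RMC}^{2-j},$$ and both maps are injective. -/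

import Mathlib

noncomputable section

/-!
A compact connected oriented surface with a triangulation is presented by its *darts*: a dart is a
triangle together with one of its three sides, and the side is directed so that the triangle lies
on its left.  Every edge of the triangulation carries exactly two darts, one from each side.
-/

/-- A triangulated closed connected oriented surface, with set of darts `D`. -/
structure TriSurface (D : Type*) where
  /-- the following side of the same triangle, going counterclockwise along its boundary -/
  next : Equiv.Perm D
  /-- the same edge, seen from the triangle on its other side, with the opposite direction -/
  opp : Equiv.Perm D
  next_next_next : ∀ d, next (next (next d)) = d
  next_ne : ∀ d, next d ≠ d
  opp_opp : ∀ d, opp (opp d) = d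
  opp_ne : ∀ d, opp d ≠ d
  connected : ∀ d d' : D, ∃ g ∈ Subgroup.closure ({next, opp} : Set (Equiv.Perm D)), g d = d'

namespace TriSurface

variable {D : Type*}

/-- The preceding side of the same triangle. -/
def prev (S : TriSurface D) (d : D) : D := S.next (S.next d)

/-- A dart `d` also names the *corner* of its triangle at the initial vertex of `d`; this corner
lies between the sides `d` and `prev d`, and immediately to the left of `d`.  Crossing the side `d`
leads to the corner `rot d`, which is the next corner around that vertex in the clockwise
direction. -/
def rot (S : TriSurface D) : Equiv.Perm D := S.opp.trans S.next

/-- `d` and `d'` have the same initial vertex. -/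
def SameVertex (S : TriSurface D) (d d' : D) : Prop := S.rot.SameCycle d d'

/-- The vertices of the triangulation; these are the punctures. -/
def Vertex (S : TriSurface D) : Type _ := Quotient (Equiv.Perm.SameCycle.setoid S.rot)

/-- The edges of the triangulation. -/
def Edge (S : TriSurface D) : Type _ := Quotient (Equiv.Perm.SameCycle.setoid S.opp)

/-- The triangles of the triangulation. -/
def Triangle (S : TriSurface D) : Type _ := Quotient (Equiv.Perm.SameCycle.setoid S.next)

/-- The Euler characteristic of the closed surface. -/
def eulerChar (S : TriSurface D) : ℤ :=
  (Nat.card S.Vertex : ℤ) - Nat.card S.Edge + Nat.card S.Triangle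

/-- A locally planar triangulation: the edges form no one-cycle and no two-cycle, and the punctured
surface is not the three-punctured sphere.  (The terminal vertex of `d` is the initial vertex of
`next d`.) -/
structure LocallyPlanar (S : TriSurface D) : Prop where
  no_one_cycle : ∀ d, ¬ S.SameVertex d (S.next d)
  no_two_cycle : ∀ d d', S.SameVertex d d' → S.SameVertex (S.next d) (S.next d') → d = d'
  not_three_punctured_sphere : ¬ (S.eulerChar = 2 ∧ Nat.card S.Vertex = 3)

end TriSurface

/-- The places where a strand (a component of the intersection of a multicurve with a triangle) can
end: `point d i` is the `i`-th crossing point of the multicurve with the side `d`, counted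
from `0` in the direction of `d`, and seen from the triangle of `d`; `vertex d` is the vertex of the
triangle of `d` at the corner `d`. -/
inductive Port (D : Type*) where
  | point (d : D) (i : ℕ)
  | vertex (d : D)

/-- The dart that a port belongs to. -/
def Port.dart {D : Type*} : Port D → D
  | .point d _ => d
  | .vertex d => d

/-- The rank of a port among the ports of its dart, in the direction of the dart. -/
def Port.rank {D : Type*} : Port D → ℕ
  | .point _ i => i + 1
  | .vertex _ => 0

/-- A port that exists when each side `d` has `cnt d` crossing points. -/
def Port.Valid {D : Type*} (cnt : D → ℕ) : Port D → Prop
  | .point d i => i < cnt d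
  | .vertex _ => True

/-- `{p, q} = {a, b}` -/
def IsPair {α : Type*} (a b p q : α) : Prop := (p = a ∧ q = b) ∨ (p = b ∧ q = a)

/-- The combinatorial picture of a multicurve in general position with respect to a triangulation:
the number of crossing points on every side, the strands in the triangles, given by the two ports
that they join, and those edges (each given by both of its darts) that are components of the
multicurve. -/
@[ext] structure Diagram (D : Type*) where
  cnt : D → ℕ
  joined : Port D → Port D → Prop
  comps : Set D

namespace Diagram

variable {D : Type*}

/-- Some strand in the triangle of the corner `c` ends at the vertex of the corner `c`. -/
def HasEnd (X : Diagram D) (c : D) : Prop := ∃ q, X.joined (.vertex c) q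

/-- The initial vertex of `d` is an endpoint of some arc of the multicurve. -/
def EndsAt (X : Diagram D) (S : TriSurface D) (d : D) : Prop :=
  ∃ c, S.SameVertex c d ∧ (X.HasEnd c ∨ c ∈ X.comps)

/-- Two ports on the boundary of one triangle. -/
def SameTriangle (S : TriSurface D) (p q : Port D) : Prop :=
  q.dart = p.dart ∨ q.dart = S.next p.dart ∨ q.dart = S.prev p.dart

/-- Going counterclockwise along the boundary of the triangle of `b`, starting at the initial vertex
of `b`, the port `p` comes before the port `q`. -/
def Before (S : TriSurface D) (b : D) (p q : Port D) : Prop :=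
  (p.dart = b ∧ q.dart = b ∧ p.rank < q.rank) ∨
  (p.dart = S.next b ∧ q.dart = S.next b ∧ p.rank < q.rank) ∨
  (p.dart = S.prev b ∧ q.dart = S.prev b ∧ p.rank < q.rank) ∨
  (p.dart = b ∧ (q.dart = S.next b ∨ q.dart = S.prev b)) ∨
  (p.dart = S.next b ∧ q.dart = S.prev b)

/-- The picture is the picture of an embedded multicurve (a disjoint union of simple loops and
simple arcs with endpoints at vertices; as the union is embedded, at most one end of
one arc is at any given vertex). -/
structure IsMulticurve (X : Diagram D) (S : TriSurface D) : Prop where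
  cnt_opp : ∀ d, X.cnt (S.opp d) = X.cnt d
  symm : ∀ p q, X.joined p q → X.joined q p
  ne : ∀ p q, X.joined p q → p ≠ q
  valid : ∀ p q, X.joined p q → p.Valid X.cnt
  sameTriangle : ∀ p q, X.joined p q → SameTriangle S p q
  /-- every crossing point is on exactly one strand on each side of its edge -/
  point_joined : ∀ d i, i < X.cnt d → ∃! q, X.joined (.point d i) q
  /-- two strands in a triangle do not cross, i.e. their ends do not alternate on its boundary -/
  noncrossing : ∀ b p q r s, X.joined p q → X.joined r s →
    ¬ (Before S b p r ∧ Before S b r q ∧ Before S b q s)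
  comps_opp : ∀ d, d ∈ X.comps → S.opp d ∈ X.comps
  comps_cnt : ∀ d, d ∈ X.comps → X.cnt d = 0
  /-- at most one end at every vertex -/
  end_unique : ∀ c c' q q', S.SameVertex c c' →
    X.joined (.vertex c) q → X.joined (.vertex c') q' → c = c' ∧ q = q'
  end_not_comp : ∀ c f q, S.SameVertex c f → X.joined (.vertex c) q → f ∉ X.comps
  comp_unique : ∀ f f', S.SameVertex f f' → f ∈ X.comps → f' ∈ X.comps → f = f'

/-- No turn-backs: no strand joins a side to itself, and a strand that ends at a vertex of
its triangle joins that vertex to the opposite side.  (A strand from a vertex to an adjacent side is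
half of a turn-back, and a strand from a vertex to another vertex is parallel to an edge; such an
edge has to be listed in `comps` instead.) -/
structure NoTurnBacks (X : Diagram D) (S : TriSurface D) : Prop where
  side : ∀ d i j, ¬ X.joined (.point d i) (.point d j)
  vertex : ∀ c q, X.joined (.vertex c) q → ∃ i, q = .point (S.next c) i

/-- Some component of the multicurve is a loop that runs once around the initial vertex of `d`,
cutting off every corner at this vertex.  Here `i c` is the crossing point with the side `c`, and
that point is number `X.cnt c - 1 - i c` when seen from the triangle on the other side. -/
def HasPunctureLoop (X : Diagram D) (S : TriSurface D) (d : D) : Prop :=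
  ∃ i : D → ℕ, ∀ c, S.SameVertex c d → i c < X.cnt c ∧
    X.joined (.point (S.opp c) (X.cnt c - 1 - i c)) (.point (S.rot c) (i (S.rot c)))

/-- A reduced multicurve: embedded, no turn-backs, and no component is a puncture loop.  (A loop
without turn-backs is never trivial, since it runs through a closed path without backtracking in the
dual graph, onto which the punctured surface retracts.) -/
structure IsReduced (X : Diagram D) (S : TriSurface D) : Prop where
  multicurve : X.IsMulticurve S
  noTurnBacks : X.NoTurnBacks S
  no_puncture_loop : ∀ d, ¬ X.HasPunctureLoop S d

/-! ### Isotopies -/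

/-- The strands of `X`, after the ports have been renamed: `old p` is the former name of the port
`p`, if it had any. -/
def renamed (X : Diagram D) (cnt' : D → ℕ) (old : Port D → Option (Port D)) (p q : Port D) : Prop :=
  p.Valid cnt' ∧ q.Valid cnt' ∧ ∃ p₀ q₀, old p = some p₀ ∧ old q = some q₀ ∧ X.joined p₀ q₀

open Classical in
/-- For a strand from the vertex of the corner `d` to the first point of the adjacent side `d`:
pull it across this side, which removes the crossing point, so that the arc ends in the
corner `rot d`. -/
def slideCW (X : Diagram D) (S : TriSurface D) (d : D) : Diagram D :=
  let cnt' : D → ℕ := fun x => if x = d ∨ x = S.opp d then X.cnt x - 1 else X.cnt x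
  let old : Port D → Option (Port D)
    | .point x i => if x = d then some (.point d (i + 1)) else some (.point x i)
    | .vertex x => if x = S.rot d then some (.point (S.opp d) (X.cnt d - 1)) else some (.vertex x)
  { cnt := cnt', joined := X.renamed cnt' old, comps := X.comps }

open Classical in
/-- For a strand from the vertex of the corner `rot d` to the last point of the adjacent side
`opp d`, which is the first point of `d`: pull it across this side, which removes the crossing
point, so that the arc ends in the corner `d`. -/
def slideCCW (X : Diagram D) (S : TriSurface D) (d : D) : Diagram D :=
  let cnt' : D → ℕ := fun x => if x = d ∨ x = S.opp d then X.cnt x - 1 else X.cnt x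
  let old : Port D → Option (Port D)
    | .point x i => if x = d then some (.point d (i + 1)) else some (.point x i)
    | .vertex x => if x = d then some (.point d 0) else some (.vertex x)
  { cnt := cnt', joined := X.renamed cnt' old, comps := X.comps }

open Classical in
/-- For a strand from point `i` to point `i + 1` of the side `d` (a turn-back): pull it across this
side, which removes both points; the strands that end there on the other side become one strand. -/
def removeTurnBack (X : Diagram D) (S : TriSurface D) (d : D) (i : ℕ) : Diagram D :=
  let j := X.cnt d - 2 - i
  let cnt' : D → ℕ := fun x => if x = d ∨ x = S.opp d then X.cnt x - 2 else X.cnt x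
  let old : Port D → Port D
    | .point x k =>
        if x = d then .point x (if k < i then k else k + 2)
        else if x = S.opp d then .point x (if k < j then k else k + 2)
        else .point x k
    | .vertex x => .vertex x
  { cnt := cnt'
    joined := fun p q => p.Valid cnt' ∧ q.Valid cnt' ∧
      (X.joined (old p) (old q) ∨
        (X.joined (old p) (.point (S.opp d) j) ∧ X.joined (old q) (.point (S.opp d) (j + 1))) ∨
        (X.joined (old q) (.point (S.opp d) j) ∧ X.joined (old p) (.point (S.opp d) (j + 1))))
    comps := X.comps }

/-- For a strand from the initial to the terminal vertex of the side `d`: push it onto the edge. -/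
def pushToEdge (X : Diagram D) (S : TriSurface D) (d : D) : Diagram D where
  cnt := X.cnt
  joined p q := X.joined p q ∧ ¬ IsPair (.vertex d) (.vertex (S.next d)) p q
  comps := X.comps ∪ {d, S.opp d}

/-- The elementary isotopies that pull a multicurve tight. -/
inductive Tighten (S : TriSurface D) : Diagram D → Diagram D → Prop
  | slideCW (X : Diagram D) (d : D) (h : X.joined (.vertex d) (.point d 0)) :
      Tighten S X (X.slideCW S d)
  | slideCCW (X : Diagram D) (d : D) (h₀ : 0 < X.cnt d)
      (h : X.joined (.vertex (S.rot d)) (.point (S.opp d) (X.cnt d - 1))) :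
      Tighten S X (X.slideCCW S d)
  | removeTurnBack (X : Diagram D) (d : D) (i : ℕ)
      (h : X.joined (.point d i) (.point d (i + 1)))
      (h' : ¬ X.joined (.point (S.opp d) (X.cnt d - 2 - i))
        (.point (S.opp d) (X.cnt d - 2 - i + 1))) :
      Tighten S X (X.removeTurnBack S d i)
  | pushToEdge (X : Diagram D) (d : D) (h₀ : X.cnt d = 0)
      (h : X.joined (.vertex d) (.vertex (S.next d))) :
      Tighten S X (X.pushToEdge S d)

/-! ### Winding ends of arcs around a vertex -/

open Classical in
/-- Isotope the arc that ends in the corner `d` so that it crosses the side `d` close to the initial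
vertex of `d` and ends in the corner `rot d`, the next one clockwise. -/
def windCW (X : Diagram D) (S : TriSurface D) (d : D) : Diagram D :=
  let cnt' : D → ℕ := fun x => if x = d ∨ x = S.opp d then X.cnt x + 1 else X.cnt x
  let old : Port D → Option (Port D)
    | .point x i =>
        if x = d then (if i = 0 then some (.vertex d) else some (.point d (i - 1)))
        else some (.point x i)
    | .vertex x => if x = d then none else some (.vertex x)
  { cnt := cnt'
    joined := fun p q => X.renamed cnt' old p q ∨
      IsPair (.vertex (S.rot d)) (.point (S.opp d) (X.cnt d)) p q
    comps := X.comps }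

open Classical in
/-- Isotope the arc that ends in the corner `rot d` so that it crosses the side `d` close to the
initial vertex of `d` and ends in the corner `d`, the next one counterclockwise. -/
def windCCW (X : Diagram D) (S : TriSurface D) (d : D) : Diagram D :=
  let cnt' : D → ℕ := fun x => if x = d ∨ x = S.opp d then X.cnt x + 1 else X.cnt x
  let old : Port D → Option (Port D)
    | .point x i =>
        if x = d then (if i = 0 then none else some (.point d (i - 1)))
        else if x = S.opp d ∧ i = X.cnt d then some (.vertex (S.rot d))
        else some (.point x i)
    | .vertex x => if x = S.rot d then none else some (.vertex x)
  { cnt := cnt'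
    joined := fun p q => X.renamed cnt' old p q ∨ IsPair (.vertex d) (.point d 0) p q
    comps := X.comps }

/-- Isotope the component that is the edge of `f` into the triangle on the right of `f`, which is
the one on the clockwise side at the initial vertex of `f`. -/
def pushCW (X : Diagram D) (S : TriSurface D) (f : D) : Diagram D where
  cnt := X.cnt
  joined p q := X.joined p q ∨ IsPair (.vertex (S.opp f)) (.vertex (S.rot f)) p q
  comps := X.comps \ {f, S.opp f}

/-- Isotope the component that is the edge of `f` into the triangle on the left of `f`, which is
the one on the counterclockwise side at the initial vertex of `f`. -/
def pushCCW (X : Diagram D) (S : TriSurface D) (f : D) : Diagram D where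
  cnt := X.cnt
  joined p q := X.joined p q ∨ IsPair (.vertex f) (.vertex (S.next f)) p q
  comps := X.comps \ {f, S.opp f}

/-- One step of winding the end of a multicurve at the initial vertex of `d` clockwise around this
vertex, until it is in the corner `d`. -/
inductive StepCW (S : TriSurface D) (d : D) : Diagram D → Diagram D → Prop
  | push (X : Diagram D) (f : D) (hf : f ∈ X.comps) (h : S.SameVertex f d) :
      StepCW S d X (X.pushCW S f)
  | wind (X : Diagram D) (c : D) (hc : X.HasEnd c) (h : S.SameVertex c d) (hcd : c ≠ d) :
      StepCW S d X (X.windCW S c)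

/-- One step of winding the end of a multicurve at the initial vertex of `d` counterclockwise around
this vertex, until it is in the corner `rot d`. -/
inductive StepCCW (S : TriSurface D) (d : D) : Diagram D → Diagram D → Prop
  | push (X : Diagram D) (f : D) (hf : f ∈ X.comps) (h : S.SameVertex f d) :
      StepCCW S d X (X.pushCCW S f)
  | wind (X : Diagram D) (c : D) (hc : X.HasEnd (S.rot c)) (h : S.SameVertex c d) (hcd : c ≠ d) :
      StepCCW S d X (X.windCCW S c)

/-- If an arc ends at the initial vertex of `d`, then it does so in the corner `c`. -/
def EndsOnlyIn (X : Diagram D) (S : TriSurface D) (d c : D) : Prop :=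
  (∀ f, S.SameVertex f d → f ∉ X.comps) ∧ (∀ x, S.SameVertex x d → X.HasEnd x → x = c)

/-- `X'` arises from `X` by an isotopy that does not cross the edge of `d`, and that winds the end
of the multicurve at the initial vertex of `d` (if there is one) clockwise around this vertex up to
the edge of `d`. -/
def WindsCW (S : TriSurface D) (d : D) (X X' : Diagram D) : Prop :=
  Relation.ReflTransGen (StepCW S d) X X' ∧ X'.EndsOnlyIn S d d

/-- The same, with the end wound counterclockwise up to the edge of `d`. -/
def WindsCCW (S : TriSurface D) (d : D) (X X' : Diagram D) : Prop :=
  Relation.ReflTransGen (StepCCW S d) X X' ∧ X'.EndsOnlyIn S d (S.rot d)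

/-! ### Smoothing the crossings with an edge

Draw the edge `e` vertically, directed upwards.  The triangle of `e` is on its left and the triangle
of `opp e` on its right.  The crossing points of the multicurve with `e` cut `e` into segments.

In the positive smoothing, at every crossing the upper half of `e` is connected to the left half of
the multicurve and the lower half of `e` to the right half.  At the top vertex, an arc that arrives
from the right is connected to the top segment of `e`; at the bottom vertex, an arc that
arrives from the left is connected to the bottom segment.  So every segment of `e` connects a strand
on the left to a strand on the right, crossing `e` once, except that the top segment ends at the top
vertex if there is no such arc, and likewise at the bottom.  The negative smoothing is the
mirror image. -/

open Classical in
/-- The number of crossings of the multicurve with an edge, including the crossings at the two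
endpoints of the edge; `c` and `c'` are the corners where arcs arrive at these endpoints. -/
def crossings (X : Diagram D) (e c c' : D) : ℕ :=
  X.cnt e + (if X.HasEnd c then 1 else 0) + (if X.HasEnd c' then 1 else 0)

open Classical in
/-- The ports at the side `d` in their order along `d`, the end in the corner `d` included if there
is one. -/
def posSeq (X : Diagram D) (d : D) (i : ℕ) : Port D :=
  if X.HasEnd d then (if i = 0 then .vertex d else .point d (i - 1)) else .point d i

open Classical in
/-- The last index of `posSeq X d`. -/
def posLast (X : Diagram D) (d : D) : ℕ := X.cnt d + (if X.HasEnd d then 1 else 0) - 1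

open Classical in
/-- The result of smoothing all crossings of `X` and `e` positively, for a multicurve `X` whose ends
at the endpoints of `e`, if there are any, are in the corners `e` and `opp e`. -/
def posSmooth (X : Diagram D) (S : TriSurface D) (e : D) : Diagram D :=
  let k := X.crossings e e (S.opp e)
  let cnt' : D → ℕ := fun x => if x = e ∨ x = S.opp e then k - 1 else X.cnt x
  let old : Port D → Option (Port D)
    | .point x i => if x = e ∨ x = S.opp e then some (X.posSeq x i) else some (.point x i)
    | .vertex x =>
        if (x = e ∨ x = S.opp e) ∧ X.HasEnd x then none
        else if x = S.next e ∧ ¬ X.HasEnd (S.opp e) then some (X.posSeq e (X.posLast e))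
        else if x = S.next (S.opp e) ∧ ¬ X.HasEnd e then
          some (X.posSeq (S.opp e) (X.posLast (S.opp e)))
        else some (.vertex x)
  { cnt := cnt'
    joined := X.renamed cnt' old
    comps := if k = 0 then X.comps ∪ {e, S.opp e} else X.comps }

open Classical in
/-- The ports at the side `d` in their order along `d`, the end in the corner `next d` at the
terminal vertex of `d` included if there is one. -/
def negSeq (X : Diagram D) (S : TriSurface D) (d : D) (i : ℕ) : Port D :=
  if i < X.cnt d then .point d i else if i = X.cnt d then .vertex (S.next d) else .point d i

open Classical in
/-- The result of smoothing all crossings of `X` and `e` negatively, for a multicurve `X` whose ends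
at the endpoints of `e`, if there are any, are in the corners `rot e = next (opp e)` and
`rot (opp e) = next e`. -/
def negSmooth (X : Diagram D) (S : TriSurface D) (e : D) : Diagram D :=
  let k := X.crossings e (S.rot e) (S.rot (S.opp e))
  let cnt' : D → ℕ := fun x => if x = e ∨ x = S.opp e then k - 1 else X.cnt x
  let old : Port D → Option (Port D)
    | .point x i =>
        if x = e ∨ x = S.opp e then
          some (X.negSeq S x (if X.HasEnd (S.rot x) then i else i + 1))
        else some (.point x i)
    | .vertex x =>
        if (x = S.next e ∨ x = S.next (S.opp e)) ∧ X.HasEnd x then none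
        else if (x = e ∨ x = S.opp e) ∧ ¬ X.HasEnd (S.rot x) then some (X.negSeq S x 0)
        else some (.vertex x)
  { cnt := cnt'
    joined := X.renamed cnt' old
    comps := if k = 0 then X.comps ∪ {e, S.opp e} else X.comps }

/-- Remove the component that is the edge of `e`. -/
def eraseEdge (X : Diagram D) (S : TriSurface D) (e : D) : Diagram D :=
  { X with comps := X.comps \ {e, S.opp e} }

/-- The dart `x` starts at an endpoint of the edge of `e`, and is not on this edge. -/
def IsSpoke (S : TriSurface D) (e x : D) : Prop :=
  (S.SameVertex x e ∨ S.SameVertex x (S.opp e)) ∧ x ≠ e ∧ x ≠ S.opp e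

open Classical in
/-- Replace the component that is the edge of `e` by the loop that is the boundary of a small
neighbourhood of this edge.  The loop crosses every other edge at an endpoint of `e` once, next to
this endpoint; it cuts off the corners at the endpoints of `e` that are not in the two triangles at
`e`, and in these two triangles it cuts off the corner opposite to `e`. -/
def encircle (X : Diagram D) (S : TriSurface D) (e : D) : Diagram D :=
  let new : D → ℕ := fun x => if IsSpoke S e x then 1 else 0
  let cnt' : D → ℕ := fun x => X.cnt x + new x + new (S.opp x)
  let rename : Port D → Port D
    | .point x i => .point x (i + new x)
    | .vertex x => .vertex x
  { cnt := cnt'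
    joined := fun p q =>
      (∃ p₀ q₀, p = rename p₀ ∧ q = rename q₀ ∧ X.joined p₀ q₀) ∨
      (∃ c, IsSpoke S e c ∧ IsSpoke S e (S.opp (S.prev c)) ∧
        IsPair (.point c 0) (.point (S.prev c) (cnt' (S.prev c) - 1)) p q) ∨
      (∃ d, (d = e ∨ d = S.opp e) ∧
        IsPair (.point (S.next d) 0) (.point (S.prev d) (cnt' (S.prev d) - 1)) p q)
    comps := X.comps \ {e, S.opp e} }

/-- `Y` is obtained from the union of the edge of `e` and the reduced multicurve `α` by the
positive resolution of every crossing.  If the edge is itself a component of `α`, this component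
together with `e` is replaced by the loop around the edge. -/
def PosSmoothing (S : TriSurface D) (e : D) (α Y : Diagram D) : Prop :=
  (e ∈ α.comps ∧ Y = α.encircle S e) ∨
  (e ∉ α.comps ∧ ∃ X₁ X₂, WindsCW S e α X₁ ∧ WindsCW S (S.opp e) X₁ X₂ ∧ Y = X₂.posSmooth S e)

/-- `Y` is obtained from the union of the edge of `e` and the reduced multicurve `α` by the
negative resolution of every crossing.  If the edge is itself a component of `α`, the resolution is
`-2` times the multicurve without this component; here the scalar `-2` is dropped. -/
def NegSmoothing (S : TriSurface D) (e : D) (α Y : Diagram D) : Prop :=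
  (e ∈ α.comps ∧ Y = α.eraseEdge S e) ∨
  (e ∉ α.comps ∧ ∃ X₁ X₂, WindsCCW S e α X₁ ∧ WindsCCW S (S.opp e) X₁ X₂ ∧ Y = X₂.negSmooth S e)

end Diagram

/-! ### Reduced multicurves and the two resolution maps -/

variable {D : Type*}

/-- The reduced multicurves up to isotopy.  A curve without turn-backs is determined, up to isotopy,
by its picture: the number of crossing points on the edges and the strands between them. -/
def RMC (S : TriSurface D) : Set (Diagram D) := {α | α.IsReduced S}

open Classical in
/-- The reduced multicurves that share exactly `j` endpoints with the edge of `e`. -/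
def RMCshare (S : TriSurface D) (e : D) (j : ℕ) : Set (Diagram D) :=
  {α | α ∈ RMC S ∧
    (if α.EndsAt S e then 1 else 0) + (if α.EndsAt S (S.opp e) then 1 else 0) = j}

/-- `β` is a reduced multicurve isotopic to the positive resolution of `e` and `α`. -/
def IsPositiveResolution (S : TriSurface D) (e : D) (α β : Diagram D) : Prop :=
  β ∈ RMC S ∧ ∃ Y, Diagram.PosSmoothing S e α Y ∧ Relation.ReflTransGen (Diagram.Tighten S) Y β

/-- `β` is a reduced multicurve isotopic to the negative resolution of `e` and `α`. -/
def IsNegativeResolution (S : TriSurface D) (e : D) (α β : Diagram D) : Prop :=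
  β ∈ RMC S ∧ ∃ Y, Diagram.NegSmoothing S e α Y ∧ Relation.ReflTransGen (Diagram.Tighten S) Y β

end

/-!
# Injectivity of the positive and the negative resolution

Suppose first that `e` is not a component of `α`.  The ends of `α` at the endpoints of `e` are wound
clockwise up to `e`, and all `k` crossings with `e`, those at the endpoints included, are smoothed.
For `k = 0` this adds `e` to `α`.  For `k ≥ 1` the crossings of the result with `e` are those of the
`k - 1` segments of `e` between the crossings, and the outcome is again an embedded multicurve, which
is tight except at the endpoints of `e`, where its ends are wound up.  Pulling these ends tight turns
them clockwise, away from `e`, and the only moves that occur are pulling an end across a side and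
pushing an arc onto an edge (`Diagram.Unwinding`).  These moves commute, so that the reduced form `β`
is unique (`Unwinding.eq_of_tighten`).

The key point is that, for `k ≥ 1`, *the negative resolution undoes the positive one*.  Every move on
the way to `β` is undone by a counterclockwise winding of the same end, so that winding the ends of
`β` counterclockwise up to `e` gives back the positive smoothing (`Unwinding.exists_reduced`).
The negative smoothing of that is the multicurve from which the positive smoothing started
(`Wound.negSmooth_posSmooth`), and this can be tightened to `α`.  Hence `α` is the negative resolution
of `β`, and since the reduced form of the negative resolution is unique as well, `α` is determined by
`β`.  All statements about negative resolutions follow from those about positive ones by reversing the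
orientation of the surface (`TriSurface.mirror`).

That the ends can be wound up at all, and that they do not meet `e` again while they are pulled tight,
both rest on `exists_uncut`: at every vertex, a reduced multicurve leaves some corner uncut, because
otherwise the innermost strands would form a loop around the puncture.  An uncut corner stays uncut
under winding and smoothing (`Wound.posSmooth_uncut`), and an end that turns around the vertex is tight
once it arrives there.

If `e` is a component of `α`, the resolutions are the loop around `e` together with the rest of `α`,
and the rest of `α` alone; `α` can be read off from either.  The loop around `e` is a loop around a
puncture only if the two triangles at `e` make up the whole surface, which is then the three-punctured
sphere (`encircle_isReduced`).

The cases do not interfere with each other (`ResolvesTo.inj`).  The resolution contains `e` as a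
component exactly if `e` is disjoint from `α`.  If `e` is a component of `α`, then the result does not
cross `e`; if `e` is not a component but has both endpoints in common with `α`, then `k ≥ 2`, and the
result crosses `e` at least once.
-/

noncomputable section

set_option linter.unusedSimpArgs false

/-! ### Darts and corners -/

namespace TriSurface

variable {D : Type*}

@[simp] lemma next_prev (S : TriSurface D) (d : D) : S.next (S.prev d) = d := S.next_next_next d
@[simp] lemma prev_next (S : TriSurface D) (d : D) : S.prev (S.next d) = d := S.next_next_next d
@[simp] lemma next_next (S : TriSurface D) (d : D) : S.next (S.next d) = S.prev d := rfl
@[simp] lemma prev_prev (S : TriSurface D) (d : D) : S.prev (S.prev d) = S.next d := by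
  unfold prev; rw [S.next_next_next]

lemma rot_eq (S : TriSurface D) (d : D) : S.rot d = S.next (S.opp d) := rfl
@[simp] lemma prev_rot (S : TriSurface D) (d : D) : S.prev (S.rot d) = S.opp d := by simp [rot_eq]
lemma rot_opp (S : TriSurface D) (d : D) : S.rot (S.opp d) = S.next d := by
  simp [rot_eq, S.opp_opp]
lemma rot_opp_prev (S : TriSurface D) (d : D) : S.rot (S.opp (S.prev d)) = d := by
  simp [rot_opp]

lemma next_inj (S : TriSurface D) {a b : D} : S.next a = S.next b ↔ a = b := S.next.injective.eq_iff
lemma opp_inj (S : TriSurface D) {a b : D} : S.opp a = S.opp b ↔ a = b := S.opp.injective.eq_iff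
lemma prev_ne (S : TriSurface D) (d : D) : S.prev d ≠ d := fun h =>
  S.next_ne d (by conv_lhs => rw [← h, next_prev])
lemma next_ne_prev (S : TriSurface D) (d : D) : S.next d ≠ S.prev d := fun h =>
  S.next_ne d ((S.next_inj.1 (show S.next (S.next d) = S.next d from h.symm)))
lemma eq_next_iff (S : TriSurface D) {a b : D} : a = S.next b ↔ b = S.prev a :=
  ⟨fun h => by simp [h], fun h => by simp [h]⟩
lemma eq_opp_iff (S : TriSurface D) {a b : D} : a = S.opp b ↔ b = S.opp a :=
  ⟨fun h => by simp [h, S.opp_opp], fun h => by simp [h, S.opp_opp]⟩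

lemma SameVertex.rfl {S : TriSurface D} {d : D} : S.SameVertex d d := Equiv.Perm.SameCycle.refl _ _
lemma SameVertex.symm {S : TriSurface D} {a b : D} (h : S.SameVertex a b) : S.SameVertex b a :=
  Equiv.Perm.SameCycle.symm h
lemma SameVertex.trans {S : TriSurface D} {a b c : D} (h : S.SameVertex a b)
    (h' : S.SameVertex b c) : S.SameVertex a c := Equiv.Perm.SameCycle.trans h h'
lemma sameVertex_rot (S : TriSurface D) (d : D) : S.SameVertex d (S.rot d) := ⟨1, by simp⟩
lemma sameVertex_next (S : TriSurface D) (d : D) : S.SameVertex (S.opp d) (S.next d) := by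
  rw [← S.rot_opp]; exact S.sameVertex_rot _
lemma sameVertex_opp_prev (S : TriSurface D) (d : D) : S.SameVertex (S.opp (S.prev d)) d := by
  simpa using S.sameVertex_next (S.prev d)

/-- The edges of the triangulation form no one-cycle and no two-cycle. -/
structure Simple (S : TriSurface D) : Prop where
  no_one_cycle : ∀ d, ¬ S.SameVertex d (S.next d)
  no_two_cycle : ∀ d d', S.SameVertex d d' → S.SameVertex (S.next d) (S.next d') → d = d'

lemma LocallyPlanar.simple {S : TriSurface D} (h : S.LocallyPlanar) : S.Simple :=
  ⟨h.no_one_cycle, h.no_two_cycle⟩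

namespace Simple

variable {S : TriSurface D}

lemma not_sameVertex_opp (hS : S.Simple) (d : D) : ¬ S.SameVertex d (S.opp d) := fun h =>
  hS.no_one_cycle d (h.trans (S.sameVertex_next d))

lemma not_sameVertex_prev (hS : S.Simple) (d : D) : ¬ S.SameVertex d (S.prev d) := fun h =>
  hS.no_one_cycle (S.prev d) (by simpa using h.symm)

lemma not_sameVertex_next_prev (hS : S.Simple) (d : D) : ¬ S.SameVertex (S.next d) (S.prev d) :=
  hS.no_one_cycle (S.next d)

lemma opp_ne_next (hS : S.Simple) (d : D) : S.opp d ≠ S.next d := fun h =>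
  hS.not_sameVertex_prev d (by
    have := S.sameVertex_rot d
    rwa [rot_eq, h, next_next] at this)

lemma opp_ne_prev (hS : S.Simple) (d : D) : S.opp d ≠ S.prev d := fun h =>
  hS.opp_ne_next (S.prev d) (by rw [← h, S.opp_opp, h, next_prev])

lemma rot_ne (hS : S.Simple) (d : D) : S.rot d ≠ d := fun h =>
  hS.opp_ne_prev d (by rw [← S.prev_rot, h])

/-- Two darts from the endpoints of an edge to each other. -/
lemma eq_opp (hS : S.Simple) {a b : D} (h : S.SameVertex a (S.opp b))
    (h' : S.SameVertex (S.opp a) b) : a = S.opp b :=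
  hS.no_two_cycle _ _ h (by
    refine (S.sameVertex_next a).symm.trans (h'.trans ?_)
    simpa [S.opp_opp] using S.sameVertex_next (S.opp b))

lemma eq_of_sameVertex (hS : S.Simple) {a b : D} (h : S.SameVertex a b)
    (h' : S.SameVertex (S.opp a) (S.opp b)) : a = b := by
  have := hS.eq_opp (a := a) (b := S.opp b) (by simpa [S.opp_opp] using h) h'
  simpa [S.opp_opp] using this

end Simple

/-- `x` is a side of the triangle of `b`. -/
def InTri (S : TriSurface D) (b x : D) : Prop := x = b ∨ x = S.next b ∨ x = S.prev b

open Classical in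
/-- The position of a side in its triangle, counted from the side `b`. -/
def place (S : TriSurface D) (b x : D) : ℕ :=
  if x = b then 0 else if x = S.next b then 1 else if x = S.prev b then 2 else 3

lemma place_self (S : TriSurface D) (b : D) : S.place b b = 0 := by simp [place]
lemma place_next (S : TriSurface D) (b : D) : S.place b (S.next b) = 1 := by
  simp [place, S.next_ne]
lemma place_prev (S : TriSurface D) (b : D) : S.place b (S.prev b) = 2 := by
  simp [place, S.prev_ne, (S.next_ne_prev b).symm]

lemma inTri_iff_place (S : TriSurface D) (b x : D) : S.InTri b x ↔ S.place b x < 3 := by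
  unfold InTri place; split_ifs <;> simp_all

lemma place_inj (S : TriSurface D) {b x y : D} (hx : S.place b x < 3)
    (h : S.place b x = S.place b y) : x = y := by
  unfold place at *; split_ifs at * <;> simp_all

lemma place_next_base (S : TriSurface D) (b x : D) : S.place (S.next b) x =
    if S.place b x = 0 then 2 else if S.place b x < 3 then S.place b x - 1 else 3 := by
  have h1 := S.next_ne b; have h2 := S.prev_ne b; have h3 := S.next_ne_prev b
  by_cases hx : x = b
  · subst hx; simp [place, h1.symm, h2.symm]
  by_cases hx' : x = S.next b
  · subst hx'; simp [place_self, place_next]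
  by_cases hx'' : x = S.prev b
  · subst hx''; simp [place, h2, h3.symm]
  · simp [place, hx, hx', hx'']

lemma InTri.symm {S : TriSurface D} {a b : D} (h : S.InTri a b) : S.InTri b a := by
  rcases h with rfl | rfl | rfl <;> simp [InTri]

lemma InTri.trans {S : TriSurface D} {a b c : D} (h : S.InTri a b) (h' : S.InTri b c) :
    S.InTri a c := by
  rcases h with rfl | rfl | rfl <;> rcases h' with rfl | rfl | rfl <;> simp [InTri]

lemma InTri.rfl {S : TriSurface D} {a : D} : S.InTri a a := Or.inl _root_.rfl
lemma inTri_next (S : TriSurface D) (a : D) : S.InTri a (S.next a) := Or.inr (Or.inl _root_.rfl)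
lemma inTri_prev (S : TriSurface D) (a : D) : S.InTri a (S.prev a) := Or.inr (Or.inr _root_.rfl)

lemma Simple.not_inTri_opp {S : TriSurface D} (hS : S.Simple) (d : D) : ¬ S.InTri d (S.opp d) := by
  rintro (h | h | h)
  exacts [S.opp_ne d h, hS.opp_ne_next d h, hS.opp_ne_prev d h]

end TriSurface

namespace Port

variable {D : Type*}

@[simp] lemma dart_point (d : D) (i : ℕ) : (Port.point d i).dart = d := rfl
@[simp] lemma dart_vertex (d : D) : (Port.vertex d).dart = d := rfl
@[simp] lemma rank_point (d : D) (i : ℕ) : (Port.point d i).rank = i + 1 := rfl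
@[simp] lemma rank_vertex (d : D) : (Port.vertex d).rank = 0 := rfl
@[simp] lemma valid_point {cnt : D → ℕ} (d : D) (i : ℕ) :
    (Port.point d i).Valid cnt ↔ i < cnt d := Iff.rfl
@[simp] lemma valid_vertex {cnt : D → ℕ} (d : D) : (Port.vertex d).Valid cnt ↔ True := Iff.rfl

lemma ext_dart_rank {p q : Port D} (h : p.dart = q.dart) (h' : p.rank = q.rank) : p = q := by
  cases p <;> cases q <;> simp_all

end Port

/-! ### Planar systems of strands -/

namespace Diagram

variable {D : Type*} {S : TriSurface D}

lemma before_iff (b : D) (p q : Port D) : Before S b p q ↔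
    S.place b p.dart < 3 ∧ S.place b q.dart < 3 ∧ (S.place b p.dart < S.place b q.dart ∨
      S.place b p.dart = S.place b q.dart ∧ p.rank < q.rank) := by
  have h1 := S.next_ne b; have h2 := S.prev_ne b; have h3 := S.next_ne_prev b
  constructor
  · rintro (⟨h, h', h''⟩ | ⟨h, h', h''⟩ | ⟨h, h', h''⟩ | ⟨h, h' | h'⟩ | ⟨h, h'⟩) <;> rw [h, h'] <;>
      simp [TriSurface.place_self, TriSurface.place_next, TriSurface.place_prev] <;> assumption
  · rintro ⟨hp, hq, h⟩
    rw [← TriSurface.inTri_iff_place] at hp hq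
    unfold Before
    rcases hp with hp | hp | hp <;> rcases hq with hq | hq | hq <;> rw [hp, hq] at h <;>
      simp [TriSurface.place_self, TriSurface.place_next, TriSurface.place_prev] at h <;>
      simp [hp, hq, h, h1, h2, h3, h3.symm, h1.symm, h2.symm]

lemma Before.trans {b : D} {p q r : Port D} (h : Before S b p q) (h' : Before S b q r) :
    Before S b p r := by
  rw [before_iff] at *; omega

lemma before_total {b : D} {p q : Port D} (hp : S.InTri b p.dart) (hq : S.InTri b q.dart) :
    Before S b p q ∨ p = q ∨ Before S b q p := by
  rw [before_iff, before_iff]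
  rw [TriSurface.inTri_iff_place] at hp hq
  by_cases h : S.place b p.dart = S.place b q.dart
  · have := S.place_inj hp h
    have h2 : p.rank = q.rank → p = q := Port.ext_dart_rank this
    by_cases h3 : p.rank = q.rank
    · exact Or.inr (Or.inl (h2 h3))
    · omega
  · omega

lemma Before.inTri_left {b : D} {p q : Port D} (h : Before S b p q) : S.InTri b p.dart := by
  rw [before_iff] at h; rw [TriSurface.inTri_iff_place]; exact h.1

lemma Before.inTri_right {b : D} {p q : Port D} (h : Before S b p q) : S.InTri b q.dart := by
  rw [before_iff] at h; rw [TriSurface.inTri_iff_place]; exact h.2.1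

lemma Before.ne {b : D} {p q : Port D} (h : Before S b p q) : p ≠ q := by
  rintro rfl
  rw [before_iff] at h; omega

lemma Before.asymm {b : D} {p q : Port D} (h : Before S b p q) : ¬ Before S b q p := by
  rw [before_iff] at *; omega

lemma before_next_iff (b : D) (p q : Port D) : Before S (S.next b) p q ↔
    (p.dart ≠ b ∧ S.InTri b p.dart ∧ q.dart = b) ∨
      ((p.dart = b ↔ q.dart = b) ∧ Before S b p q) := by
  have hz : ∀ x, x = b ↔ S.place b x = 0 := fun x =>
    ⟨fun h => by rw [h, TriSurface.place_self], fun h => by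
      unfold TriSurface.place at h; split_ifs at h; assumption⟩
  simp only [before_iff, TriSurface.place_next_base, TriSurface.inTri_iff_place, ne_eq, hz]
  by_cases hp : S.place b p.dart = 0 <;> by_cases hq : S.place b q.dart = 0 <;>
    by_cases hp' : S.place b p.dart < 3 <;> by_cases hq' : S.place b q.dart < 3 <;>
    simp [hp, hq, hp', hq'] <;> omega

/-- No two strands in the triangle of `b` cross. -/
def NonCrossingAt (S : TriSurface D) (J : Port D → Port D → Prop) (b : D) : Prop :=
  ∀ p q r s, J p q → J r s → ¬ (Before S b p r ∧ Before S b r q ∧ Before S b q s)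

/-- Whether strands cross does not depend on the side from which the boundary of the triangle is
read. -/
lemma NonCrossingAt.next {J : Port D → Port D → Prop} (hs : ∀ p q, J p q → J q p) {b : D}
    (h : NonCrossingAt S J b) : NonCrossingAt S J (S.next b) := by
  rintro p q r s hpq hrs ⟨h1, h2, h3⟩
  have e1 := h p q r s hpq hrs
  have e2 := h s r p q (hs _ _ hrs) hpq
  have e3 := h q p s r (hs _ _ hpq) (hs _ _ hrs)
  have e4 := h r s q p hrs (hs _ _ hpq)
  have t1 := @Before.trans _ S b
  have t2 : ∀ x y : Port D, x.dart = b → y.dart ≠ b → S.InTri b y.dart → Before S b x y := by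
    intro x y hx hy hy'
    rw [before_iff, hx, TriSurface.place_self]
    rw [TriSurface.inTri_iff_place] at hy'
    refine ⟨by omega, hy', Or.inl (Nat.pos_of_ne_zero fun h => hy ?_)⟩
    unfold TriSurface.place at h; split_ifs at h; assumption
  rw [before_next_iff] at h1 h2 h3
  have i1 := @Before.inTri_left _ S b
  have i2 := @Before.inTri_right _ S b
  by_cases hp : p.dart = b <;> by_cases hq : q.dart = b <;> by_cases hr : r.dart = b <;>
    by_cases hs' : s.dart = b <;> simp [hp, hq, hr, hs'] at h1 h2 h3 <;> grind

lemma NonCrossingAt.of_inTri {J : Port D → Port D → Prop} (hs : ∀ p q, J p q → J q p) {b b' : D}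
    (hb : S.InTri b b') (h : NonCrossingAt S J b) : NonCrossingAt S J b' := by
  rcases hb with rfl | rfl | rfl
  · exact h
  · exact h.next hs
  · exact (h.next hs).next hs

/-- A system of strands in the triangles, no two of which cross or have a common end. -/
structure Planar (S : TriSurface D) (J : Port D → Port D → Prop) : Prop where
  symm : ∀ p q, J p q → J q p
  ne : ∀ p q, J p q → p ≠ q
  inTri : ∀ p q, J p q → S.InTri p.dart q.dart
  unique : ∀ p q q', J p q → J p q' → q = q'
  noncrossing : ∀ b, NonCrossingAt S J b

/-- A strand with one end on one side of another strand has its other end on that side, too. -/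
lemma Planar.enclosed {J : Port D → Port D → Prop} (hJ : Planar S J) {b : D} {p q r s : Port D}
    (hpq : J p q) (hrs : J r s) (h1 : Before S b p r) (h2 : Before S b r q) :
    Before S b p s ∧ Before S b s q := by
  have hs : S.InTri b s.dart := h1.inTri_right.trans (hJ.inTri _ _ hrs)
  have hsp : s ≠ p := by
    rintro rfl
    exact h2.ne (hJ.unique _ _ _ (hJ.symm _ _ hrs) hpq)
  have hsq : s ≠ q := by
    rintro rfl
    exact h1.ne (hJ.unique _ _ _ (hJ.symm _ _ hpq) (hJ.symm _ _ hrs))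
  rcases before_total hs h1.inTri_left with h | h | h
  · exact absurd ⟨h, h1, h2⟩ (hJ.noncrossing b _ _ _ _ (hJ.symm _ _ hrs) hpq)
  · exact absurd h hsp
  rcases before_total hs h2.inTri_right with h' | h' | h'
  · exact ⟨h, h'⟩
  · exact absurd h' hsq
  · exact absurd ⟨h1, h2, h'⟩ (hJ.noncrossing b _ _ _ _ hpq hrs)

/-- Renaming the ports keeps a system of strands planar, if the order of the ports along the
boundary of every triangle, read from a suitable side, is kept. -/
lemma Planar.renamed {X : Diagram D} {cnt' : D → ℕ} {old : Port D → Option (Port D)}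
    (hJ : Planar S X.joined)
    (inj : ∀ p p' r, p.Valid cnt' → p'.Valid cnt' → old p = some r → old p' = some r → p = p')
    (tri : ∀ p r, p.Valid cnt' → old p = some r → S.InTri r.dart p.dart)
    (mono : ∀ b, ∃ b', S.InTri b' b ∧ ∀ p q r s p' q', p.Valid cnt' → q.Valid cnt' →
      old p = some r → old q = some s → X.joined r p' → X.joined s q' → Before S b' p q →
      Before S b' r s) : Planar S (X.renamed cnt' old) := by
  have symm : ∀ p q, X.renamed cnt' old p q → X.renamed cnt' old q p := by
    rintro p q ⟨hp, hq, p₀, q₀, h1, h2, h⟩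
    exact ⟨hq, hp, q₀, p₀, h2, h1, hJ.symm _ _ h⟩
  refine ⟨symm, ?_, ?_, ?_, ?_⟩
  · rintro p q ⟨hp, hq, p₀, q₀, h1, h2, h⟩ rfl
    rw [h1] at h2
    exact hJ.ne _ _ h (Option.some.inj h2)
  · rintro p q ⟨hp, hq, p₀, q₀, h1, h2, h⟩
    exact ((tri _ _ hp h1).symm.trans (hJ.inTri _ _ h)).trans (tri _ _ hq h2)
  · rintro p q q' ⟨hp, hq, p₀, q₀, h1, h2, h⟩ ⟨hp', hq', p₀', q₀', h1', h2', h'⟩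
    obtain rfl : p₀ = p₀' := Option.some.inj (h1.symm.trans h1')
    obtain rfl := hJ.unique _ _ _ h h'
    exact inj _ _ _ hq hq' h2 h2'
  · intro b
    obtain ⟨b', hb, hm⟩ := mono b
    refine NonCrossingAt.of_inTri symm hb ?_
    rintro p q r s ⟨hp, hq, p₀, q₀, h1, h2, h⟩ ⟨hr, hs, r₀, s₀, h3, h4, h'⟩ ⟨e1, e2, e3⟩
    exact hJ.noncrossing b' _ _ _ _ h h'
      ⟨hm _ _ _ _ _ _ hp hr h1 h3 h h' e1, hm _ _ _ _ _ _ hr hq h3 h2 h' (hJ.symm _ _ h) e2,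
        hm _ _ _ _ _ _ hq hs h2 h4 (hJ.symm _ _ h) (hJ.symm _ _ h') e3⟩

/-- New strands between ports that are neighbours on the boundary of a triangle can be added to a
planar system. -/
lemma Planar.add {J K : Port D → Port D → Prop} (hJ : Planar S J)
    (symm : ∀ p q, K p q → K q p) (unique : ∀ p q q', K p q → K p q' → q = q')
    (disj : ∀ p q q', K p q → ¬ J p q')
    (adj : ∀ p q, K p q → p ≠ q ∧ ∃ b, S.InTri b p.dart ∧ S.InTri b q.dart ∧
      ∀ r s, (J r s ∨ K r s) → ¬ (Before S b p r ∧ Before S b r q) ∧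
        ¬ (Before S b q r ∧ Before S b r p)) :
    Planar S (fun p q => J p q ∨ K p q) := by
  have hsymm : ∀ p q, (J p q ∨ K p q) → (J q p ∨ K q p) := by
    rintro p q (h | h)
    exacts [Or.inl (hJ.symm _ _ h), Or.inr (symm _ _ h)]
  refine ⟨hsymm, ?_, ?_, ?_, ?_⟩
  · rintro p q (h | h)
    exacts [hJ.ne _ _ h, (adj _ _ h).1]
  · rintro p q (h | h)
    · exact hJ.inTri _ _ h
    · obtain ⟨-, b, h1, h2, -⟩ := adj _ _ h
      exact h1.symm.trans h2
  · rintro p q q' (h | h) (h' | h')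
    exacts [hJ.unique _ _ _ h h', absurd h (disj _ _ _ h'), absurd h' (disj _ _ _ h),
      unique _ _ _ h h']
  · intro b
    -- a strand with adjacent ends crosses no other strand
    have key : ∀ b p q r s, K p q → (J r s ∨ K r s) →
        ¬ (Before S b p r ∧ Before S b r q ∧ Before S b q s) ∧
        ¬ (Before S b r p ∧ Before S b p s ∧ Before S b s q) := by
      intro b p q r s h h'
      obtain ⟨-, b', h1, h2, hb⟩ := adj _ _ h
      have hr := hb _ _ h'
      have hs := hb _ _ (hsymm _ _ h')
      by_cases hbp : S.InTri b p.dart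
      · have hn : NonCrossingAt S (fun x y => IsPair p q x y ∨ IsPair r s x y) b := by
          refine NonCrossingAt.of_inTri (b := b') ?_ (h1.trans hbp.symm) ?_
          · rintro x y ((h | h) | (h | h)) <;> simp [IsPair, h]
          · rintro x y z w hxy hzw ⟨e1, e2, e3⟩
            have a1 := e1.trans e2
            have a2 := e2.trans e3
            have a3 := e1.asymm
            have a4 := e2.asymm
            have a5 := e3.asymm
            rcases hxy with (⟨rfl, rfl⟩ | ⟨rfl, rfl⟩) | (⟨rfl, rfl⟩ | ⟨rfl, rfl⟩) <;>
              rcases hzw with (⟨rfl, rfl⟩ | ⟨rfl, rfl⟩) | (⟨rfl, rfl⟩ | ⟨rfl, rfl⟩) <;>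
              first | exact e1.ne rfl | exact e2.ne rfl | exact e3.ne rfl | tauto
        exact ⟨hn p q r s (Or.inl (Or.inl ⟨rfl, rfl⟩)) (Or.inr (Or.inl ⟨rfl, rfl⟩)),
          hn r s p q (Or.inr (Or.inl ⟨rfl, rfl⟩)) (Or.inl (Or.inl ⟨rfl, rfl⟩))⟩
      · exact ⟨fun h => hbp h.1.inTri_left, fun h => hbp h.2.1.inTri_left⟩
    rintro p q r s (h | h) (h' | h')
    · exact hJ.noncrossing b _ _ _ _ h h'
    · exact (key b r s p q h' (Or.inl h)).2
    · exact (key b p q r s h (Or.inl h')).1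
    · exact (key b p q r s h (Or.inr h')).1

lemma Planar.mono {J K : Port D → Port D → Prop} (hJ : Planar S J) (hK : ∀ p q, K p q → J p q)
    (symm : ∀ p q, K p q → K q p) : Planar S K :=
  ⟨symm, fun _ _ h => hJ.ne _ _ (hK _ _ h), fun _ _ h => hJ.inTri _ _ (hK _ _ h),
    fun _ _ _ h h' => hJ.unique _ _ _ (hK _ _ h) (hK _ _ h'),
    fun b _ _ _ _ h h' => hJ.noncrossing b _ _ _ _ (hK _ _ h) (hK _ _ h')⟩

end Diagram

/-! ### Multicurves and their uncut corners -/

namespace Diagram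

variable {D : Type*} {S : TriSurface D}

lemma IsMulticurve.planar {X : Diagram D} (h : X.IsMulticurve S) : Planar S X.joined where
  symm := h.symm
  ne := h.ne
  inTri := h.sameTriangle
  unique := by
    intro p q q' h1 h2
    cases p with
    | point d i =>
      obtain ⟨r, -, hr⟩ := h.point_joined d i (h.valid _ _ h1)
      rw [hr _ h1, hr _ h2]
    | vertex c => exact (h.end_unique c c q q' TriSurface.SameVertex.rfl h1 h2).2
  noncrossing := fun b => h.noncrossing b

/-- The conditions on a multicurve, sorted into those on the strands, on the crossing points and on
the vertices. -/
lemma IsMulticurve.of_planar {X : Diagram D} (hJ : Planar S X.joined)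
    (cnt_opp : ∀ d, X.cnt (S.opp d) = X.cnt d)
    (valid : ∀ p q, X.joined p q → p.Valid X.cnt)
    (full : ∀ d i, i < X.cnt d → ∃ q, X.joined (.point d i) q)
    (comps_opp : ∀ d, d ∈ X.comps → S.opp d ∈ X.comps)
    (comps_cnt : ∀ d, d ∈ X.comps → X.cnt d = 0)
    (ends : ∀ c c', S.SameVertex c c' → X.HasEnd c → X.HasEnd c' → c = c')
    (end_comp : ∀ c f, S.SameVertex c f → X.HasEnd c → f ∉ X.comps)
    (comp_unique : ∀ f f', S.SameVertex f f' → f ∈ X.comps → f' ∈ X.comps → f = f') :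
    X.IsMulticurve S where
  cnt_opp := cnt_opp
  symm := hJ.symm
  ne := hJ.ne
  valid := valid
  sameTriangle := hJ.inTri
  point_joined d i hi := by
    obtain ⟨q, hq⟩ := full d i hi
    exact ⟨q, hq, fun q' hq' => hJ.unique _ _ _ hq' hq⟩
  noncrossing b := hJ.noncrossing b
  comps_opp := comps_opp
  comps_cnt := comps_cnt
  end_unique c c' q q' h h1 h2 := by
    obtain rfl := ends c c' h ⟨q, h1⟩ ⟨q', h2⟩
    exact ⟨rfl, hJ.unique _ _ _ h1 h2⟩
  end_not_comp c f q h h1 := end_comp c f h ⟨q, h1⟩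
  comp_unique := comp_unique

namespace IsMulticurve

variable {X : Diagram D}

lemma full (h : X.IsMulticurve S) {d : D} {i : ℕ} (hi : i < X.cnt d) :
    ∃ q, X.joined (.point d i) q := (h.point_joined d i hi).exists

lemma lt_cnt (h : X.IsMulticurve S) {d : D} {i : ℕ} {q : Port D} (hq : X.joined (.point d i) q) :
    i < X.cnt d := h.valid _ _ hq

lemma unique (h : X.IsMulticurve S) {p q q' : Port D} (h1 : X.joined p q) (h2 : X.joined p q') :
    q = q' := h.planar.unique _ _ _ h1 h2

lemma ends (h : X.IsMulticurve S) {c c' : D} (hc : S.SameVertex c c') (h1 : X.HasEnd c)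
    (h2 : X.HasEnd c') : c = c' := by
  obtain ⟨q, hq⟩ := h1
  obtain ⟨q', hq'⟩ := h2
  exact (h.end_unique c c' q q' hc hq hq').1

lemma end_comp (h : X.IsMulticurve S) {c f : D} (hc : S.SameVertex c f) (h1 : X.HasEnd c) :
    f ∉ X.comps := by
  obtain ⟨q, hq⟩ := h1
  exact h.end_not_comp c f q hc hq

end IsMulticurve

/-- No strand joins a side to itself. -/
def NoSideTurn (X : Diagram D) : Prop := ∀ d i j, ¬ X.joined (.point d i) (.point d j)

/-- A strand from a vertex to an adjacent side `c` ends at the crossing point next to the vertex. -/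
lemma IsMulticurve.vertex_point_eq_zero {X : Diagram D} (h : X.IsMulticurve S) (hX : X.NoSideTurn)
    {c : D} {i : ℕ} (hi : X.joined (.vertex c) (.point c i)) : i = 0 := by
  by_contra h0
  obtain ⟨q, hq⟩ := h.full (d := c) (i := 0) (by have := h.lt_cnt (h.symm _ _ hi); omega)
  obtain ⟨h1, h2⟩ := h.planar.enclosed (b := c) hi hq (by simp [Before]) (by
    simp [Before]; omega)
  have hc : q.dart = c := by
    simp [Before, (S.next_ne c).symm, (S.prev_ne c).symm] at h1 h2
    have := S.next_ne c; have := S.prev_ne c; have := S.next_ne_prev c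
    grind
  cases q with
  | point d j => obtain rfl : d = c := hc; exact hX _ _ _ hq
  | vertex d => obtain rfl : d = c := hc; exact h1.ne rfl

/-- A strand that is parallel to an edge cuts off no crossing points. -/
lemma IsMulticurve.cnt_eq_zero {X : Diagram D} (h : X.IsMulticurve S) (hX : X.NoSideTurn)
    {c : D} (hi : X.joined (.vertex c) (.vertex (S.next c))) : X.cnt c = 0 := by
  by_contra h0
  obtain ⟨q, hq⟩ := h.full (d := c) (i := 0) (by omega)
  obtain ⟨h1, h2⟩ := h.planar.enclosed (b := c) hi hq (by simp [Before]) (by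
    simp [Before])
  have hc : q.dart = c := by
    simp [Before, (S.next_ne c).symm, (S.prev_ne c).symm] at h1 h2
    have := S.next_ne c; have := S.prev_ne c; have := S.next_ne_prev c
    grind
  cases q with
  | point d j => obtain rfl : d = c := hc; exact hX _ _ _ hq
  | vertex d => obtain rfl : d = c := hc; exact h1.ne rfl

/-- No strand cuts off the corner `c`, that is, joins the two sides at this corner; and no arc that
ends in this corner starts out along one of these sides. -/
structure Uncut (X : Diagram D) (S : TriSurface D) (c : D) : Prop where
  point_point : ∀ i j, ¬ X.joined (.point c i) (.point (S.prev c) j)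
  vertex_point : ∀ i, ¬ X.joined (.vertex c) (.point c i)
  vertex_prev : ∀ i, ¬ X.joined (.vertex c) (.point (S.prev c) i)

lemma Uncut.no_puncture_loop {X : Diagram D} {c d : D} (h : X.Uncut S c) (hX : X.IsMulticurve S)
    (hc : S.SameVertex c d) : ¬ X.HasPunctureLoop S d := by
  rintro ⟨i, hi⟩
  obtain ⟨-, hj⟩ := hi (S.opp (S.prev c)) ((S.sameVertex_opp_prev c).trans hc)
  rw [S.opp_opp, S.rot_opp_prev] at hj
  exact h.point_point _ _ (hX.symm _ _ hj)

/-- If some strand joins the two sides of a corner where no arc ends, then there is one that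
joins the two crossing points next to the vertex. -/
lemma IsMulticurve.innermost {X : Diagram D} (h : X.IsMulticurve S) (hX : X.NoSideTurn) {c : D}
    (hc : ¬ X.HasEnd c) {i j : ℕ} (hij : X.joined (.point c i) (.point (S.prev c) j)) :
    X.joined (.point c 0) (.point (S.prev c) (X.cnt (S.prev c) - 1)) := by
  have n1 := S.next_ne c; have n2 := S.prev_ne c; have n3 := S.next_ne_prev c
  have hi := h.lt_cnt hij
  have hj := h.lt_cnt (h.symm _ _ hij)
  -- the partner of the first point lies behind `j` on `prev c`
  obtain ⟨j', hj', h0⟩ : ∃ j', j ≤ j' ∧ X.joined (.point c 0) (.point (S.prev c) j') := by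
    rcases Nat.eq_zero_or_pos i with rfl | hpos
    · exact ⟨j, le_rfl, hij⟩
    obtain ⟨q, hq⟩ := h.full (d := c) (i := 0) (by omega)
    have hqd := h.planar.inTri _ _ hq
    have hdart : q.dart = S.prev c ∧ j < q.rank := by
      have hnc := h.noncrossing c _ _ _ _ hq hij
      have hqe : q ≠ .vertex c := by
        rintro rfl; exact hc ⟨_, h.symm _ _ hq⟩
      have hqc : q.dart ≠ c := by
        cases q with
        | point d k => rintro rfl; exact hX _ _ _ hq
        | vertex d => rintro rfl; exact hqe rfl
      rcases hqd with hd | hd | hd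
      · exact absurd hd hqc
      · exact absurd ⟨by simp [Before]; omega, by simp at hd; simp [Before, hd],
          by simp at hd; simp [Before, hd]⟩ hnc
      · refine ⟨hd, ?_⟩
        by_contra hlt
        have hne : q ≠ .point (S.prev c) j := by
          rintro rfl
          have := h.unique (h.symm _ _ hq) (h.symm _ _ hij)
          simp at this; omega
        have hr : q.rank ≠ j + 1 := fun hr => hne (Port.ext_dart_rank (by simpa using hd)
          (by simpa using hr))
        simp at hd
        exact hnc ⟨by simp [Before]; omega, by simp [Before, hd], by simp [Before, hd]; omega⟩
    cases q with
    | point d k =>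
      obtain ⟨rfl, hk⟩ := hdart
      simp at hk
      exact ⟨k, by omega, hq⟩
    | vertex d => simp at hdart
  have hj'' := h.lt_cnt (h.symm _ _ h0)
  rcases Nat.lt_or_ge j' (X.cnt (S.prev c) - 1) with hlt | hge
  · exfalso
    obtain ⟨q, hq⟩ := h.full (d := S.prev c) (i := X.cnt (S.prev c) - 1) (by omega)
    -- read the boundary from `prev c`: the strand runs from `j'` over the last point to the corner
    obtain ⟨h1, h2⟩ := h.planar.enclosed (b := S.prev c) (h.symm _ _ h0) hq
      (by simp [Before]; omega) (by simp [Before])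
    cases q with
    | point d k =>
      simp [Before, n2, n1.symm, n2.symm, n3.symm] at h1 h2
      rcases h1 with h1 | h1
      · exact hX _ _ _ (h1.1 ▸ hq)
      · grind
    | vertex d =>
      simp [Before, n2, n1.symm, n2.symm, n3.symm] at h1 h2
      rcases h1 with rfl | rfl
      · exact hc ⟨_, h.symm _ _ hq⟩
      · simp_all
  · have : j' = X.cnt (S.prev c) - 1 := by omega
    exact this ▸ h0

/-- The arc that ends in the corner `c` goes to the opposite side. -/
def TightEnd (X : Diagram D) (S : TriSurface D) (c : D) : Prop :=
  ∀ q, X.joined (.vertex c) q → ∃ i, q = .point (S.next c) i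

/-- At every vertex, a multicurve that is tight there leaves some corner uncut. If an arc ends in a
corner, it blocks this corner; if an edge is a component, it blocks the corners next to it; and if
all corners are cut off, then the innermost strands form a puncture loop. -/
lemma exists_uncut {X : Diagram D} (h : X.IsMulticurve S) (hX : X.NoSideTurn) (d : D)
    (ht : ∀ c, S.SameVertex c d → X.TightEnd S c) (hl : ¬ X.HasPunctureLoop S d) :
    ∃ c, S.SameVertex c d ∧ X.Uncut S c := by
  by_contra! hcon
  have n3 := S.next_ne_prev
  -- no arc ends at this vertex
  have hend : ∀ c, S.SameVertex c d → ¬ X.HasEnd c := by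
    rintro c hc ⟨q, hq⟩
    refine hcon c hc ?_
    obtain ⟨k, rfl⟩ := ht c hc q hq
    refine ⟨fun i j hij => ?_, fun i hi => ?_, fun i hi => ?_⟩
    · exact h.noncrossing c _ _ _ _ hq hij ⟨by simp [Before], by simp [Before], by simp [Before]⟩
    · have := h.unique hq hi; simp [S.next_ne] at this
    · have := h.unique hq hi; simp [n3] at this
  have hcut : ∀ c, S.SameVertex c d →
      X.joined (.point c 0) (.point (S.prev c) (X.cnt (S.prev c) - 1)) := by
    intro c hc
    by_contra hn
    refine hcon c hc ⟨fun i j hij => hn ?_, fun i hi => ?_, fun i hi => ?_⟩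
    · exact h.innermost hX (hend c hc) hij
    · exact hend c hc ⟨_, hi⟩
    · exact hend c hc ⟨_, hi⟩
  refine hl ⟨fun _ => 0, fun c hc => ⟨h.lt_cnt (hcut c hc), ?_⟩⟩
  have := hcut _ ((S.sameVertex_rot c).symm.trans hc)
  rw [S.prev_rot, h.cnt_opp] at this
  simpa using h.symm _ _ this

end Diagram

namespace Diagram

variable {D : Type*} {S : TriSurface D}

/-! ### Pulling an end across a side -/

open Classical in
/-- The number of crossing points after one of them has been removed from the edge of `d`. -/
def cntSub (X : Diagram D) (S : TriSurface D) (d : D) : D → ℕ :=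
  fun x => if x = d ∨ x = S.opp d then X.cnt x - 1 else X.cnt x

open Classical in
/-- The former names of the ports after `slideCW`. -/
def slidePort (X : Diagram D) (S : TriSurface D) (d : D) : Port D → Port D
  | .point x i => if x = d then .point d (i + 1) else .point x i
  | .vertex x => if x = S.rot d then .point (S.opp d) (X.cnt d - 1) else .vertex x

lemma slideCW_cnt (X : Diagram D) (d : D) : (X.slideCW S d).cnt = X.cntSub S d := rfl
lemma slideCW_joined_eq (X : Diagram D) (d : D) : (X.slideCW S d).joined =
    X.renamed (X.cntSub S d) (fun p => some (X.slidePort S d p)) := by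
  unfold slideCW
  dsimp only
  congr 1
  funext p
  cases p <;> simp only [slidePort] <;> split_ifs <;> rfl

lemma slideCW_joined (X : Diagram D) (d : D) (p q : Port D) : (X.slideCW S d).joined p q ↔
    p.Valid (X.cntSub S d) ∧ q.Valid (X.cntSub S d) ∧
      X.joined (X.slidePort S d p) (X.slidePort S d q) := by
  rw [slideCW_joined_eq]; simp [renamed]

section slide

variable {X : Diagram D} {d : D}

lemma slideCW_planar (hS : S.Simple) (h : X.IsMulticurve S)
    (hd : X.joined (.vertex d) (.point d 0)) : Planar S (X.slideCW S d).joined := by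
  have hc := h.cnt_opp d
  have h1 := h.lt_cnt (h.symm _ _ hd)
  have n1 := S.opp_ne d
  rw [slideCW_joined_eq]
  refine h.planar.renamed ?_ ?_ ?_
  · intro p p' r hp hp' h1 h2
    have := h1.trans h2.symm
    simp only [Option.some.injEq] at this
    cases p <;> cases p' <;> simp only [slidePort] at this <;>
      simp only [Port.Valid, cntSub] at hp hp' <;> grind
  · rintro p r hp h1
    obtain rfl := Option.some.inj h1
    cases p with
    | point x i => simp only [slidePort]; split_ifs with hx <;> simp [TriSurface.InTri, hx]
    | vertex x =>
      simp only [slidePort]; split_ifs with hx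
      · rw [hx]; exact S.inTri_next _
      · exact Or.inl rfl
  · intro b
    -- the corner `rot d` is the terminal corner of the side `opp d`
    by_cases hb : S.InTri (S.opp d) b
    · refine ⟨_, hb, ?_⟩
      rintro p q r s p' q' hp hq h1 h2 - - hpq
      obtain rfl := Option.some.inj h1
      obtain rfl := Option.some.inj h2
      have m1 := S.next_ne (S.opp d); have m2 := S.prev_ne (S.opp d)
      have m3 := S.next_ne_prev (S.opp d); have m4 := hS.not_inTri_opp (S.opp d)
      rw [S.opp_opp] at m4; simp only [TriSurface.InTri] at m4
      have m6 := S.rot_eq d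
      cases p <;> cases q <;> simp only [slidePort] <;>
        simp only [Port.Valid, cntSub] at hp hq <;> simp only [Before] at * <;> grind [Port.dart, Port.rank]
    · refine ⟨b, TriSurface.InTri.rfl, ?_⟩
      rintro p q r s p' q' hp hq h1 h2 - - hpq
      obtain rfl := Option.some.inj h1
      obtain rfl := Option.some.inj h2
      have m5 : ¬ S.InTri b (S.rot d) := fun hh => hb ((S.inTri_next _).trans hh.symm)
      have m1 := S.next_ne b; have m2 := S.prev_ne b
      have m3 := S.next_ne_prev b
      simp only [TriSurface.InTri] at m5
      cases p <;> cases q <;> simp only [slidePort] <;> simp only [Before] at * <;> grind [Port.dart, Port.rank]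

lemma cntSub_opp (h : ∀ x, X.cnt (S.opp x) = X.cnt x) (x : D) :
    X.cntSub S d (S.opp x) = X.cntSub S d x := by
  have := S.opp_inj (a := x) (b := d)
  have := S.eq_opp_iff (a := x) (b := d)
  simp only [cntSub, h]
  grind

/-- The strands that `slideCW` keeps. -/
lemma slideCW_partner (hS : S.Simple) (h : X.IsMulticurve S)
    (hd : X.joined (.vertex d) (.point d 0)) {p s : Port D} (hp : p.Valid (X.cntSub S d))
    (hpd : p ≠ .vertex d) (hs : X.joined (X.slidePort S d p) s) :
    ∃ q, (X.slideCW S d).joined p q ∧ X.slidePort S d q = s := by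
  have hr := hS.rot_ne d
  have h1 := h.lt_cnt (h.symm _ _ hd)
  have hco := h.cnt_opp d
  have hv := h.valid _ _ (h.symm _ _ hs)
  have n1 := S.opp_ne d
  have hps : X.slidePort S d p ≠ .point d 0 := by
    cases p <;> simp only [slidePort] <;> grind
  have hpv : X.slidePort S d p ≠ .vertex d := by
    cases p <;> simp only [slidePort] <;> grind
  have hsd : s ≠ .vertex d := by
    rintro rfl; exact hps (h.unique (h.symm _ _ hs) hd)
  have hs0 : s ≠ .point d 0 := by
    rintro rfl; exact hpv (h.unique (h.symm _ _ hs) (h.symm _ _ hd))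
  have hsr : s ≠ .vertex (S.rot d) := by
    rintro rfl
    exact hr (h.ends (S.sameVertex_rot d).symm ⟨_, h.symm _ _ hs⟩ ⟨_, hd⟩)
  obtain ⟨q, hq, rfl⟩ : ∃ q : Port D, q.Valid (X.cntSub S d) ∧ X.slidePort S d q = s := by
    cases s with
    | vertex x => exact ⟨.vertex x, trivial, by simp only [slidePort]; grind⟩
    | point x i =>
      simp only [Port.Valid] at hv
      by_cases hx : x = d
      · subst hx
        refine ⟨.point x (i - 1), ?_, ?_⟩
        · simp only [Port.Valid, cntSub]; grind
        · simp only [slidePort]; grind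
      · by_cases hx' : x = S.opp d ∧ i = X.cnt d - 1
        · refine ⟨.vertex (S.rot d), trivial, ?_⟩
          simp only [slidePort]; grind
        · refine ⟨.point x i, ?_, ?_⟩
          · simp only [Port.Valid, cntSub]; grind
          · simp only [slidePort]; grind
  exact ⟨q, (slideCW_joined _ _ _ _).2 ⟨hp, hq, hs⟩, rfl⟩

lemma slideCW_not_hasEnd (h : X.IsMulticurve S) (hS : S.Simple)
    (hd : X.joined (.vertex d) (.point d 0)) : ¬ (X.slideCW S d).HasEnd d := by
  rintro ⟨q, hq⟩
  have hr := hS.rot_ne d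
  have n1 := S.opp_ne d
  rw [slideCW_joined] at hq
  have h2 := hq.2.2
  simp only [slidePort, hr.symm, if_false] at h2
  have := h.unique h2 hd
  cases q <;> simp only [slidePort] at this <;> grind

lemma slideCW_hasEnd (hS : S.Simple) (h : X.IsMulticurve S)
    (hd : X.joined (.vertex d) (.point d 0)) (c : D) :
    (X.slideCW S d).HasEnd c ↔ c = S.rot d ∨ (c ≠ d ∧ X.HasEnd c) := by
  have h1 := h.lt_cnt (h.symm _ _ hd)
  have hco := h.cnt_opp d
  constructor
  · intro hc
    have hcd : c ≠ d := by
      rintro rfl; exact slideCW_not_hasEnd h hS hd hc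
    obtain ⟨q, hq⟩ := hc
    rw [slideCW_joined] at hq
    by_cases hcr : c = S.rot d
    · exact Or.inl hcr
    · refine Or.inr ⟨hcd, X.slidePort S d q, ?_⟩
      simpa [slidePort, hcr] using hq.2.2
  · rintro (rfl | ⟨hcd, s, hs⟩)
    · obtain ⟨s, hs⟩ := h.full (d := S.opp d) (i := X.cnt d - 1) (by omega)
      obtain ⟨q, hq, -⟩ := slideCW_partner hS h hd (p := .vertex (S.rot d)) trivial
        (by simpa using hS.rot_ne d) (s := s) (by simpa [slidePort] using hs)
      exact ⟨q, hq⟩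
    · have hcr : c ≠ S.rot d := by
        rintro rfl
        exact hS.rot_ne d (h.ends (S.sameVertex_rot d).symm ⟨_, hs⟩ ⟨_, hd⟩)
      obtain ⟨q, hq, -⟩ := slideCW_partner hS h hd (p := .vertex c) trivial
        (by simpa using hcd) (s := s) (by simpa [slidePort, hcr] using hs)
      exact ⟨q, hq⟩

lemma slideCW_isMulticurve (hS : S.Simple) (h : X.IsMulticurve S)
    (hd : X.joined (.vertex d) (.point d 0)) : (X.slideCW S d).IsMulticurve S := by
  have hsv := S.sameVertex_rot d
  have hde : X.HasEnd d := ⟨_, hd⟩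
  have h1 := h.lt_cnt (h.symm _ _ hd)
  have hco := h.cnt_opp d
  refine .of_planar (slideCW_planar hS h hd) (cntSub_opp h.cnt_opp)
    (fun p q hpq => ((slideCW_joined _ _ _ _).1 hpq).1) ?_ h.comps_opp ?_ ?_ ?_ h.comp_unique
  · intro x i hi
    rw [slideCW_cnt] at hi
    have hv : (X.slidePort S d (.point x i)).Valid X.cnt := by
      simp only [slidePort, cntSub, Port.Valid] at *; grind
    obtain ⟨y, k, hy⟩ : ∃ y k, X.slidePort S d (.point x i) = .point y k := by
      simp only [slidePort]; grind
    obtain ⟨s, hs⟩ := h.full (d := y) (i := k) (by rw [hy] at hv; exact hv)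
    obtain ⟨q, hq, -⟩ := slideCW_partner hS h hd (p := .point x i) hi (by simp) (hy ▸ hs)
    exact ⟨q, hq⟩
  · intro x hx
    have := h.comps_cnt x hx
    simp only [slideCW_cnt, cntSub, this]; simp
  · intro c c' hcc hc hc'
    rw [slideCW_hasEnd hS h hd] at hc hc'
    rcases hc with rfl | ⟨hc, hc2⟩ <;> rcases hc' with rfl | ⟨hc', hc2'⟩
    · rfl
    · exact absurd (h.ends (hsv.trans hcc) hde hc2').symm hc'
    · exact absurd (h.ends (hcc.trans hsv.symm) hc2 hde) hc
    · exact h.ends hcc hc2 hc2'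
  · intro c f hcf hc
    rw [slideCW_hasEnd hS h hd] at hc
    rcases hc with rfl | ⟨hc, hc2⟩
    · exact h.end_comp (hsv.trans hcf) hde
    · exact h.end_comp hcf hc2

/-- The strands between two crossing points after `slideCW`. -/
lemma slideCW_point_point {x y : D} {i j : ℕ} (hpq : (X.slideCW S d).joined (.point x i) (.point y j)) :
    ∃ i' j', X.joined (.point x i') (.point y j') := by
  have := ((slideCW_joined _ _ _ _).1 hpq).2.2
  simp only [slidePort] at this
  split_ifs at this with h1 h2 h2 <;> subst_vars <;> exact ⟨_, _, this⟩

lemma slideCW_vertex_point {c y : D} {j : ℕ} (hc : c ≠ S.rot d)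
    (hpq : (X.slideCW S d).joined (.vertex c) (.point y j)) :
    ∃ j', X.joined (.vertex c) (.point y j') := by
  have := ((slideCW_joined _ _ _ _).1 hpq).2.2
  simp only [slidePort, hc, if_false] at this
  split_ifs at this with h1 <;> subst_vars <;> exact ⟨_, this⟩

lemma slideCW_rot_point {y : D} {j : ℕ}
    (hpq : (X.slideCW S d).joined (.vertex (S.rot d)) (.point y j)) :
    ∃ i' j', X.joined (.point (S.opp d) i') (.point y j') := by
  have := ((slideCW_joined _ _ _ _).1 hpq).2.2
  simp only [slidePort, if_true] at this
  split_ifs at this with h1 <;> subst_vars <;> exact ⟨_, _, this⟩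

lemma slideCW_noSideTurn (hX : X.NoSideTurn) : (X.slideCW S d).NoSideTurn := by
  intro x i j hij
  obtain ⟨i', j', h⟩ := slideCW_point_point hij
  exact hX _ _ _ h

lemma Uncut.slideCW (h : X.IsMulticurve S) (hX : X.NoSideTurn) {c : D} (hc : X.Uncut S c) :
    (X.slideCW S d).Uncut S c := by
  refine ⟨fun i j hij => ?_, fun i hi => ?_, fun i hi => ?_⟩
  · obtain ⟨i', j', h⟩ := slideCW_point_point hij
    exact hc.point_point _ _ h
  · by_cases hcr : c = S.rot d
    · subst hcr
      obtain ⟨i', j', hij⟩ := slideCW_rot_point hi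
      exact hc.point_point j' i' (by rw [S.prev_rot]; exact h.symm _ _ hij)
    · obtain ⟨j', h⟩ := slideCW_vertex_point hcr hi
      exact hc.vertex_point _ h
  · by_cases hcr : c = S.rot d
    · subst hcr
      rw [S.prev_rot] at hi
      obtain ⟨i', j', h⟩ := slideCW_rot_point hi
      exact hX _ _ _ h
    · obtain ⟨j', h⟩ := slideCW_vertex_point hcr hi
      exact hc.vertex_prev _ h

lemma HasPunctureLoop.of_slideCW (h : X.IsMulticurve S)
    (hd : X.joined (.vertex d) (.point d 0)) {u : D} (hu : (X.slideCW S d).HasPunctureLoop S u) :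
    X.HasPunctureLoop S u := by
  classical
  obtain ⟨i, hi⟩ := hu
  have h1 := h.lt_cnt (h.symm _ _ hd)
  have hco := h.cnt_opp d
  have hoo := S.opp_opp d
  have n1 := S.opp_ne d
  refine ⟨fun x => if x = d then i x + 1 else i x, fun c hc => ?_⟩
  obtain ⟨h2, h3⟩ := hi c hc
  have := ((slideCW_joined _ _ _ _).1 h3).2.2
  rw [slideCW_cnt] at h2 this
  clear hi
  refine ⟨by simp only [cntSub] at h2; grind, ?_⟩
  convert this using 1
  · simp only [slidePort]
    by_cases e1 : c = d
    · subst e1; simp [n1, cntSub]; omega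
    · by_cases e2 : S.opp c = d
      · subst e2
        simp only [cntSub, hoo, e1, if_true, if_false] at *
        simp only [Port.point.injEq, true_and]
        rw [S.opp_opp] at h2 ⊢
        simp at h2 ⊢; omega
      · have : c ≠ S.opp d := fun h => e2 (by rw [h, hoo])
        simp [e1, e2, cntSub, this]
  · simp only [slidePort]; grind

end slide
end Diagram

/-! ### Tightening a multicurve whose ends are wound around the endpoints of an edge -/

/-- `x` starts at an endpoint of the edge of `e`. -/
def TriSurface.AtEdge {D : Type*} (S : TriSurface D) (e x : D) : Prop :=
  S.SameVertex x e ∨ S.SameVertex x (S.opp e)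

lemma TriSurface.AtEdge.of_sameVertex {D : Type*} {S : TriSurface D} {e x y : D}
    (h : S.AtEdge e x) (hxy : S.SameVertex y x) : S.AtEdge e y :=
  h.imp hxy.trans hxy.trans

/-- An edge other than that of `e` has at most one endpoint in common with it. -/
lemma TriSurface.Simple.not_atEdge_opp {D : Type*} {S : TriSurface D} (hS : S.Simple) {e x : D}
    (h : S.AtEdge e x) (h1 : x ≠ e) (h2 : x ≠ S.opp e) : ¬ S.AtEdge e (S.opp x) := by
  rintro (h' | h') <;> rcases h with h | h
  · exact hS.not_sameVertex_opp x (h.trans h'.symm)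
  · exact h2 (hS.eq_opp h h')
  · exact h1 (hS.eq_of_sameVertex h h')
  · exact hS.not_sameVertex_opp x (h.trans h'.symm)

namespace Diagram

variable {D : Type*} {S : TriSurface D}

section push

variable {X : Diagram D} {f : D}

lemma pushToEdge_joined (X : Diagram D) (f : D) (p q : Port D) : (X.pushToEdge S f).joined p q ↔
    X.joined p q ∧ ¬ IsPair (.vertex f) (.vertex (S.next f)) p q := Iff.rfl

lemma pushToEdge_hasEnd (h : X.IsMulticurve S) (hf : X.joined (.vertex f) (.vertex (S.next f)))
    (c : D) : (X.pushToEdge S f).HasEnd c ↔ X.HasEnd c ∧ c ≠ f ∧ c ≠ S.next f := by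
  constructor
  · rintro ⟨q, hq, hn⟩
    refine ⟨⟨q, hq⟩, ?_, ?_⟩
    · rintro rfl
      exact hn (Or.inl ⟨rfl, h.unique hq hf⟩)
    · rintro rfl
      exact hn (Or.inr ⟨rfl, h.unique hq (h.symm _ _ hf)⟩)
  · rintro ⟨⟨q, hq⟩, h1, h2⟩
    refine ⟨q, hq, ?_⟩
    rintro (⟨h3, -⟩ | ⟨h3, -⟩)
    · exact h1 (Port.vertex.inj h3)
    · exact h2 (Port.vertex.inj h3)

lemma pushToEdge_isMulticurve (hS : S.Simple) (h : X.IsMulticurve S) (hX : X.NoSideTurn)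
    (hf : X.joined (.vertex f) (.vertex (S.next f))) : (X.pushToEdge S f).IsMulticurve S := by
  have h1 : X.HasEnd f := ⟨_, hf⟩
  have h2 : X.HasEnd (S.next f) := ⟨_, h.symm _ _ hf⟩
  have h3 := S.sameVertex_next f
  have h4 := h.cnt_eq_zero hX hf
  have hmem : ∀ g, g ∈ (X.pushToEdge S f).comps ↔ g ∈ X.comps ∨ g = f ∨ g = S.opp f := by
    intro g; simp [pushToEdge]; tauto
  refine .of_planar (h.planar.mono (fun p q hpq => hpq.1) ?_) h.cnt_opp
    (fun p q hpq => h.valid _ _ hpq.1) ?_ ?_ ?_ ?_ ?_ ?_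
  · rintro p q ⟨hpq, hn⟩
    refine ⟨h.symm _ _ hpq, fun hp => hn ?_⟩
    simp only [IsPair] at hp ⊢; tauto
  · intro d i hi
    obtain ⟨q, hq⟩ := h.full hi
    exact ⟨q, hq, by simp [IsPair]⟩
  · intro g hg
    rw [hmem] at hg ⊢
    rcases hg with hg | rfl | rfl
    · exact Or.inl (h.comps_opp _ hg)
    · simp
    · simp [S.opp_opp]
  · intro g hg
    rw [hmem] at hg
    rcases hg with hg | rfl | rfl
    · exact h.comps_cnt _ hg
    · exact h4
    · exact (h.cnt_opp _).trans h4
  · intro c c' hcc hc hc'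
    rw [pushToEdge_hasEnd h hf] at hc hc'
    exact h.ends hcc hc.1 hc'.1
  · intro c g hcg hc hg
    rw [pushToEdge_hasEnd h hf] at hc
    rw [hmem] at hg
    rcases hg with hg | rfl | rfl
    · exact h.end_comp hcg hc.1 hg
    · exact hc.2.1 (h.ends hcg hc.1 h1)
    · exact hc.2.2 (h.ends (hcg.trans h3) hc.1 h2)
  · intro g g' hgg hg hg'
    rw [hmem] at hg hg'
    rcases hg with hg | rfl | rfl <;> rcases hg' with hg' | rfl | rfl
    · exact h.comp_unique _ _ hgg hg hg'
    · exact absurd hg (h.end_comp hgg.symm h1)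
    · exact absurd hg (h.end_comp (h3.symm.trans hgg.symm) h2)
    · exact absurd hg' (h.end_comp hgg h1)
    · rfl
    · exact absurd hgg (hS.not_sameVertex_opp _)
    · exact absurd hg' (h.end_comp (h3.symm.trans hgg) h2)
    · exact absurd hgg.symm (hS.not_sameVertex_opp _)
    · rfl

lemma Uncut.of_joined {X Y : Diagram D} {c : D} (h : X.Uncut S c)
    (hY : ∀ p q, Y.joined p q → X.joined p q) : Y.Uncut S c :=
  ⟨fun i j hij => h.point_point i j (hY _ _ hij), fun i hi => h.vertex_point i (hY _ _ hi),
    fun i hi => h.vertex_prev i (hY _ _ hi)⟩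

lemma HasPunctureLoop.of_joined {X Y : Diagram D} {u : D} (h : Y.HasPunctureLoop S u)
    (hcnt : Y.cnt = X.cnt) (hY : ∀ p q, Y.joined p q → X.joined p q) :
    X.HasPunctureLoop S u := by
  obtain ⟨i, hi⟩ := h
  exact ⟨i, fun c hc => ⟨hcnt ▸ (hi c hc).1, hY _ _ (hcnt ▸ (hi c hc).2)⟩⟩

end push

/-- If an arc ends at the initial vertex of `d`, then there is an uncut corner at this vertex that is
reached from the end by turning clockwise, without crossing the edge of `d`.  If it is the corner
`d` itself, then no arc with an end in the other corner `next d` at this edge passes through it. -/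
def ClearRun (X : Diagram D) (S : TriSurface D) (d : D) : Prop :=
  ∀ x, S.SameVertex x d → X.HasEnd x → ∃ m, (∀ l < m, (S.rot ^ l) x ≠ d) ∧
    X.Uncut S ((S.rot ^ m) x) ∧ ((S.rot ^ m) x = d → ∀ q, X.joined (.vertex (S.next d)) q →
      q ≠ .vertex d ∧ ∀ i, q ≠ .point (S.prev d) i)

/-- The multicurves that arise from a positive smoothing along the edge of `e` by pulling the arcs
tight.  Only the ends at the endpoints of this edge may be wound up, and they unwind
clockwise, before they get back to the edge. -/
structure Unwinding (S : TriSurface D) (e : D) (X : Diagram D) : Prop where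
  multicurve : X.IsMulticurve S
  noSideTurn : X.NoSideTurn
  no_loop : ∀ u, ¬ X.HasPunctureLoop S u
  ends : ∀ x q, X.joined (.vertex x) q → (∃ i, q = .point (S.next x) i) ∨
    (S.AtEdge e x ∧ ∃ i, q = .point x i) ∨ (S.AtEdge e x ∧ q = .vertex (S.next x)) ∨
    (S.AtEdge e (S.prev x) ∧ q = .vertex (S.prev x))
  run : X.ClearRun S e
  run_opp : X.ClearRun S (S.opp e)

namespace Unwinding

variable {X : Diagram D} {e d : D}

lemma symm_edge (h : Unwinding S e X) : Unwinding S (S.opp e) X := by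
  refine ⟨h.multicurve, h.noSideTurn, h.no_loop, ?_, h.run_opp, by rw [S.opp_opp]; exact h.run⟩
  have : ∀ x, S.AtEdge (S.opp e) x ↔ S.AtEdge e x := by
    intro x; simp [TriSurface.AtEdge, S.opp_opp, or_comm]
  simpa only [this] using h.ends

lemma slide_ne (h : Unwinding S e X) (hd : X.joined (.vertex d) (.point d 0)) : d ≠ e := by
  rintro rfl
  obtain ⟨m, hm, hu, -⟩ := h.run d .rfl ⟨_, hd⟩
  rcases Nat.eq_zero_or_pos m with rfl | hpos
  · exact hu.vertex_point 0 hd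
  · exact hm 0 hpos rfl

lemma slide_atEdge (h : Unwinding S e X) (hd : X.joined (.vertex d) (.point d 0)) :
    S.AtEdge e d := by
  have := (S.next_ne d)
  rcases h.ends _ _ hd with ⟨i, hi⟩ | h' | h' | h'
  · simp at hi; exact absurd hi.1.symm this
  · exact h'.1
  · simp at h'
  · simp at h'

lemma push_ne (h : Unwinding S e X) (hd : X.joined (.vertex d) (.vertex (S.next d))) : d ≠ e := by
  rintro rfl
  obtain ⟨m, hm, hu, hc⟩ := h.run d .rfl ⟨_, hd⟩
  rcases Nat.eq_zero_or_pos m with rfl | hpos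
  · exact (hc rfl _ (h.multicurve.symm _ _ hd)).1 rfl
  · exact hm 0 hpos rfl

lemma clearRun_slide (hS : S.Simple) (h : X.IsMulticurve S) (hX : X.NoSideTurn) {d₀ : D}
    (hd : X.joined (.vertex d) (.point d 0)) (hne : d ≠ S.opp d₀)
    (hr : X.ClearRun S d₀) : (X.slideCW S d).ClearRun S d₀ := by
  have hC : (∀ q, X.joined (.vertex (S.next d₀)) q →
      q ≠ .vertex d₀ ∧ ∀ i, q ≠ .point (S.prev d₀) i) →
      ∀ q, (X.slideCW S d).joined (.vertex (S.next d₀)) q →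
      q ≠ .vertex d₀ ∧ ∀ i, q ≠ .point (S.prev d₀) i := by
    intro hc q hq
    have hn : S.next d₀ ≠ S.rot d := by
      intro h'
      rw [S.rot_eq, S.next_inj, S.eq_opp_iff] at h'
      exact hne h'
    have h2 := ((slideCW_joined _ _ _ _).1 hq).2.2
    simp only [slidePort, hn, if_false] at h2
    have h3 := hc _ h2
    constructor
    · rintro rfl
      by_cases hdr : d₀ = S.rot d
      · subst hdr
        exact h3.2 (X.cnt d - 1) (by simp [slidePort])
      · exact h3.1 (by simp [slidePort, hdr])
    · rintro i rfl
      by_cases hdr : S.prev d₀ = d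
      · exact h3.2 (i + 1) (by simp [slidePort, hdr])
      · exact h3.2 i (by simp [slidePort, hdr])
  intro x hx hxe
  rw [slideCW_hasEnd hS h hd] at hxe
  rcases hxe with rfl | ⟨-, hxe⟩
  · obtain ⟨m, hm, hu, hc⟩ := hr d ((S.sameVertex_rot d).trans hx) ⟨_, hd⟩
    rcases m with - | m
    · exact absurd hd (hu.vertex_point 0)
    have hpow : ∀ l, (S.rot ^ (l + 1)) d = (S.rot ^ l) (S.rot d) := fun l => by
      rw [pow_succ]; rfl
    rw [hpow] at hu hc
    exact ⟨m, fun l hl => hpow l ▸ hm (l + 1) (by omega), hu.slideCW h hX, fun he => hC (hc he)⟩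
  · obtain ⟨m, hm, hu, hc⟩ := hr x hx hxe
    exact ⟨m, hm, hu.slideCW h hX, fun he => hC (hc he)⟩

lemma slide (hS : S.Simple) (h : Unwinding S e X) (hd : X.joined (.vertex d) (.point d 0)) :
    Unwinding S e (X.slideCW S d) := by
  have hM := h.multicurve
  have h1 := h.slide_ne hd
  have h2 := h.symm_edge.slide_ne hd
  have hat := h.slide_atEdge hd
  have hat' := hS.not_atEdge_opp hat h1 h2
  have hrot := hat.of_sameVertex (S.sameVertex_rot d).symm
  refine ⟨slideCW_isMulticurve hS hM hd, slideCW_noSideTurn h.noSideTurn,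
    fun u hu => h.no_loop u (hu.of_slideCW hM hd), ?_,
    clearRun_slide hS hM h.noSideTurn hd h2 h.run,
    clearRun_slide hS hM h.noSideTurn hd (by rw [S.opp_opp]; exact h1) h.run_opp⟩
  intro x q hq
  have hpr := S.prev_rot d
  have hj := ((slideCW_joined _ _ _ _).1 hq).2.2
  have hend : X.HasEnd d := ⟨_, hd⟩
  -- the other end of the strand that arrives at the point next to the vertex
  have key : ∀ s, X.joined (.point (S.opp d) (X.cnt d - 1)) s → (∀ i, s ≠ .point (S.opp d) i) ∧
      s ≠ .vertex (S.rot d) ∧ s ≠ .vertex (S.opp d) := by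
    intro s hs
    refine ⟨?_, ?_, ?_⟩
    · rintro i rfl; exact h.noSideTurn _ _ _ hs
    · rintro rfl
      exact hS.rot_ne d (hM.ends (S.sameVertex_rot d).symm ⟨_, hM.symm _ _ hs⟩ hend)
    · rintro rfl
      rcases h.ends _ _ (hM.symm _ _ hs) with ⟨i, hi⟩ | h' | h' | h'
      · simp at hi; exact S.next_ne _ hi.1.symm
      · exact hat' h'.1
      · simp at h'
      · simp at h'
  by_cases hx : x = S.rot d
  · subst hx
    simp only [slidePort, if_true] at hj
    obtain ⟨k1, k2, k3⟩ := key _ hj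
    have htri := hM.planar.inTri _ _ hj
    cases q with
    | point y i =>
      have hy : S.InTri (S.opp d) y := by
        simp only [slidePort] at htri; split_ifs at htri with hyd
        · exact hyd ▸ htri
        · exact htri
      rcases hy with hy | hy | hy
      · subst hy
        exact absurd (by simp [slidePort, S.opp_ne]) (k1 i)
      · exact Or.inr (Or.inl ⟨hrot, i, by rw [hy]; rfl⟩)
      · exact Or.inl ⟨i, by rw [hy, S.rot_eq]; simp⟩
    | vertex y =>
      by_cases hyr : y = S.rot d
      · subst hyr
        exact absurd (hM.unique (by simpa [slidePort] using hj) (by simpa [slidePort] using hj))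
          (hM.ne _ _ (by simpa [slidePort] using hj))
      · simp only [slidePort, hyr, if_false] at k1 k2 k3 htri
        rcases htri with hy | hy | hy
        · simp at hy; exact absurd (by rw [hy]) k3
        · simp at hy; exact absurd hy hyr
        · simp at hy
          refine Or.inr (Or.inr (Or.inl ⟨hrot, by rw [hy, S.rot_eq]; simp⟩))
  · simp only [slidePort, hx, if_false] at hj
    have hq' := h.ends _ _ hj
    cases q with
    | point y i =>
      by_cases hy : y = d
      · subst hy
        simp [slidePort] at hq' ⊢; exact hq'
      · simpa [slidePort, hy] using hq'
    | vertex y =>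
      by_cases hyr : y = S.rot d
      · subst hyr
        simp only [slidePort, if_true] at hj hq'
        have k := key _ (hM.symm _ _ hj)
        rcases hq' with ⟨i, hi⟩ | ⟨h', i, hi⟩ | h' | h'
        · simp at hi
          have hxp : S.prev x = S.rot d := by
            rw [S.rot_eq, hi.1]; simp
          refine Or.inr (Or.inr (Or.inr ⟨hxp ▸ hrot, by rw [hxp]⟩))
        · simp at hi; exact absurd (by rw [hi.1]) k.2.2
        · simp at h'
        · simp at h'
      · simpa [slidePort, hyr] using hq'

lemma push (hS : S.Simple) (h : Unwinding S e X) (hd : X.joined (.vertex d) (.vertex (S.next d))) :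
    Unwinding S e (X.pushToEdge S d) := by
  have hM := h.multicurve
  have hsub : ∀ p q, (X.pushToEdge S d).joined p q → X.joined p q := fun p q hpq => hpq.1
  have hrun : ∀ d₀, X.ClearRun S d₀ → (X.pushToEdge S d).ClearRun S d₀ := by
    rintro d₀ hr x hx ⟨q, hq⟩
    obtain ⟨m, hm, hu, hc⟩ := hr x hx ⟨q, hq.1⟩
    exact ⟨m, hm, hu.of_joined hsub, fun he q hq => hc he q hq.1⟩
  exact ⟨pushToEdge_isMulticurve hS hM h.noSideTurn hd, fun _ _ _ hij => h.noSideTurn _ _ _ hij.1,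
    fun u hu => h.no_loop u (hu.of_joined rfl hsub), fun x q hq => h.ends x q hq.1,
    hrun _ h.run, hrun _ h.run_opp⟩

/-- The only way to tighten. -/
lemma tighten_cases (h : Unwinding S e X) {Y : Diagram D} (hY : Tighten S X Y) :
    (∃ d, X.joined (.vertex d) (.point d 0) ∧ Y = X.slideCW S d) ∨
    (∃ d, X.joined (.vertex d) (.vertex (S.next d)) ∧ Y = X.pushToEdge S d) := by
  have hM := h.multicurve
  cases hY with
  | slideCW d hd => exact Or.inl ⟨d, hd, rfl⟩
  | slideCCW d h₀ hd =>
    exfalso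
    have n1 := S.next_ne (S.opp d); have n2 := S.next_ne_prev (S.opp d)
    rcases h.ends _ _ hd with ⟨i, hi⟩ | h' | h' | h'
    · simp [S.rot_eq] at hi; exact S.prev_ne _ hi.1.symm
    · simp [S.rot_eq] at h'; exact n1 h'.2.symm
    · simp at h'
    · simp at h'
  | removeTurnBack d i hd h' => exact absurd hd (h.noSideTurn _ _ _)
  | pushToEdge d h₀ hd => exact Or.inr ⟨d, hd, rfl⟩

lemma tighten (hS : S.Simple) (h : Unwinding S e X) {Y : Diagram D} (hY : Tighten S X Y) :
    Unwinding S e Y := by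
  rcases h.tighten_cases hY with ⟨d, hd, rfl⟩ | ⟨d, hd, rfl⟩
  · exact h.slide hS hd
  · exact h.push hS hd

end Unwinding
end Diagram

namespace Diagram

variable {D : Type*} {S : TriSurface D}

/-! ### Confluence of the tightening -/

section commute

variable {X : Diagram D} {d d' f f' : D}

lemma slideCW_comm (h : X.IsMulticurve S) (hd : X.joined (.vertex d) (.point d 0))
    (hd' : X.joined (.vertex d') (.point d' 0)) (h1 : d' ≠ d) (h2 : d' ≠ S.opp d) :
    (X.slideCW S d).slideCW S d' = (X.slideCW S d').slideCW S d := by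
  have h2' : d ≠ S.opp d' := fun h => h2 (S.eq_opp_iff.1 h)
  have h3 : S.opp d ≠ S.opp d' := fun h => h1 (S.opp_inj.1 h).symm
  have e1 : X.cntSub S d d' = X.cnt d' := by simp [cntSub, h1, h2]
  have e2 : X.cntSub S d' d = X.cnt d := by simp [cntSub, h1.symm, h2']
  have hcnt : (X.slideCW S d).cntSub S d' = (X.slideCW S d').cntSub S d := by
    funext x
    simp only [cntSub, slideCW_cnt]; grind
  have hport : ∀ p, X.slidePort S d ((X.slideCW S d).slidePort S d' p) =
      X.slidePort S d' ((X.slideCW S d').slidePort S d p) := by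
    have hr : S.rot d ≠ S.rot d' := fun h => h1 (S.rot.injective h).symm
    have i1 := S.opp_ne d; have i2 := S.opp_ne d'
    intro p
    cases p <;> simp only [slidePort, slideCW_cnt, e1, e2] <;> grind
  have hv : ∀ p : Port D, p.Valid ((X.slideCW S d).cntSub S d') →
      ((X.slideCW S d).slidePort S d' p).Valid (X.cntSub S d) := by
    intro p hp
    have := h.lt_cnt (h.symm _ _ hd')
    have := h.cnt_opp d'
    have := h.cnt_opp d
    cases p <;> simp only [slidePort, slideCW_cnt, e1] <;>
      simp only [Port.Valid, cntSub, slideCW_cnt] at * <;> grind [Port.Valid]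
  have hv' : ∀ p : Port D, p.Valid ((X.slideCW S d').cntSub S d) →
      ((X.slideCW S d').slidePort S d p).Valid (X.cntSub S d') := by
    intro p hp
    have := h.lt_cnt (h.symm _ _ hd)
    have := h.cnt_opp d'
    have := h.cnt_opp d
    cases p <;> simp only [slidePort, slideCW_cnt, e2] <;>
      simp only [Port.Valid, cntSub, slideCW_cnt] at * <;> grind [Port.Valid]
  refine Diagram.ext hcnt ?_ rfl
  funext p q
  simp only [slideCW_joined, eq_iff_iff]
  constructor
  · rintro ⟨hp, hq, -, -, hj⟩
    rw [hcnt] at hp hq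
    rw [hport, hport] at hj
    exact ⟨hp, hq, hv' _ hp, hv' _ hq, hj⟩
  · rintro ⟨hp, hq, -, -, hj⟩
    rw [← hcnt] at hp hq
    rw [← hport, ← hport] at hj
    exact ⟨hp, hq, hv _ hp, hv _ hq, hj⟩

lemma slideCW_pushToEdge_comm (hS : S.Simple) (h : X.IsMulticurve S)
    (hd : X.joined (.vertex d) (.point d 0)) (hf : X.joined (.vertex f) (.vertex (S.next f))) :
    (X.slideCW S d).pushToEdge S f = (X.pushToEdge S f).slideCW S d ∧
      (X.slideCW S d).joined (.vertex f) (.vertex (S.next f)) ∧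
      (X.pushToEdge S f).joined (.vertex d) (.point d 0) := by
  have hr : ∀ c, X.HasEnd c → c ≠ S.rot d := by
    rintro c hc rfl
    exact hS.rot_ne d (h.ends (S.sameVertex_rot d).symm hc ⟨_, hd⟩)
  have r1 := hr f ⟨_, hf⟩
  have r2 := hr (S.next f) ⟨_, h.symm _ _ hf⟩
  have hiff : ∀ c p, c ≠ S.rot d → (X.slidePort S d p = .vertex c ↔ p = .vertex c) := by
    intro c p hc
    cases p <;> simp only [slidePort] <;> grind
  refine ⟨Diagram.ext rfl ?_ rfl, ?_, hd, by simp [IsPair]⟩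
  · funext p q
    have : ∀ p, (X.pushToEdge S f).slidePort S d p = X.slidePort S d p := fun p => by cases p <;> rfl
    simp only [slideCW_joined, pushToEdge_joined, eq_iff_iff, IsPair, this, hiff _ _ r1, hiff _ _ r2]
    tauto
  · rw [slideCW_joined]
    exact ⟨trivial, trivial, by simpa [slidePort, r1, r2] using hf⟩

lemma pushToEdge_comm (hf' : X.joined (.vertex f') (.vertex (S.next f'))) (hne : f ≠ f') :
    (X.pushToEdge S f).pushToEdge S f' = (X.pushToEdge S f').pushToEdge S f ∧
      (X.pushToEdge S f).joined (.vertex f') (.vertex (S.next f')) := by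
  refine ⟨Diagram.ext rfl ?_ ?_, hf', ?_⟩
  · funext p q
    simp only [pushToEdge_joined, eq_iff_iff]; tauto
  · simp only [pushToEdge]
    rw [Set.union_assoc, Set.union_assoc, Set.union_comm {f, _}]
  · rintro (⟨h1, -⟩ | ⟨h1, h2⟩)
    · exact hne (Port.vertex.inj h1).symm
    · have h3 := Port.vertex.inj h1
      have h4 := Port.vertex.inj h2
      rw [h3, S.next_next] at h4
      exact S.prev_ne _ h4

end commute

namespace Unwinding

variable {X Y Z : Diagram D} {e : D}

lemma tighten_slide {d : D} (hd : X.joined (.vertex d) (.point d 0)) :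
    Tighten S X (X.slideCW S d) := .slideCW X d hd

lemma tighten_push (h : Unwinding S e X) {f : D} (hf : X.joined (.vertex f) (.vertex (S.next f))) :
    Tighten S X (X.pushToEdge S f) :=
  .pushToEdge X f (h.multicurve.cnt_eq_zero h.noSideTurn hf) hf

/-- Tightening steps commute. -/
lemma diamond (hS : S.Simple) (h : Unwinding S e X) (hY : Tighten S X Y) (hZ : Tighten S X Z) :
    Y = Z ∨ ∃ W, Tighten S Y W ∧ Tighten S Z W := by
  have hM := h.multicurve
  rcases h.tighten_cases hY with ⟨d, hd, rfl⟩ | ⟨f, hf, rfl⟩ <;>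
    rcases h.tighten_cases hZ with ⟨d', hd', rfl⟩ | ⟨f', hf', rfl⟩
  · by_cases h1 : d' = d
    · exact Or.inl (by rw [h1])
    have h2 : d' ≠ S.opp d := by
      rintro rfl
      exact hS.not_atEdge_opp (h.slide_atEdge hd) (h.slide_ne hd) (h.symm_edge.slide_ne hd)
        (h.slide_atEdge hd')
    have key : ∀ d d', X.joined (.vertex d) (.point d 0) → X.joined (.vertex d') (.point d' 0) →
        d' ≠ d → d' ≠ S.opp d → (X.slideCW S d).joined (.vertex d') (.point d' 0) := by
      intro d d' hd hd' h1 h2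
      have hr : d' ≠ S.rot d := by
        rintro rfl
        exact hS.rot_ne d (hM.ends (S.sameVertex_rot d).symm ⟨_, hd'⟩ ⟨_, hd⟩)
      rw [slideCW_joined]
      refine ⟨trivial, ?_, by simpa [slidePort, hr, h1] using hd'⟩
      simpa [cntSub, h1, h2] using hM.lt_cnt (hM.symm _ _ hd')
    refine Or.inr ⟨_, tighten_slide (key d d' hd hd' h1 h2), ?_⟩
    rw [slideCW_comm hM hd hd' h1 h2]
    exact tighten_slide (key d' d hd' hd (Ne.symm h1) fun h => h2 (S.eq_opp_iff.1 h))
  · obtain ⟨h1, h2, h3⟩ := slideCW_pushToEdge_comm hS hM hd hf'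
    exact Or.inr ⟨_, (h.slide hS hd).tighten_push h2, h1 ▸ tighten_slide h3⟩
  · obtain ⟨h1, h2, h3⟩ := slideCW_pushToEdge_comm hS hM hd' hf
    exact Or.inr ⟨_, h1 ▸ tighten_slide h3, (h.slide hS hd').tighten_push h2⟩
  · by_cases h1 : f = f'
    · exact Or.inl (by rw [h1])
    obtain ⟨h2, h3⟩ := pushToEdge_comm (f := f) hf' h1
    obtain ⟨-, h5⟩ := pushToEdge_comm (f := f') hf (Ne.symm h1)
    exact Or.inr ⟨_, (h.push hS hf).tighten_push h3, h2 ▸ (h.push hS hf').tighten_push h5⟩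

end Unwinding

/-- A reduced multicurve cannot be tightened. -/
lemma IsReduced.not_tighten {X Y : Diagram D} (h : X.IsReduced S) : ¬ Tighten S X Y := by
  intro hY
  cases hY with
  | slideCW d hd =>
    obtain ⟨i, hi⟩ := h.noTurnBacks.vertex _ _ hd
    simp at hi; exact S.next_ne _ hi.1.symm
  | slideCCW d h₀ hd =>
    obtain ⟨i, hi⟩ := h.noTurnBacks.vertex _ _ hd
    simp [S.rot_eq] at hi; exact S.prev_ne _ hi.1.symm
  | removeTurnBack d i hd h' => exact h.noTurnBacks.side _ _ _ hd
  | pushToEdge d h₀ hd =>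
    obtain ⟨i, hi⟩ := h.noTurnBacks.vertex _ _ hd
    simp at hi

lemma IsReduced.eq_of_tighten {X Y : Diagram D} (h : X.IsReduced S)
    (hY : Relation.ReflTransGen (Tighten S) X Y) : Y = X := by
  rcases Relation.ReflTransGen.cases_head hY with h' | ⟨c, hc, -⟩
  · exact h'.symm
  · exact absurd hc h.not_tighten

/-- A smoothing has at most one reduced form, since its tightening steps commute. -/
lemma Unwinding.eq_of_tighten {X Y Z : Diagram D} {e : D} (hS : S.Simple) (h : Unwinding S e X)
    (hY : Relation.ReflTransGen (Tighten S) X Y) (hZ : Relation.ReflTransGen (Tighten S) X Z)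
    (hYr : Y.IsReduced S) (hZr : Z.IsReduced S) : Y = Z := by
  let r : Diagram D → Diagram D → Prop := fun A B => Unwinding S e A ∧ Tighten S A B
  have lift : ∀ {B}, Relation.ReflTransGen (Tighten S) X B → Relation.ReflTransGen r X B ∧
      Unwinding S e B := by
    intro B hB
    induction hB with
    | refl => exact ⟨.refl, h⟩
    | tail _ hbc ih => exact ⟨ih.1.tail ⟨ih.2, hbc⟩, ih.2.tighten hS hbc⟩
  obtain ⟨W, hW1, hW2⟩ := Relation.church_rosser (r := r) (by
    rintro a b c ⟨ha, hab⟩ ⟨-, hac⟩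
    rcases ha.diamond hS hab hac with rfl | ⟨W, h1, h2⟩
    · exact ⟨b, .refl, .refl⟩
    · exact ⟨W, .single ⟨ha.tighten hS hab, h1⟩, .single ⟨ha.tighten hS hac, h2⟩⟩)
    (lift hY).1 (lift hZ).1
  have hmono : ∀ {A B}, Relation.ReflTransGen r A B → Relation.ReflTransGen (Tighten S) A B :=
    fun h => Relation.ReflTransGen.mono (fun _ _ h => h.2) _ _ h
  rw [← hYr.eq_of_tighten (hmono hW1), ← hZr.eq_of_tighten (hmono hW2)]

/-! ### Tightening undoes winding -/

section wind

variable {X : Diagram D} {d : D}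

open Classical in
/-- The number of crossing points after one has been added to the edge of `d`. -/
def cntAdd (X : Diagram D) (S : TriSurface D) (d : D) : D → ℕ :=
  fun x => if x = d ∨ x = S.opp d then X.cnt x + 1 else X.cnt x

open Classical in
/-- The former names of the ports after `windCCW`. -/
def windCCWPort (X : Diagram D) (S : TriSurface D) (d : D) : Port D → Option (Port D)
  | .point x i =>
      if x = d then (if i = 0 then none else some (.point d (i - 1)))
      else if x = S.opp d ∧ i = X.cnt d then some (.vertex (S.rot d))
      else some (.point x i)
  | .vertex x => if x = S.rot d then none else some (.vertex x)

lemma windCCW_joined (X : Diagram D) (d : D) (p q : Port D) : (X.windCCW S d).joined p q ↔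
    X.renamed (X.cntAdd S d) (X.windCCWPort S d) p q ∨
      IsPair (.vertex d) (.point d 0) p q := Iff.rfl

lemma windCCW_cnt (X : Diagram D) (d : D) : (X.windCCW S d).cnt = X.cntAdd S d := rfl

lemma cntAdd_cntSub (h : X.IsMulticurve S) (hd : 0 < X.cnt d) :
    (X.slideCW S d).cntAdd S d = X.cnt := by
  have hco := h.cnt_opp d
  funext x
  simp only [cntAdd, slideCW_cnt, cntSub]
  split_ifs with hx
  · rcases hx with rfl | rfl <;> omega
  · rfl

/-- Pulling an end clockwise across a side is undone by winding it back counterclockwise. -/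
lemma windCCW_slideCW (hS : S.Simple) (h : X.IsMulticurve S)
    (hd : X.joined (.vertex d) (.point d 0)) : (X.slideCW S d).windCCW S d = X := by
  have h1 := h.lt_cnt (h.symm _ _ hd)
  have hco := h.cnt_opp d
  have n1 := S.opp_ne d
  have hr := hS.rot_ne d
  have hcnt := cntAdd_cntSub h h1
  have hdc : (X.slideCW S d).cnt d = X.cnt d - 1 := by simp [slideCW_cnt, cntSub]
  have hback : ∀ p p₀, (X.slideCW S d).windCCWPort S d p = some p₀ → X.slidePort S d p₀ = p := by
    intro p p₀ hp
    cases p <;> simp only [windCCWPort, hdc] at hp <;> grind [slidePort]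
  have hforth : ∀ p : Port D, p.Valid X.cnt → p ≠ .vertex d → p ≠ .point d 0 →
      p ≠ .vertex (S.rot d) → ∃ p₀, (X.slideCW S d).windCCWPort S d p = some p₀ ∧
        p₀.Valid (X.cntSub S d) := by
    intro p hp h1 h2 h3
    cases p with
    | point x i =>
      simp only [windCCWPort, hdc]
      simp only [Port.Valid] at hp
      split_ifs with e1 e2 e3
      · subst e1 e2; simp at h2
      · exact ⟨_, rfl, by simp only [Port.Valid, cntSub]; grind⟩
      · exact ⟨_, rfl, trivial⟩
      · exact ⟨_, rfl, by simp only [Port.Valid, cntSub]; grind⟩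
    | vertex x =>
      simp only [windCCWPort]
      split_ifs with e1
      · subst e1; simp at h3
      · exact ⟨_, rfl, trivial⟩
  refine Diagram.ext hcnt ?_ rfl
  funext p q
  simp only [windCCW_joined, eq_iff_iff, renamed, hcnt, slideCW_joined]
  constructor
  · rintro (⟨hp, hq, p₀, q₀, hp₀, hq₀, -, -, hj⟩ | ⟨rfl, rfl⟩ | ⟨rfl, rfl⟩)
    · rwa [hback _ _ hp₀, hback _ _ hq₀] at hj
    · exact hd
    · exact h.symm _ _ hd
  · intro hj
    by_cases c1 : p = .vertex d
    · subst c1; exact Or.inr (Or.inl ⟨rfl, h.unique hj hd⟩)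
    by_cases c2 : p = .point d 0
    · subst c2; exact Or.inr (Or.inr ⟨rfl, h.unique hj (h.symm _ _ hd)⟩)
    by_cases c3 : q = .vertex d
    · subst c3; exact Or.inr (Or.inr ⟨h.unique (h.symm _ _ hj) hd, rfl⟩)
    by_cases c4 : q = .point d 0
    · subst c4; exact Or.inr (Or.inl ⟨h.unique (h.symm _ _ hj) (h.symm _ _ hd), rfl⟩)
    have hrv : ∀ p q, X.joined p q → p ≠ .vertex (S.rot d) := by
      rintro p q hj rfl
      exact hr (h.ends (S.sameVertex_rot d).symm ⟨_, hj⟩ ⟨_, hd⟩)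
    obtain ⟨p₀, hp₀, hpv⟩ := hforth p (h.valid _ _ hj) c1 c2 (hrv _ _ hj)
    obtain ⟨q₀, hq₀, hqv⟩ := hforth q (h.valid _ _ (h.symm _ _ hj)) c3 c4 (hrv _ _ (h.symm _ _ hj))
    refine Or.inl ⟨h.valid _ _ hj, h.valid _ _ (h.symm _ _ hj), p₀, q₀, hp₀, hq₀, hpv, hqv, ?_⟩
    rwa [hback _ _ hp₀, hback _ _ hq₀]

lemma pushCCW_pushToEdge (h : X.IsMulticurve S) (hd : X.joined (.vertex d) (.vertex (S.next d))) :
    (X.pushToEdge S d).pushCCW S d = X := by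
  refine Diagram.ext rfl ?_ ?_
  · funext p q
    simp only [pushCCW, pushToEdge_joined, eq_iff_iff]
    constructor
    · rintro (h' | ⟨rfl, rfl⟩ | ⟨rfl, rfl⟩)
      exacts [h'.1, hd, h.symm _ _ hd]
    · intro h'
      by_cases hp : IsPair (.vertex d) (.vertex (S.next d)) p q
      exacts [Or.inr hp, Or.inl ⟨h', hp⟩]
  · have h1 : d ∉ X.comps := h.end_comp .rfl ⟨_, hd⟩
    have h2 : S.opp d ∉ X.comps := h.end_comp (S.sameVertex_next d).symm ⟨_, h.symm _ _ hd⟩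
    ext x
    simp only [pushCCW, pushToEdge, Set.mem_sdiff, Set.mem_union, Set.mem_insert_iff,
      Set.mem_singleton_iff]
    constructor
    · rintro ⟨h3 | h3, h4⟩
      exacts [h3, absurd h3 h4]
    · intro h3
      exact ⟨Or.inl h3, by rintro (rfl | rfl) <;> contradiction⟩

lemma slideCW_endsAt (hS : S.Simple) (h : X.IsMulticurve S)
    (hd : X.joined (.vertex d) (.point d 0)) (u : D) :
    (X.slideCW S d).EndsAt S u ↔ X.EndsAt S u := by
  have hsv := S.sameVertex_rot d
  constructor
  · rintro ⟨c, hc, h1 | h1⟩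
    · rw [slideCW_hasEnd hS h hd] at h1
      rcases h1 with rfl | ⟨-, h1⟩
      · exact ⟨d, hsv.trans hc, Or.inl ⟨_, hd⟩⟩
      · exact ⟨c, hc, Or.inl h1⟩
    · exact ⟨c, hc, Or.inr h1⟩
  · rintro ⟨c, hc, h1 | h1⟩
    · by_cases hcd : c = d
      · subst hcd
        exact ⟨S.rot c, hsv.symm.trans hc, Or.inl ((slideCW_hasEnd hS h hd _).2 (Or.inl rfl))⟩
      · exact ⟨c, hc, Or.inl ((slideCW_hasEnd hS h hd _).2 (Or.inr ⟨hcd, h1⟩))⟩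
    · exact ⟨c, hc, Or.inr h1⟩

lemma pushToEdge_endsAt (h : X.IsMulticurve S)
    (hd : X.joined (.vertex d) (.vertex (S.next d))) (u : D) :
    (X.pushToEdge S d).EndsAt S u ↔ X.EndsAt S u := by
  have hsv := S.sameVertex_next d
  have hmem : ∀ g, g ∈ (X.pushToEdge S d).comps ↔ g ∈ X.comps ∨ g = d ∨ g = S.opp d := by
    intro g; simp [pushToEdge]; tauto
  constructor
  · rintro ⟨c, hc, h1 | h1⟩
    · rw [pushToEdge_hasEnd h hd] at h1
      exact ⟨c, hc, Or.inl h1.1⟩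
    · rcases (hmem _).1 h1 with h1 | rfl | rfl
      · exact ⟨c, hc, Or.inr h1⟩
      · exact ⟨c, hc, Or.inl ⟨_, hd⟩⟩
      · exact ⟨_, hsv.symm.trans hc, Or.inl ⟨_, h.symm _ _ hd⟩⟩
  · rintro ⟨c, hc, h1 | h1⟩
    · by_cases hcd : c = d
      · subst hcd
        exact ⟨c, hc, Or.inr ((hmem _).2 (by simp))⟩
      by_cases hcd' : c = S.next d
      · subst hcd'
        exact ⟨S.opp d, hsv.trans hc, Or.inr ((hmem _).2 (by simp))⟩
      · exact ⟨c, hc, Or.inl ((pushToEdge_hasEnd h hd _).2 ⟨h1, hcd, hcd'⟩)⟩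
    · exact ⟨c, hc, Or.inr ((hmem _).2 (Or.inl h1))⟩

end wind

/-- What tightening the arc at one endpoint of the edge of `e` does not change. -/
structure AgreesAway (S : TriSurface D) (e : D) (X Z : Diagram D) : Prop where
  cnt : Z.cnt e = X.cnt e
  comps : e ∈ Z.comps ↔ e ∈ X.comps
  endsAt : ∀ u, Z.EndsAt S u ↔ X.EndsAt S u
  hasEnd_opp : ∀ x, S.SameVertex x (S.opp e) → (Z.HasEnd x → X.HasEnd x)
  comps_opp : ∀ x, S.SameVertex x (S.opp e) → (x ∈ Z.comps → x ∈ X.comps)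
  tight_opp : ∀ x, S.SameVertex x (S.opp e) → X.TightEnd S x → Z.TightEnd S x

lemma AgreesAway.refl (e : D) (X : Diagram D) : AgreesAway S e X X :=
  ⟨rfl, Iff.rfl, fun _ => Iff.rfl, fun _ _ => id, fun _ _ => id, fun _ _ => id⟩

lemma AgreesAway.trans {e : D} {X Y Z : Diagram D} (h : AgreesAway S e X Y)
    (h' : AgreesAway S e Y Z) : AgreesAway S e X Z :=
  ⟨h'.cnt.trans h.cnt, h'.comps.trans h.comps, fun u => (h'.endsAt u).trans (h.endsAt u),
    fun x hx hz => h.hasEnd_opp x hx (h'.hasEnd_opp x hx hz),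
    fun x hx hz => h.comps_opp x hx (h'.comps_opp x hx hz),
    fun x hx hz => h'.tight_opp x hx (h.tight_opp x hx hz)⟩

namespace Unwinding

variable {X : Diagram D} {e d : D}

lemma agreesAway_slide (hS : S.Simple) (h : Unwinding S e X)
    (hd : X.joined (.vertex d) (.point d 0)) (hde : S.SameVertex d e) :
    AgreesAway S e X (X.slideCW S d) := by
  have hM := h.multicurve
  have hno : ∀ x, S.SameVertex x (S.opp e) → x ≠ S.rot d := by
    rintro x hx rfl
    exact hS.not_sameVertex_opp e (hde.symm.trans ((S.sameVertex_rot d).trans hx))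
  refine ⟨?_, Iff.rfl, slideCW_endsAt hS hM hd, ?_, fun _ _ => id, ?_⟩
  · have h1 := h.slide_ne hd
    have h2 := h.symm_edge.slide_ne hd
    have h3 : e ≠ S.opp d := fun h => h2 (S.eq_opp_iff.1 h)
    simp [slideCW_cnt, cntSub, h1.symm, h3]
  · intro x hx hz
    rcases (slideCW_hasEnd hS hM hd x).1 hz with h' | h'
    · exact absurd h' (hno x hx)
    · exact h'.2
  · intro x hx ht q hq
    have hj := ((slideCW_joined _ _ _ _).1 hq).2.2
    simp only [slidePort, hno x hx, if_false] at hj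
    obtain ⟨i, hi⟩ := ht _ hj
    cases q with
    | point y j =>
      by_cases hy : y = d
      · subst hy; simp [slidePort] at hi ⊢; exact hi.1
      · simp [slidePort, hy] at hi ⊢; exact hi.1
    | vertex y =>
      exfalso
      by_cases hy : y = S.rot d
      · -- then the arc would have become parallel to the edge of `e`
        subst hy
        simp [slidePort] at hi
        have hx' : x = S.next (S.rot d) := by
          rw [S.rot_eq, hi.1]; simp
        subst hx'
        have he : S.rot d = e := hS.no_two_cycle _ _ ((S.sameVertex_rot d).symm.trans hde)
          (hx.trans (S.sameVertex_next e))
        exact (h.slide hS hd).push_ne ((slideCW_isMulticurve hS hM hd).symm _ _ hq) he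
      · simp [slidePort, hy] at hi

lemma agreesAway_push (hS : S.Simple) (h : Unwinding S e X)
    (hd : X.joined (.vertex d) (.vertex (S.next d))) (hde : S.SameVertex d e) :
    AgreesAway S e X (X.pushToEdge S d) := by
  have hM := h.multicurve
  have h1 := h.push_ne hd
  have h2 := h.symm_edge.push_ne hd
  have h3 : e ≠ S.opp d := fun h => h2 (S.eq_opp_iff.1 h)
  have h4 : ¬ S.SameVertex (S.opp d) (S.opp e) := fun h' => h1 (hS.eq_of_sameVertex hde h')
  refine ⟨rfl, ?_, pushToEdge_endsAt hM hd, ?_, ?_, ?_⟩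
  · simp [pushToEdge, h1.symm, h3]
  · intro x hx hz
    exact ((pushToEdge_hasEnd hM hd x).1 hz).1
  · intro x hx hz
    simp only [pushToEdge, Set.mem_union, Set.mem_insert_iff, Set.mem_singleton_iff] at hz
    rcases hz with hz | rfl | rfl
    · exact hz
    · exact absurd (hde.symm.trans hx) (hS.not_sameVertex_opp e)
    · exact absurd hx h4
  · intro x hx ht q hq
    exact ht q hq.1

lemma exists_tight_of_not_slide (hS : S.Simple) (h : Unwinding S e X) {x : D}
    (hx : S.SameVertex x e) (hxe : X.HasEnd x) (hs : ¬ X.joined (.vertex x) (.point x 0)) :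
    ∃ Z, Unwinding S e Z ∧
    Relation.ReflTransGen (Tighten S) X Z ∧ Relation.ReflTransGen (StepCCW S e) Z X ∧
    (∀ x, S.SameVertex x e → Z.TightEnd S x) ∧ AgreesAway S e X Z := by
  have hM := h.multicurve
  by_cases ht : X.TightEnd S x
  · refine ⟨X, h, .refl, .refl, fun y hy q hq => ?_, .refl e X⟩
    obtain rfl := h.multicurve.ends (hy.trans hx.symm) ⟨q, hq⟩ hxe
    exact ht q hq
  unfold TightEnd at ht
  push Not at ht
  obtain ⟨q, hq, ht⟩ := ht
  have hp : X.joined (.vertex x) (.vertex (S.next x)) := by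
    rcases h.ends _ _ hq with ⟨i, hi⟩ | ⟨-, i, rfl⟩ | ⟨-, rfl⟩ | ⟨h', rfl⟩
    · exact absurd hi (ht i)
    · exact absurd (hM.vertex_point_eq_zero h.noSideTurn hq ▸ hq) hs
    · exact hq
    · exfalso
      have hq' : X.joined (.vertex (S.prev x)) (.vertex (S.next (S.prev x))) := by
        rw [S.next_prev]; exact h.multicurve.symm _ _ hq
      rcases h' with h' | h'
      · exact hS.not_sameVertex_prev x (hx.trans h'.symm)
      · refine h.symm_edge.push_ne hq' (hS.no_two_cycle _ _ h' ?_)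
        rw [S.next_prev]
        have := S.sameVertex_next (S.opp e)
        rw [S.opp_opp] at this
        exact hx.trans this
  refine ⟨X.pushToEdge S x, h.push hS hp, .single (h.tighten_push hp), .single ?_, ?_,
    h.agreesAway_push hS hp hx⟩
  · conv => rhs; rw [← pushCCW_pushToEdge hM hp]
    exact .push _ _ (by simp [pushToEdge]) hx
  · rintro y hy q' ⟨hq', hn⟩
    obtain rfl := hM.ends (hy.trans hx.symm) ⟨q', hq'⟩ hxe
    exact absurd (Or.inl ⟨rfl, hM.unique hq' hp⟩) hn

/-- The arc at an endpoint of the edge can be pulled tight, and winding it back counterclockwise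
undoes this. -/
lemma exists_tight (hS : S.Simple) (h : Unwinding S e X) : ∃ Z, Unwinding S e Z ∧
    Relation.ReflTransGen (Tighten S) X Z ∧ Relation.ReflTransGen (StepCCW S e) Z X ∧
    (∀ x, S.SameVertex x e → Z.TightEnd S x) ∧ AgreesAway S e X Z := by
  by_cases hend : ∃ x, S.SameVertex x e ∧ X.HasEnd x
  swap
  · refine ⟨X, h, .refl, .refl, fun x hx q hq => absurd ⟨x, hx, q, hq⟩ hend, .refl e X⟩
  obtain ⟨x, hx, hxe⟩ := hend
  obtain ⟨m, hm, hu, -⟩ := h.run x hx hxe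
  induction m generalizing X x with
  | zero => exact h.exists_tight_of_not_slide hS hx hxe (hu.vertex_point 0)
  | succ m ih =>
    have hM := h.multicurve
    by_cases hs : X.joined (.vertex x) (.point x 0)
    · have hpow : ∀ l, (S.rot ^ (l + 1)) x = (S.rot ^ l) (S.rot x) := fun l => by
        rw [pow_succ]; rfl
      have hag := h.agreesAway_slide hS hs hx
      obtain ⟨Z, h1, h2, h3, h4, h5⟩ := ih (h.slide hS hs) (S.rot x)
        ((S.sameVertex_rot x).symm.trans hx) ((slideCW_hasEnd hS hM hs _).2 (Or.inl rfl))
        (fun l hl => hpow l ▸ hm (l + 1) (by omega))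
        (by rw [hpow] at hu; exact hu.slideCW hM h.noSideTurn)
      refine ⟨Z, h1, .head (tighten_slide hs) h2, h3.tail ?_, h4, hag.trans h5⟩
      conv => rhs; rw [← windCCW_slideCW hS hM hs]
      exact .wind _ _ ((slideCW_hasEnd hS hM hs _).2 (Or.inl rfl)) hx (hm 0 (by omega))
    · exact h.exists_tight_of_not_slide hS hx hxe hs

/-- The smoothing can be tightened to a reduced multicurve, which can be wound back
counterclockwise. -/
lemma exists_reduced (hS : S.Simple) (h : Unwinding S e X) (h1 : X.EndsOnlyIn S e (S.rot e))
    (h2 : X.EndsOnlyIn S (S.opp e) (S.rot (S.opp e))) :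
    ∃ β, β.IsReduced S ∧ Relation.ReflTransGen (Tighten S) X β ∧
      (∃ X₁, WindsCCW S e β X₁ ∧ WindsCCW S (S.opp e) X₁ X) ∧ β.cnt e = X.cnt e ∧
      (e ∈ β.comps ↔ e ∈ X.comps) ∧ ∀ u, β.EndsAt S u ↔ X.EndsAt S u := by
  obtain ⟨Z, z1, z2, z3, z4, z5⟩ := h.symm_edge.exists_tight hS
  have z1' := z1.symm_edge
  rw [S.opp_opp] at z1'
  obtain ⟨β, b1, b2, b3, b4, b5⟩ := z1'.exists_tight hS
  have t1 : ∀ x, S.SameVertex x (S.opp e) → β.TightEnd S x :=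
    fun x hx => b5.tight_opp x hx (z4 x hx)
  have t2 : ∀ x, S.AtEdge e x → β.TightEnd S x := fun x hx => hx.elim (b4 x) (t1 x)
  have hM := b1.multicurve
  have hcnt : Z.cnt e = X.cnt e := by
    have := z5.cnt
    rwa [z1.multicurve.cnt_opp, h.multicurve.cnt_opp] at this
  have hmem : ∀ {Y : Diagram D}, Y.IsMulticurve S → (S.opp e ∈ Y.comps ↔ e ∈ Y.comps) :=
    fun hY => ⟨fun h => by simpa [S.opp_opp] using hY.comps_opp _ h, hY.comps_opp _⟩
  refine ⟨β, ⟨hM, ⟨b1.noSideTurn, fun x q hq => ?_⟩, b1.no_loop⟩, z2.trans b2,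
    ⟨Z, ⟨b3, ?_, ?_⟩, z3, h2⟩, b5.cnt.trans hcnt, ?_,
    fun u => (b5.endsAt u).trans (z5.endsAt u)⟩
  · rcases b1.ends x q hq with h' | ⟨h', i, rfl⟩ | ⟨h', rfl⟩ | ⟨h', rfl⟩
    · exact h'
    · exact t2 x h' _ hq
    · exact t2 x h' _ hq
    · obtain ⟨i, hi⟩ := t2 _ h' _ (hM.symm _ _ hq)
      simp at hi
  · intro f hf hfc
    exact h1.1 f hf (z5.comps_opp f (by rwa [S.opp_opp]) hfc)
  · intro x hx hxe
    exact h1.2 x hx (z5.hasEnd_opp x (by rwa [S.opp_opp]) hxe)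
  · rw [b5.comps, ← hmem z1.multicurve, ← hmem h.multicurve]
    exact z5.comps

end Unwinding
end Diagram

namespace Diagram

variable {D : Type*} {S : TriSurface D}

/-! ### Winding an end clockwise -/

section wind

variable {X : Diagram D} {c : D}

open Classical in
/-- The former names of the ports after `windCW`. -/
def windCWPort (c : D) : Port D → Option (Port D)
  | .point x i =>
      if x = c then (if i = 0 then some (.vertex c) else some (.point c (i - 1)))
      else some (.point x i)
  | .vertex x => if x = c then none else some (.vertex x)

lemma windCW_joined (X : Diagram D) (c : D) (p q : Port D) : (X.windCW S c).joined p q ↔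
    X.renamed (X.cntAdd S c) (windCWPort c) p q ∨
      IsPair (.vertex (S.rot c)) (.point (S.opp c) (X.cnt c)) p q := Iff.rfl

lemma windCW_cnt (X : Diagram D) (c : D) : (X.windCW S c).cnt = X.cntAdd S c := rfl

lemma windCWPort_dart {p q : Port D} (h : windCWPort c p = some q) : q.dart = p.dart := by
  cases p <;> simp only [windCWPort] at h <;> grind [Port.dart]

lemma cntAdd_opp (h : ∀ x, X.cnt (S.opp x) = X.cnt x) (x : D) :
    X.cntAdd S c (S.opp x) = X.cntAdd S c x := by
  have := S.opp_inj (a := x) (b := c)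
  have := S.eq_opp_iff (a := x) (b := c)
  simp only [cntAdd, h]
  grind

lemma windCW_planar (hS : S.Simple) (h : X.IsMulticurve S) (hc : X.HasEnd c) :
    Planar S (X.windCW S c).joined := by
  have hco := h.cnt_opp c
  have n1 := S.opp_ne c
  have hr := hS.rot_ne c
  have hrend : ¬ X.HasEnd (S.rot c) := fun h' =>
    hr (h.ends (S.sameVertex_rot c).symm h' hc)
  have P1 : Planar S (X.renamed (X.cntAdd S c) (windCWPort c)) := by
    refine h.planar.renamed ?_ ?_ ?_
    · intro p p' r hp hp' h1 h2
      cases p <;> cases p' <;> simp only [windCWPort] at h1 h2 <;> grind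
    · intro p r hp h1
      rw [windCWPort_dart h1]; exact .rfl
    · intro b
      by_cases hb : S.InTri c b
      · refine ⟨_, hb, ?_⟩
        rintro p q r s p' q' hp hq h1 h2 - - hpq
        have m1 := S.next_ne c; have m2 := S.prev_ne c; have m3 := S.next_ne_prev c
        cases p <;> cases q <;> simp only [windCWPort] at h1 h2 <;> simp only [Before] at * <;>
          grind [Port.dart, Port.rank]
      · refine ⟨b, .rfl, ?_⟩
        rintro p q r s p' q' hp hq h1 h2 - - hpq
        have m5 : ∀ x, S.InTri b x → x ≠ c := by
          rintro x hx rfl; exact hb hx.symm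
        have e1 := m5 _ hpq.inTri_left
        have e2 := m5 _ hpq.inTri_right
        have e3 : r = p := by
          cases p <;> simp only [windCWPort] at h1 <;> grind [Port.dart]
        have e4 : s = q := by
          cases q <;> simp only [windCWPort] at h2 <;> grind [Port.dart]
        rwa [e3, e4]
  have hno : ∀ p q q', IsPair (.vertex (S.rot c)) (.point (S.opp c) (X.cnt c)) p q →
      ¬ X.renamed (X.cntAdd S c) (windCWPort c) p q' := by
    rintro p q q' (⟨rfl, -⟩ | ⟨rfl, -⟩) ⟨-, -, p₀, q₀, h1, -, hj⟩
    · simp [windCWPort, hr] at h1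
      subst h1; exact hrend ⟨_, hj⟩
    · simp [windCWPort, n1] at h1
      subst h1
      have := h.lt_cnt hj; omega
  refine P1.add ?_ ?_ hno ?_
  · intro p q hp; simp only [IsPair] at *; tauto
  · rintro p q q' (⟨rfl, rfl⟩ | ⟨rfl, rfl⟩) (⟨h1, rfl⟩ | ⟨h1, rfl⟩) <;> simp_all
  · -- the two ends of the new strand are neighbours in the triangle of `opp c`
    have key : ∀ r s, (X.renamed (X.cntAdd S c) (windCWPort c) r s ∨
        IsPair (.vertex (S.rot c)) (.point (S.opp c) (X.cnt c)) r s) →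
        ¬ (Before S (S.opp c) (.point (S.opp c) (X.cnt c)) r ∧
          Before S (S.opp c) r (.vertex (S.rot c))) := by
      rintro r s hrs ⟨h1, h2⟩
      have hv : r.Valid (X.cntAdd S c) := by
        rcases hrs with hrs | ⟨rfl, -⟩ | ⟨rfl, -⟩
        · exact hrs.1
        · trivial
        · simp [cntAdd]; omega
      have m1 := S.next_ne (S.opp c); have m2 := S.prev_ne (S.opp c)
      have m3 := S.next_ne_prev (S.opp c)
      have m4 := S.rot_eq c
      cases r <;> simp only [Before, Port.Valid, cntAdd] at * <;> grind [Port.dart, Port.rank]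
    have hb : ∀ p q, Before S (S.opp c) p q → ¬ Before S (S.opp c) q p := fun p q => Before.asymm
    have hbb : Before S (S.opp c) (.point (S.opp c) (X.cnt c)) (.vertex (S.rot c)) := by
      simp [Before, S.rot_eq]
    rintro p q (⟨rfl, rfl⟩ | ⟨rfl, rfl⟩)
    · refine ⟨by simp, S.opp c, S.inTri_next _, .rfl, fun r s hrs => ⟨?_, key r s hrs⟩⟩
      rintro ⟨h1, h2⟩
      exact hb _ _ hbb (h1.trans h2)
    · refine ⟨by simp, S.opp c, .rfl, S.inTri_next _, fun r s hrs => ⟨key r s hrs, ?_⟩⟩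
      rintro ⟨h1, h2⟩
      exact hb _ _ hbb (h1.trans h2)

/-- The strands that `windCW` keeps. -/
lemma windCW_partner (h : X.IsMulticurve S) {p p₀ s : Port D}
    (hp : p.Valid (X.cntAdd S c)) (hpp : windCWPort c p = some p₀) (hs : X.joined p₀ s) :
    ∃ q, (X.windCW S c).joined p q := by
  have hv := h.valid _ _ (h.symm _ _ hs)
  obtain ⟨q, hq, hqs⟩ : ∃ q : Port D, q.Valid (X.cntAdd S c) ∧ windCWPort c q = some s := by
    have n1 := S.opp_ne c
    cases s with
    | vertex x =>
      by_cases hx : x = c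
      · exact ⟨.point c 0, by simp [cntAdd], by simp [windCWPort, hx]⟩
      · exact ⟨.vertex x, trivial, by simp [windCWPort, hx]⟩
    | point x i =>
      simp only [Port.Valid] at hv
      by_cases hx : x = c
      · exact ⟨.point c (i + 1), by simp [cntAdd]; rw [← hx]; exact hv, by simp [windCWPort, hx]⟩
      · exact ⟨.point x i, by simp only [Port.Valid, cntAdd]; grind, by simp [windCWPort, hx]⟩
  exact ⟨q, Or.inl ⟨hp, hq, p₀, s, hpp, hqs, hs⟩⟩

lemma windCW_hasEnd (h : X.IsMulticurve S) (x : D) :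
    (X.windCW S c).HasEnd x ↔ x = S.rot c ∨ (x ≠ c ∧ X.HasEnd x) := by
  constructor
  · rintro ⟨q, hq⟩
    rcases (windCW_joined _ _ _ _).1 hq with ⟨-, -, p₀, q₀, h1, h2, hj⟩ | ⟨h1, -⟩ | ⟨h1, -⟩
    · simp only [windCWPort] at h1
      split_ifs at h1 with hx
      obtain rfl := Option.some.inj h1
      exact Or.inr ⟨hx, _, hj⟩
    · exact Or.inl (Port.vertex.inj h1)
    · simp at h1
  · rintro (rfl | ⟨hx, s, hs⟩)
    · exact ⟨_, Or.inr (Or.inl ⟨rfl, rfl⟩)⟩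
    · exact windCW_partner h (p := .vertex x) trivial (by simp [windCWPort, hx]) hs

lemma windCW_isMulticurve (hS : S.Simple) (h : X.IsMulticurve S) (hc : X.HasEnd c) :
    (X.windCW S c).IsMulticurve S := by
  have hsv := S.sameVertex_rot c
  have hco := h.cnt_opp c
  have n1 := S.opp_ne c
  have hcnt : ∀ x, x ∈ X.comps → x ≠ c ∧ x ≠ S.opp c := by
    refine fun x hx => ⟨?_, ?_⟩ <;> rintro rfl
    · exact h.end_comp .rfl hc hx
    · exact h.end_comp .rfl hc (by simpa [S.opp_opp] using h.comps_opp _ hx)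
  refine .of_planar (windCW_planar hS h hc) (cntAdd_opp h.cnt_opp) ?_ ?_ h.comps_opp ?_ ?_ ?_
    h.comp_unique
  · intro p q hpq
    rcases (windCW_joined _ _ _ _).1 hpq with h1 | ⟨rfl, -⟩ | ⟨rfl, -⟩
    · exact h1.1
    · trivial
    · simp [windCW_cnt, cntAdd]; omega
  · intro x i hi
    by_cases hxi : x = S.opp c ∧ i = X.cnt c
    · exact ⟨_, Or.inr (Or.inr ⟨by rw [hxi.1, hxi.2], rfl⟩)⟩
    · obtain ⟨p₀, hp, s, hs⟩ : ∃ p₀, windCWPort c (.point x i) = some p₀ ∧ ∃ s, X.joined p₀ s := by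
        simp only [windCW_cnt, cntAdd] at hi
        by_cases hx : x = c
        · by_cases h0 : i = 0
          · exact ⟨.vertex c, by simp [windCWPort, hx, h0], hc⟩
          · exact ⟨.point c (i - 1), by simp [windCWPort, hx, h0], h.full (by grind)⟩
        · exact ⟨.point x i, by simp [windCWPort, hx], h.full (by grind)⟩
      exact windCW_partner h hi hp hs
  · intro x hx
    simp [windCW_cnt, cntAdd, hcnt x hx, h.comps_cnt x hx]
  · intro x x' hxx hx hx'
    rw [windCW_hasEnd h] at hx hx'
    rcases hx with rfl | ⟨hx, hx2⟩ <;> rcases hx' with rfl | ⟨hx', hx2'⟩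
    · rfl
    · exact absurd (h.ends (hsv.trans hxx) hc hx2').symm hx'
    · exact absurd (h.ends (hxx.trans hsv.symm) hx2 hc) hx
    · exact h.ends hxx hx2 hx2'
  · intro x f hxf hx
    rw [windCW_hasEnd h] at hx
    rcases hx with rfl | ⟨hx, hx2⟩
    · exact h.end_comp (hsv.trans hxf) hc
    · exact h.end_comp hxf hx2

lemma windCW_joined_point {x y : D} {i j : ℕ}
    (hj : (X.windCW S c).joined (.point x i) (.point y j)) :
    ∃ p q, windCWPort c (.point x i) = some p ∧ windCWPort c (.point y j) = some q ∧
      X.joined p q := by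
  rcases (windCW_joined _ _ _ _).1 hj with ⟨-, -, p₀, q₀, h1, h2, hj⟩ | ⟨h1, -⟩ | ⟨-, h1⟩
  · exact ⟨p₀, q₀, h1, h2, hj⟩
  · simp at h1
  · simp at h1

lemma windCW_joined_vertex {x : D} {q : Port D} (hx : x ≠ S.rot c)
    (hj : (X.windCW S c).joined (.vertex x) q) :
    x ≠ c ∧ ∃ q₀, windCWPort c q = some q₀ ∧ X.joined (.vertex x) q₀ := by
  rcases (windCW_joined _ _ _ _).1 hj with ⟨-, -, p₀, q₀, h1, h2, hj⟩ | ⟨h1, -⟩ | ⟨h1, -⟩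
  · simp only [windCWPort] at h1
    split_ifs at h1 with hxc
    obtain rfl := Option.some.inj h1
    exact ⟨hxc, q₀, h2, hj⟩
  · exact absurd (Port.vertex.inj h1) hx
  · simp at h1

lemma windCW_joined_rot (hS : S.Simple) (h : X.IsMulticurve S) (hc : X.HasEnd c) {q : Port D}
    (hj : (X.windCW S c).joined (.vertex (S.rot c)) q) : q = .point (S.opp c) (X.cnt c) :=
  (windCW_planar hS h hc).unique _ _ _ hj (Or.inr (Or.inl ⟨rfl, rfl⟩))

lemma windCW_noSideTurn (h : X.IsMulticurve S) (hX : X.NoSideTurn)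
    (hX' : ∀ i, ¬ X.joined (.vertex c) (.point c i)) :
    (X.windCW S c).NoSideTurn := by
  intro x i j hij
  obtain ⟨p, q, h1, h2, h3⟩ := windCW_joined_point hij
  simp only [windCWPort] at h1 h2
  by_cases hx : x = c
  · subst hx
    by_cases hi : i = 0 <;> by_cases hj : j = 0 <;> simp [hi, hj] at h1 h2 <;> subst h1 h2
    · exact h.ne _ _ h3 rfl
    · exact hX' _ h3
    · exact hX' _ (h.symm _ _ h3)
    · exact hX _ _ _ h3
  · simp [hx] at h1 h2
    subst h1 h2
    exact hX _ _ _ h3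

lemma Uncut.windCW {x : D} (hx : X.Uncut S x) (h1 : x ≠ S.rot c) (h2 : x ≠ S.next c) :
    (X.windCW S c).Uncut S x := by
  have h3 : S.prev x ≠ c := fun h => h2 (S.eq_next_iff.2 h.symm)
  refine ⟨fun i j hij => ?_, fun i hi => ?_, fun i hi => ?_⟩
  · obtain ⟨p, q, hp, hq, hj⟩ := windCW_joined_point hij
    simp [windCWPort, h3] at hq
    subst hq
    by_cases hxc : x = c
    · subst hxc
      by_cases hi : i = 0 <;> simp [windCWPort, hi] at hp <;> subst hp
      · exact hx.vertex_prev _ hj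
      · exact hx.point_point _ _ hj
    · simp [windCWPort, hxc] at hp
      subst hp; exact hx.point_point _ _ hj
  · obtain ⟨hxc, q, hq, hj⟩ := windCW_joined_vertex h1 hi
    simp [windCWPort, hxc] at hq
    subst hq; exact hx.vertex_point _ hj
  · obtain ⟨hxc, q, hq, hj⟩ := windCW_joined_vertex h1 hi
    simp [windCWPort, h3] at hq
    subst hq; exact hx.vertex_prev _ hj

lemma HasPunctureLoop.of_windCW (hS : S.Simple) (h : X.IsMulticurve S) (hc : X.HasEnd c) {u : D}
    (hu : (X.windCW S c).HasPunctureLoop S u) : X.HasPunctureLoop S u := by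
  classical
  obtain ⟨i, hi⟩ := hu
  have hco := h.cnt_opp c
  have n1 := S.opp_ne c
  have hM := windCW_isMulticurve hS h hc
  -- the loop avoids the new crossing point, which is next to an end
  have hnew : ∀ x k, ¬ (X.windCW S c).joined (.point (S.opp c) (X.cnt c)) (.point x k) := by
    intro x k hj
    have := hM.unique hj (Or.inr (Or.inr ⟨rfl, rfl⟩))
    simp at this
  have hi1 : S.SameVertex c u → i c ≠ 0 := by
    intro hcu h0
    have := (hi c hcu).2
    rw [h0] at this
    exact hnew _ _ (by simpa [windCW_cnt, cntAdd] using this)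
  have hi2 : S.SameVertex (S.opp c) u → i (S.opp c) ≠ X.cnt c := by
    intro hcu h0
    obtain ⟨y, hy⟩ := S.rot.surjective (S.opp c)
    have hyu : S.SameVertex y u := (S.sameVertex_rot y).trans (hy ▸ hcu)
    have := (hi y hyu).2
    rw [hy, h0] at this
    exact hnew _ _ (hM.symm _ _ this)
  refine ⟨fun x => if x = c then i x - 1 else i x, fun x hx => ?_⟩
  obtain ⟨h2, h3⟩ := hi x hx
  have hi3 := hi1
  obtain ⟨p, q, hp, hq, hj⟩ := windCW_joined_point h3
  have hrx : S.SameVertex (S.rot x) u := (S.sameVertex_rot x).symm.trans hx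
  clear hi hnew h3
  rw [windCW_cnt] at h2 hp
  have hq' : q = .point (S.rot x) (if S.rot x = c then i (S.rot x) - 1 else i (S.rot x)) := by
    by_cases hr : S.rot x = c
    · have := hi1 (hr ▸ hrx)
      simp [windCWPort, hr, this] at hq
      simp [hr, hq]
    · simp [windCWPort, hr] at hq
      simp [hr, hq]
  have hlt : (if x = c then i x - 1 else i x) < X.cnt x := by
    simp only [cntAdd] at h2
    by_cases hxc : x = c
    · subst hxc; have := hi1 hx; simp at h2 ⊢; omega
    · by_cases hxo : x = S.opp c
      · subst hxo; have := hi2 hx; simp [hxc] at h2 ⊢; omega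
      · simpa [hxc, hxo] using h2
  refine ⟨hlt, ?_⟩
  have hp' : p = .point (S.opp x) (X.cnt x - 1 - (if x = c then i x - 1 else i x)) := by
    by_cases hxc : x = c
    · subst hxc
      have := hi1 hx
      simp [windCWPort, n1, cntAdd] at hp
      subst hp; simp; omega
    · by_cases hxo : x = S.opp c
      · subst hxo
        have := hi2 hx
        have hne : X.cnt c - i (S.opp c) ≠ 0 := by
          simp [cntAdd] at h2; omega
        simp only [windCWPort, S.opp_opp, cntAdd] at hp
        simp [hco, hne] at hp
        subst hp; rw [S.opp_opp]; simp [hxc, hco]; omega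
      · have : S.opp x ≠ c := fun h => hxo (by rw [← h, S.opp_opp])
        simp [windCWPort, this, cntAdd, hxc, hxo] at hp
        simp [hxc, hp]
  rwa [hp', hq'] at hj

open Classical in
/-- The former names of the ports after `slideCCW`. -/
def slideCCWPort (d : D) : Port D → Port D
  | .point x i => if x = d then .point d (i + 1) else .point x i
  | .vertex x => if x = d then .point d 0 else .vertex x

lemma slideCCW_joined (X : Diagram D) (d : D) (p q : Port D) : (X.slideCCW S d).joined p q ↔
    p.Valid (X.cntSub S d) ∧ q.Valid (X.cntSub S d) ∧
      X.joined (slideCCWPort d p) (slideCCWPort d q) := by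
  have : (X.slideCCW S d).joined =
      X.renamed (X.cntSub S d) (fun p => some (slideCCWPort d p)) := by
    unfold slideCCW
    dsimp only
    congr 1
    funext p
    cases p <;> simp only [slideCCWPort] <;> split_ifs <;> rfl
  rw [this]; simp [renamed]

lemma cntSub_cntAdd (X : Diagram D) (c : D) : (X.windCW S c).cntSub S c = X.cnt := by
  funext x
  simp only [cntSub, windCW_cnt, cntAdd]
  split_ifs <;> simp

/-- Winding an end clockwise across a side is undone by pulling it tight. -/
lemma slideCCW_windCW (h : X.IsMulticurve S) :
    (X.windCW S c).slideCCW S c = X := by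
  have hco := h.cnt_opp c
  have n1 := S.opp_ne c
  have hport : ∀ p, windCWPort c (slideCCWPort c p) = some p := by
    intro p
    cases p with
    | point x i => by_cases hx : x = c <;> simp [slideCCWPort, windCWPort, hx]
    | vertex x => by_cases hx : x = c <;> simp [slideCCWPort, windCWPort, hx]
  have hval : ∀ p : Port D, p.Valid X.cnt → (slideCCWPort c p).Valid (X.cntAdd S c) := by
    intro p hp
    cases p with
    | point x i =>
      by_cases hx : x = c
      · subst hx; simp [slideCCWPort, cntAdd]; exact hp
      · simp only [slideCCWPort, hx, if_false, cntAdd, Port.Valid] at *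
        split_ifs <;> omega
    | vertex x => by_cases hx : x = c <;> simp [slideCCWPort, cntAdd, hx]
  have hnew : ∀ p : Port D, p.Valid X.cnt → slideCCWPort c p ≠ .point (S.opp c) (X.cnt c) := by
    intro p hp
    cases p <;> simp only [slideCCWPort] <;> simp only [Port.Valid] at hp <;> grind
  refine Diagram.ext (cntSub_cntAdd X c) ?_ rfl
  funext p q
  simp only [slideCCW_joined, cntSub_cntAdd, eq_iff_iff, windCW_joined]
  constructor
  · rintro ⟨hp, hq, ⟨-, -, p₀, q₀, h1, h2, hj⟩ | ⟨-, h2⟩ | ⟨h1, -⟩⟩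
    · rw [hport] at h1 h2
      rwa [Option.some.inj h1, Option.some.inj h2]
    · exact absurd h2 (hnew _ hq)
    · exact absurd h1 (hnew _ hp)
  · intro hj
    have hp := h.valid _ _ hj
    have hq := h.valid _ _ (h.symm _ _ hj)
    exact ⟨hp, hq, Or.inl ⟨hval _ hp, hval _ hq, p, q, hport p, hport q, hj⟩⟩

lemma tighten_windCW (h : X.IsMulticurve S) :
    Tighten S (X.windCW S c) X := by
  conv => rhs; rw [← slideCCW_windCW (c := c) h]
  refine .slideCCW _ _ (by simp [windCW_cnt, cntAdd]) (Or.inr (Or.inl ⟨rfl, ?_⟩))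
  simp [windCW_cnt, cntAdd]

lemma windCW_endsAt (h : X.IsMulticurve S) (hc : X.HasEnd c) (u : D) :
    (X.windCW S c).EndsAt S u ↔ X.EndsAt S u := by
  have hsv := S.sameVertex_rot c
  constructor
  · rintro ⟨x, hx, h1 | h1⟩
    · rw [windCW_hasEnd h] at h1
      rcases h1 with rfl | ⟨-, h1⟩
      · exact ⟨c, hsv.trans hx, Or.inl hc⟩
      · exact ⟨x, hx, Or.inl h1⟩
    · exact ⟨x, hx, Or.inr h1⟩
  · rintro ⟨x, hx, h1 | h1⟩
    · by_cases hcd : x = c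
      · subst hcd
        exact ⟨S.rot x, hsv.symm.trans hx, Or.inl ((windCW_hasEnd h _).2 (Or.inl rfl))⟩
      · exact ⟨x, hx, Or.inl ((windCW_hasEnd h _).2 (Or.inr ⟨hcd, h1⟩))⟩
    · exact ⟨x, hx, Or.inr h1⟩

end wind

section push

variable {X : Diagram D} {f : D}

lemma pushCW_joined (X : Diagram D) (f : D) (p q : Port D) : (X.pushCW S f).joined p q ↔
    X.joined p q ∨ IsPair (.vertex (S.opp f)) (.vertex (S.rot f)) p q := Iff.rfl

lemma mem_pushCW_comps (x : D) : x ∈ (X.pushCW S f).comps ↔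
    x ∈ X.comps ∧ x ≠ f ∧ x ≠ S.opp f := by
  simp [pushCW]

lemma pushCW_hasEnd (x : D) : (X.pushCW S f).HasEnd x ↔
    x = S.opp f ∨ x = S.rot f ∨ X.HasEnd x := by
  constructor
  · rintro ⟨q, hq | ⟨h1, -⟩ | ⟨h1, -⟩⟩
    · exact Or.inr (Or.inr ⟨q, hq⟩)
    · exact Or.inl (Port.vertex.inj h1)
    · exact Or.inr (Or.inl (Port.vertex.inj h1))
  · rintro (rfl | rfl | ⟨q, hq⟩)
    · exact ⟨_, Or.inr (Or.inl ⟨rfl, rfl⟩)⟩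
    · exact ⟨_, Or.inr (Or.inr ⟨rfl, rfl⟩)⟩
    · exact ⟨q, Or.inl hq⟩

lemma pushCW_isMulticurve (hS : S.Simple) (h : X.IsMulticurve S) (hf : f ∈ X.comps) :
    (X.pushCW S f).IsMulticurve S := by
  have hf' := h.comps_opp _ hf
  have h0 := h.comps_cnt _ hf'
  have e1 : ¬ X.HasEnd (S.opp f) := fun h' => h.end_comp .rfl h' hf'
  have e2 : ¬ X.HasEnd (S.rot f) := fun h' =>
    h.end_comp (S.sameVertex_rot f).symm h' hf
  have hne : S.opp f ≠ S.rot f := (S.next_ne _).symm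
  have hsv := S.sameVertex_rot f
  have hopp := hS.not_sameVertex_opp f
  have hP : Planar S (X.pushCW S f).joined := by
    refine h.planar.add ?_ ?_ ?_ ?_
    · intro p q hp; simp only [IsPair] at *; tauto
    · rintro p q q' (⟨rfl, rfl⟩ | ⟨rfl, rfl⟩) (⟨h1, rfl⟩ | ⟨h1, rfl⟩) <;> simp_all
    · rintro p q q' (⟨rfl, rfl⟩ | ⟨rfl, rfl⟩) hj
      · exact e1 ⟨_, hj⟩
      · exact e2 ⟨_, hj⟩
    · have key : ∀ r s, (X.joined r s ∨ IsPair (.vertex (S.opp f)) (.vertex (S.rot f)) r s) →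
          ¬ (Before S (S.opp f) (.vertex (S.opp f)) r ∧
            Before S (S.opp f) r (.vertex (S.rot f))) := by
        rintro r s hrs ⟨h1, h2⟩
        have hv : r.Valid X.cnt := by
          rcases hrs with hrs | ⟨rfl, -⟩ | ⟨rfl, -⟩
          · exact h.valid _ _ hrs
          · trivial
          · trivial
        have m1 := S.next_ne (S.opp f); have m2 := S.prev_ne (S.opp f)
        have m3 := S.next_ne_prev (S.opp f)
        have m4 := S.rot_eq f
        cases r <;> simp only [Before, Port.Valid] at * <;> grind [Port.dart, Port.rank]
      have hbb : Before S (S.opp f) (.vertex (S.opp f)) (.vertex (S.rot f)) := by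
        simp [Before, S.rot_eq]
      rintro p q (⟨rfl, rfl⟩ | ⟨rfl, rfl⟩)
      · refine ⟨by simpa using hne, S.opp f, .rfl, S.inTri_next _,
          fun r s hrs => ⟨key r s hrs, ?_⟩⟩
        rintro ⟨h1, h2⟩
        exact hbb.asymm (h1.trans h2)
      · refine ⟨by simpa using hne.symm, S.opp f, S.inTri_next _, .rfl,
          fun r s hrs => ⟨?_, key r s hrs⟩⟩
        rintro ⟨h1, h2⟩
        exact hbb.asymm (h1.trans h2)
  refine .of_planar hP h.cnt_opp ?_ ?_ ?_ ?_ ?_ ?_ ?_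
  · rintro p q (hpq | ⟨rfl, -⟩ | ⟨rfl, -⟩)
    · exact h.valid _ _ hpq
    · trivial
    · trivial
  · intro d i hi
    obtain ⟨q, hq⟩ := h.full hi
    exact ⟨q, Or.inl hq⟩
  · intro x hx
    rw [mem_pushCW_comps] at hx ⊢
    refine ⟨h.comps_opp _ hx.1, fun h' => hx.2.2 (S.eq_opp_iff.1 h'.symm), fun h' => hx.2.1 ?_⟩
    exact S.opp_inj.1 h'
  · intro x hx
    exact h.comps_cnt x ((mem_pushCW_comps _).1 hx).1
  · intro x x' hxx hx hx'
    rw [pushCW_hasEnd] at hx hx'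
    rcases hx with rfl | rfl | hx <;> rcases hx' with rfl | rfl | hx'
    · rfl
    · exact absurd (hsv.trans hxx.symm) hopp
    · exact absurd hf' (h.end_comp hxx.symm hx')
    · exact absurd (hsv.trans hxx) hopp
    · rfl
    · exact absurd hf (h.end_comp (hxx.symm.trans hsv.symm) hx')
    · exact absurd hf' (h.end_comp hxx hx)
    · exact absurd hf (h.end_comp (hxx.trans hsv.symm) hx)
    · exact h.ends hxx hx hx'
  · intro x g hxg hx hg
    rw [pushCW_hasEnd] at hx
    rw [mem_pushCW_comps] at hg
    rcases hx with rfl | rfl | hx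
    · exact hg.2.2 (h.comp_unique _ _ hxg hf' hg.1).symm
    · exact hg.2.1 (h.comp_unique _ _ (hsv.trans hxg) hf hg.1).symm
    · exact h.end_comp hxg hx hg.1
  · intro g g' hgg hg hg'
    exact h.comp_unique _ _ hgg ((mem_pushCW_comps _).1 hg).1 ((mem_pushCW_comps _).1 hg').1

lemma pushToEdge_pushCW (h : X.IsMulticurve S) (hf : f ∈ X.comps) :
    (X.pushCW S f).pushToEdge S (S.opp f) = X := by
  have hf' := h.comps_opp _ hf
  have e1 : ¬ X.HasEnd (S.opp f) := fun h' => h.end_comp .rfl h' hf'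
  have e2 : ¬ X.HasEnd (S.rot f) := fun h' =>
    h.end_comp (S.sameVertex_rot f).symm h' hf
  refine Diagram.ext rfl ?_ ?_
  · funext p q
    simp only [pushToEdge_joined, pushCW_joined, eq_iff_iff, ← S.rot_eq]
    constructor
    · rintro ⟨h1 | h1, h2⟩
      · exact h1
      · exact absurd h1 h2
    · refine fun h1 => ⟨Or.inl h1, ?_⟩
      rintro (⟨rfl, -⟩ | ⟨rfl, -⟩)
      · exact e1 ⟨_, h1⟩
      · exact e2 ⟨_, h1⟩
  · ext x
    simp only [pushToEdge, pushCW, S.opp_opp, Set.mem_union, Set.mem_sdiff, Set.mem_insert_iff,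
      Set.mem_singleton_iff]
    constructor
    · rintro (⟨h1, -⟩ | rfl | rfl) <;> assumption
    · intro h1; by_cases x = f <;> by_cases x = S.opp f <;> tauto

lemma tighten_pushCW (h : X.IsMulticurve S) (hf : f ∈ X.comps) : Tighten S (X.pushCW S f) X := by
  conv => rhs; rw [← pushToEdge_pushCW h hf]
  exact .pushToEdge _ _ (h.comps_cnt _ (h.comps_opp _ hf)) (Or.inr (Or.inl ⟨rfl, rfl⟩))

lemma pushCW_joined_point {p : Port D} {x : D} {i : ℕ}
    (hj : (X.pushCW S f).joined p (.point x i)) : X.joined p (.point x i) := by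
  rcases hj with hj | ⟨-, h1⟩ | ⟨-, h1⟩
  · exact hj
  · simp at h1
  · simp at h1

lemma pushCW_endsAt (h : X.IsMulticurve S) (hf : f ∈ X.comps) (u : D) :
    (X.pushCW S f).EndsAt S u ↔ X.EndsAt S u := by
  have hsv := S.sameVertex_rot f
  have hf' := h.comps_opp _ hf
  constructor
  · rintro ⟨x, hx, h1 | h1⟩
    · rw [pushCW_hasEnd] at h1
      rcases h1 with rfl | rfl | h1
      · exact ⟨_, hx, Or.inr hf'⟩
      · exact ⟨_, hsv.trans hx, Or.inr hf⟩
      · exact ⟨x, hx, Or.inl h1⟩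
    · exact ⟨x, hx, Or.inr ((mem_pushCW_comps _).1 h1).1⟩
  · rintro ⟨x, hx, h1 | h1⟩
    · exact ⟨x, hx, Or.inl ((pushCW_hasEnd _).2 (Or.inr (Or.inr h1)))⟩
    · by_cases h2 : x = f
      · subst h2
        exact ⟨_, hsv.symm.trans hx, Or.inl ((pushCW_hasEnd _).2 (Or.inr (Or.inl rfl)))⟩
      by_cases h3 : x = S.opp f
      · subst h3
        exact ⟨_, hx, Or.inl ((pushCW_hasEnd _).2 (Or.inl rfl))⟩
      · exact ⟨x, hx, Or.inr ((mem_pushCW_comps _).2 ⟨h1, h2, h3⟩)⟩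

end push
end Diagram

namespace Diagram

variable {D : Type*} {S : TriSurface D}

/-! ### Winding the ends up to an edge -/

/-- The multicurves that arise from a reduced multicurve by winding the ends at the endpoints of the
edge of `e` clockwise. -/
structure Winding (S : TriSurface D) (e : D) (X : Diagram D) : Prop where
  multicurve : X.IsMulticurve S
  noSideTurn : X.NoSideTurn
  no_loop : ∀ u, ¬ X.HasPunctureLoop S u
  ends : ∀ x q, X.joined (.vertex x) q → (∃ i, q = .point (S.next x) i) ∨
    (S.AtEdge e (S.next x) ∧ q = .vertex (S.next x)) ∨
    (S.AtEdge e x ∧ ∃ i, q = .point (S.prev x) i) ∨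
    (S.AtEdge e x ∧ q = .vertex (S.prev x))
  not_comp : e ∉ X.comps

/-- If an arc ends at the vertex of the corner `opp d`, then it does not start out along the side
`rot d` of its triangle. -/
def StartsAway (X : Diagram D) (S : TriSurface D) (d : D) : Prop :=
  ∀ q, X.joined (.vertex (S.opp d)) q → q.dart ≠ S.rot d

/-- What winding the end at one endpoint of the edge of `e` does not change. -/
structure WindKeeps (S : TriSurface D) (e : D) (X Z : Diagram D) : Prop where
  cnt : Z.cnt e = X.cnt e
  endsAt : ∀ u, Z.EndsAt S u ↔ X.EndsAt S u
  hasEnd_opp : ∀ x, S.SameVertex x (S.opp e) → (Z.HasEnd x ↔ X.HasEnd x)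
  comps_opp : ∀ x, S.SameVertex x (S.opp e) → (x ∈ Z.comps ↔ x ∈ X.comps)
  tight_opp : ∀ x, S.SameVertex x (S.opp e) → X.TightEnd S x → Z.TightEnd S x
  uncut_opp : ∀ x, S.SameVertex x (S.opp e) → X.Uncut S x → Z.Uncut S x
  startsAway_opp : X.StartsAway S (S.opp e) → Z.StartsAway S (S.opp e)

lemma WindKeeps.refl (e : D) (X : Diagram D) : WindKeeps S e X X :=
  ⟨rfl, fun _ => Iff.rfl, fun _ _ => Iff.rfl, fun _ _ => Iff.rfl, fun _ _ => id, fun _ _ => id, id⟩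

lemma WindKeeps.trans {e : D} {X Y Z : Diagram D} (h : WindKeeps S e X Y)
    (h' : WindKeeps S e Y Z) : WindKeeps S e X Z :=
  ⟨h'.cnt.trans h.cnt, fun u => (h'.endsAt u).trans (h.endsAt u),
    fun x hx => (h'.hasEnd_opp x hx).trans (h.hasEnd_opp x hx),
    fun x hx => (h'.comps_opp x hx).trans (h.comps_opp x hx),
    fun x hx hz => h'.tight_opp x hx (h.tight_opp x hx hz),
    fun x hx hz => h'.uncut_opp x hx (h.uncut_opp x hx hz),
    fun hz => h'.startsAway_opp (h.startsAway_opp hz)⟩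

namespace Winding

variable {X Y Z : Diagram D} {e c f : D}

lemma symm_edge (h : Winding S e X) : Winding S (S.opp e) X := by
  have : ∀ x, S.AtEdge (S.opp e) x ↔ S.AtEdge e x := by
    intro x; simp [TriSurface.AtEdge, S.opp_opp, or_comm]
  refine ⟨h.multicurve, h.noSideTurn, h.no_loop, ?_, fun h' => h.not_comp ?_⟩
  · simpa only [this] using h.ends
  · simpa [S.opp_opp] using h.multicurve.comps_opp _ h'

lemma of_reduced (h : X.IsReduced S) (he : e ∉ X.comps) : Winding S e X :=
  ⟨h.multicurve, h.noTurnBacks.side, h.no_puncture_loop,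
    fun x q hq => Or.inl (h.noTurnBacks.vertex x q hq), he⟩

lemma not_vertex_point (h : Winding S e X) (x : D) (i : ℕ) :
    ¬ X.joined (.vertex x) (.point x i) := by
  intro hj
  rcases h.ends _ _ hj with ⟨k, hk⟩ | h' | ⟨-, k, hk⟩ | h'
  · simp at hk; exact S.next_ne _ hk.1.symm
  · simp at h'
  · simp at hk; exact S.prev_ne _ hk.1.symm
  · simp at h'

lemma wind (hS : S.Simple) (h : Winding S e X) (hc : X.HasEnd c) (hce : S.SameVertex c e) :
    Winding S e (X.windCW S c) := by
  have hM := h.multicurve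
  refine ⟨windCW_isMulticurve hS hM hc,
    windCW_noSideTurn hM h.noSideTurn (h.not_vertex_point c),
    fun u hu => h.no_loop u (hu.of_windCW hS hM hc), ?_, h.not_comp⟩
  intro x q hq
  by_cases hx : x = S.rot c
  · subst hx
    rw [windCW_joined_rot hS hM hc hq]
    exact Or.inr (Or.inr (Or.inl ⟨Or.inl ((S.sameVertex_rot c).symm.trans hce), _,
      by rw [S.prev_rot]⟩))
  · obtain ⟨hxc, q₀, hq₀, hj⟩ := windCW_joined_vertex hx hq
    have hold := h.ends x q₀ hj
    cases q with
    | vertex y =>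
      by_cases hy : y = c
      · simp [windCWPort, hy] at hq₀
      · simp [windCWPort, hy] at hq₀; subst hq₀; exact hold
    | point y i =>
      by_cases hy : y = c
      · subst hy
        by_cases hi : i = 0
        · simp [windCWPort, hi] at hq₀; subst hq₀
          rcases hold with ⟨k, hk⟩ | ⟨h', hk⟩ | ⟨h', k, hk⟩ | ⟨h', hk⟩
          · simp at hk
          · simp at hk; exact Or.inl ⟨i, by rw [hk]⟩
          · simp at hk
          · simp at hk; exact Or.inr (Or.inr (Or.inl ⟨h', i, by rw [hk]⟩))
        · simp [windCWPort, hi] at hq₀; subst hq₀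
          simpa using hold
      · simp [windCWPort, hy] at hq₀; subst hq₀; exact hold

lemma push (hS : S.Simple) (h : Winding S e X) (hf : f ∈ X.comps) (hfe : S.SameVertex f e) :
    Winding S e (X.pushCW S f) := by
  have hM := h.multicurve
  have hrot : S.AtEdge e (S.rot f) := Or.inl ((S.sameVertex_rot f).symm.trans hfe)
  refine ⟨pushCW_isMulticurve hS hM hf,
    fun _ _ _ hj => h.noSideTurn _ _ _ (pushCW_joined_point hj), ?_, ?_,
    fun h' => h.not_comp ((mem_pushCW_comps _).1 h').1⟩
  · rintro u ⟨i, hi⟩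
    exact h.no_loop u ⟨i, fun c hc => ⟨(hi c hc).1, pushCW_joined_point (hi c hc).2⟩⟩
  · rintro x q (hq | ⟨h1, rfl⟩ | ⟨h1, rfl⟩)
    · exact h.ends x q hq
    · obtain rfl := Port.vertex.inj h1
      exact Or.inr (Or.inl ⟨hrot, rfl⟩)
    · obtain rfl := Port.vertex.inj h1
      exact Or.inr (Or.inr (Or.inr ⟨hrot, by rw [S.prev_rot]⟩))

lemma step (hS : S.Simple) (h : Winding S e X) (hY : StepCW S e X Y) : Winding S e Y := by
  cases hY with
  | push f hf hfe => exact h.push hS hf hfe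
  | wind c hc hce hne => exact h.wind hS hc hce

lemma keeps_wind (hS : S.Simple) (h : Winding S e X) (hc : X.HasEnd c) (hce : S.SameVertex c e)
    (hne : c ≠ e) : WindKeeps S e X (X.windCW S c) := by
  have hM := h.multicurve
  have hno : ∀ x, S.SameVertex x (S.opp e) → x ≠ c ∧ x ≠ S.rot c := by
    refine fun x hx => ⟨?_, ?_⟩ <;> rintro rfl
    · exact hS.not_sameVertex_opp e (hce.symm.trans hx)
    · exact hS.not_sameVertex_opp e (hce.symm.trans ((S.sameVertex_rot c).trans hx))
  have hco : e ≠ S.opp c := fun h' =>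
    hS.not_sameVertex_opp c (by rw [← h']; exact hce)
  have hnext : ¬ S.SameVertex (S.opp c) (S.opp e) := fun h' => hne (hS.eq_of_sameVertex hce h')
  refine ⟨by simp [windCW_cnt, cntAdd, hne.symm, hco], windCW_endsAt hM hc, ?_,
    fun _ _ => Iff.rfl, ?_, ?_, ?_⟩
  · intro x hx
    rw [windCW_hasEnd hM]
    have := hno x hx
    simp [this]
  · intro x hx ht q hq
    obtain ⟨hxc, q₀, hq₀, hj⟩ := windCW_joined_vertex (hno x hx).2 hq
    obtain ⟨i, rfl⟩ := ht _ hj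
    cases q with
    | vertex y => simp only [windCWPort] at hq₀; grind
    | point y k =>
      have := windCWPort_dart hq₀
      exact ⟨k, by rw [show y = S.next x from this.symm]⟩
  · intro x hx hu
    refine hu.windCW (hno x hx).2 ?_
    rintro rfl
    exact hnext ((S.sameVertex_next c).trans hx)
  · intro ha q hq
    rw [S.opp_opp] at hq
    by_cases her : e = S.rot c
    · -- the new end lies on the other side of its triangle
      have := windCW_joined_rot hS hM hc (her ▸ hq)
      rw [this, Port.dart_point, S.rot_opp, her, ← S.prev_rot]
      exact (S.next_ne_prev _).symm
    · obtain ⟨hxc, q₀, hq₀, hj⟩ := windCW_joined_vertex her hq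
      rw [← windCWPort_dart hq₀]
      exact ha q₀ (by rwa [S.opp_opp])

lemma keeps_push (hS : S.Simple) (h : Winding S e X) (hf : f ∈ X.comps) (hfe : S.SameVertex f e) :
    WindKeeps S e X (X.pushCW S f) := by
  have hM := h.multicurve
  have hne : f ≠ e := by rintro rfl; exact h.not_comp hf
  have h1 : ∀ x, S.SameVertex x (S.opp e) → x ≠ f ∧ x ≠ S.opp f ∧ x ≠ S.rot f := by
    refine fun x hx => ⟨?_, ?_, ?_⟩ <;> rintro rfl
    · exact hS.not_sameVertex_opp e (hfe.symm.trans hx)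
    · exact hne (hS.eq_of_sameVertex hfe hx)
    · exact hS.not_sameVertex_opp e (hfe.symm.trans ((S.sameVertex_rot f).trans hx))
  refine ⟨rfl, pushCW_endsAt hM hf, ?_, ?_, ?_, ?_, ?_⟩
  · intro x hx
    rw [pushCW_hasEnd]; simp [h1 x hx]
  · intro x hx
    rw [mem_pushCW_comps]; simp [h1 x hx]
  · rintro x hx ht q (hq | ⟨h2, -⟩ | ⟨h2, -⟩)
    · exact ht q hq
    · exact absurd (Port.vertex.inj h2) (h1 x hx).2.1
    · exact absurd (Port.vertex.inj h2) (h1 x hx).2.2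
  · exact fun x hx hu => ⟨fun i j hij => hu.point_point i j (pushCW_joined_point hij),
      fun i hi => hu.vertex_point i (pushCW_joined_point hi),
      fun i hi => hu.vertex_prev i (pushCW_joined_point hi)⟩
  · rintro ha q (hq | ⟨h2, -⟩ | ⟨h2, rfl⟩)
    · exact ha q hq
    · rw [S.opp_opp] at h2
      have := Port.vertex.inj h2
      exact absurd hfe (by rw [this]; exact hS.not_sameVertex_opp f)
    · rw [S.opp_opp] at h2
      have := Port.vertex.inj h2
      rw [Port.dart_vertex, S.rot_opp, this, ← S.prev_rot]
      exact (S.next_ne_prev _).symm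

/-- There is only one way to wind. -/
lemma step_unique (h : X.IsMulticurve S) (hY : StepCW S e X Y) (hZ : StepCW S e X Z) : Y = Z := by
  cases hY with
  | push f hf hfe =>
    cases hZ with
    | push f' hf' hfe' => rw [h.comp_unique _ _ (hfe.trans hfe'.symm) hf hf']
    | wind c hc hce hne => exact absurd hf (h.end_comp (hce.trans hfe.symm) hc)
  | wind c hc hce hne =>
    cases hZ with
    | push f' hf' hfe' => exact absurd hf' (h.end_comp (hce.trans hfe'.symm) hc)
    | wind c' hc' hce' hne' => rw [h.ends (hce.trans hce'.symm) hc hc']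

lemma not_step (h : X.EndsOnlyIn S e e) : ¬ StepCW S e X Y := by
  intro hY
  cases hY with
  | push f hf hfe => exact h.1 f hfe hf
  | wind c hc hce hne => exact hne (h.2 c hce hc)

lemma windsCW_unique (hS : S.Simple) (h : Winding S e X) (hY : WindsCW S e X Y)
    (hZ : WindsCW S e X Z) : Y = Z := by
  obtain ⟨hY, hYe⟩ := hY
  obtain ⟨hZ, hZe⟩ := hZ
  induction hY using Relation.ReflTransGen.head_induction_on with
  | refl =>
    rcases Relation.ReflTransGen.cases_head hZ with h' | ⟨B, hB, -⟩
    · exact h'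
    · exact absurd hB (not_step hYe)
  | head hA _ ih =>
    rcases Relation.ReflTransGen.cases_head hZ with rfl | ⟨B, hB, hBZ⟩
    · exact absurd hA (not_step hZe)
    · obtain rfl := step_unique h.multicurve hA hB
      exact ih (h.step hS hA) hBZ

lemma of_windsCW (hS : S.Simple) (h : Winding S e X) (hY : WindsCW S e X Y) : Winding S e Y := by
  obtain ⟨hY, -⟩ := hY
  induction hY with
  | refl => exact h
  | tail _ hs ih => exact ih.step hS hs

/-- An end at the initial vertex of `e` can be wound clockwise up to `e`; an uncut corner that it
does not run into stays uncut. -/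
lemma exists_windsCW_of_hasEnd (hS : S.Simple) (h : Winding S e X) {x c₀ : D} (hx : X.HasEnd x)
    (hxe : S.SameVertex x e) (hc₀ : S.SameVertex c₀ e) (hu : X.Uncut S c₀) {m : ℕ}
    (hm : (S.rot ^ m) x = e) (hlt : ∀ l < m, (S.rot ^ l) x ≠ e)
    (havoid : ∀ l < m, (S.rot ^ (l + 1)) x ≠ c₀) (ha : c₀ = S.rot e → X.StartsAway S e) :
    ∃ Z, WindsCW S e X Z ∧ Relation.ReflTransGen (Tighten S) Z X ∧ WindKeeps S e X Z ∧
      Z.Uncut S c₀ ∧ (c₀ = S.rot e → Z.StartsAway S e) := by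
  induction m generalizing X x with
  | zero =>
    have hxe' : x = e := hm
    subst hxe'
    exact ⟨X, ⟨.refl, fun f hf => h.multicurve.end_comp hf.symm hx,
      fun y hy hye => h.multicurve.ends hy hye hx⟩, .refl, .refl _ X, hu, ha⟩
  | succ m ih =>
    have hM := h.multicurve
    have hne : x ≠ e := hlt 0 (by omega)
    have hsv := S.sameVertex_rot x
    have hpow : ∀ l, (S.rot ^ (l + 1)) x = (S.rot ^ l) (S.rot x) := fun l => by
      rw [pow_succ]; rfl
    have hav : c₀ ≠ S.next x := by
      rintro rfl
      exact hS.no_one_cycle x (hxe.trans hc₀.symm)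
    have ha' : c₀ = S.rot e → (X.windCW S x).StartsAway S e := by
      intro hc q hq
      have hr : S.opp e ≠ S.rot x := fun h' =>
        hS.not_sameVertex_opp e (hxe.symm.trans (h' ▸ hsv))
      obtain ⟨-, q₀, hq₀, hj⟩ := windCW_joined_vertex hr hq
      rw [← windCWPort_dart hq₀]
      exact ha hc q₀ hj
    obtain ⟨Z, z1, z2, z3, z4, z5⟩ := ih (h.wind hS hx hxe) (x := S.rot x)
      ((windCW_hasEnd hM _).2 (Or.inl rfl)) (hsv.symm.trans hxe)
      (hu.windCW (Ne.symm (havoid 0 (by omega))) hav) (by rw [← hpow, hm])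
      (fun l hl => hpow l ▸ hlt (l + 1) (by omega))
      (fun l hl => hpow (l + 1) ▸ havoid (l + 1) (by omega)) ha'
    exact ⟨Z, ⟨.head (.wind X x hx hxe hne) z1.1, z1.2⟩, z2.tail (tighten_windCW hM),
      (h.keeps_wind hS hx hxe hne).trans z3, z4, z5⟩

/-- An end in an uncut corner at the initial vertex of `e` can be wound clockwise up to `e`. -/
lemma exists_windsCW_of_uncut [Finite D] (hS : S.Simple) (h : Winding S e X) {x : D}
    (hx : X.HasEnd x) (hxe : S.SameVertex x e) (hu : X.Uncut S x)
    (ha : x = S.rot e → X.StartsAway S e) :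
    ∃ Z, WindsCW S e X Z ∧ Relation.ReflTransGen (Tighten S) Z X ∧ WindKeeps S e X Z ∧
      Z.Uncut S x ∧ (x = S.rot e → Z.StartsAway S e) := by
  classical
  have hex : ∃ m : ℕ, (S.rot ^ m) x = e := by
    obtain ⟨m, -, hm⟩ := Equiv.Perm.SameCycle.exists_pow_eq' hxe
    exact ⟨m, hm⟩
  refine h.exists_windsCW_of_hasEnd hS hx hxe hxe hu (Nat.find_spec hex)
    (fun l hl => Nat.find_min hex hl) ?_ ha
  intro l hl hcyc
  refine Nat.find_min hex (m := Nat.find hex - (l + 1)) (by omega) ?_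
  have := Nat.find_spec hex
  rw [show Nat.find hex = Nat.find hex - (l + 1) + (l + 1) by omega, pow_add,
    Equiv.Perm.mul_apply, hcyc] at this
  exact this

/-- The corner of a tight end is not cut off. -/
lemma _root_.Diagram.TightEnd.uncut (hM : X.IsMulticurve S) (hx : X.HasEnd c)
    (ht : X.TightEnd S c) : X.Uncut S c := by
  obtain ⟨q, hq⟩ := hx
  obtain ⟨k, rfl⟩ := ht q hq
  refine ⟨fun i j hij => ?_, fun i hi => ?_, fun i hi => ?_⟩
  · exact hM.noncrossing c _ _ _ _ hq hij ⟨by simp [Before], by simp [Before], by simp [Before]⟩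
  · have := hM.unique hq hi; simp [S.next_ne] at this
  · have := hM.unique hq hi; simp [S.next_ne_prev] at this

/-- A multicurve that is tight at the initial vertex of `e` can be wound clockwise there up to `e`,
and then still has an uncut corner at this vertex. -/
lemma exists_windsCW [Finite D] (hS : S.Simple) (h : Winding S e X)
    (ht : ∀ x, S.SameVertex x e → X.TightEnd S x) :
    ∃ Z, WindsCW S e X Z ∧ Relation.ReflTransGen (Tighten S) Z X ∧ WindKeeps S e X Z ∧
      ∃ c₀, S.SameVertex c₀ e ∧ Z.Uncut S c₀ ∧
        (Z.HasEnd e → c₀ = S.rot e → Z.StartsAway S e) := by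
  have hM := h.multicurve
  by_cases hend : ∃ x, S.SameVertex x e ∧ X.HasEnd x
  · obtain ⟨x, hxe, hx⟩ := hend
    have ha : x = S.rot e → X.StartsAway S e := by
      rintro rfl q hq hd
      obtain ⟨r, hr⟩ := hx
      obtain ⟨i, rfl⟩ := ht _ hxe _ hr
      have m1 := S.next_ne (S.opp e); have m2 := S.prev_ne (S.opp e)
      have m3 := S.next_ne_prev (S.opp e)
      rw [S.rot_eq, S.next_next] at hr
      rw [S.rot_eq] at hd
      cases q with
      | vertex y =>
        obtain rfl : y = S.next (S.opp e) := hd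
        have := hM.unique hr (hM.symm _ _ hq)
        simp at this
      | point y k =>
        obtain rfl : y = S.next (S.opp e) := hd
        refine hM.noncrossing (S.opp e) _ _ _ _ hq hr ⟨?_, ?_, ?_⟩ <;> simp [Before]
    obtain ⟨Z, z1, z2, z3, z4, z5⟩ := h.exists_windsCW_of_uncut hS hx hxe
      ((ht x hxe).uncut hM hx) ha
    exact ⟨Z, z1, z2, z3, x, hxe, z4, fun _ => z5⟩
  by_cases hcomp : ∃ f, S.SameVertex f e ∧ f ∈ X.comps
  · obtain ⟨f, hfe, hf⟩ := hcomp
    have hsv := S.sameVertex_rot f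
    have hM' := (h.push hS hf hfe).multicurve
    have h0 : X.cnt (S.opp f) = 0 := hM.comps_cnt _ (hM.comps_opp _ hf)
    have hjr : (X.pushCW S f).joined (.vertex (S.rot f)) (.vertex (S.opp f)) :=
      Or.inr (Or.inr ⟨rfl, rfl⟩)
    have hpr : ∀ i p, ¬ (X.pushCW S f).joined (.point (S.prev (S.rot f)) i) p := by
      intro i p hp
      have := hM'.lt_cnt hp
      rw [S.prev_rot] at this
      exact absurd (this.trans_eq h0) (Nat.not_lt_zero _)
    have hu : (X.pushCW S f).Uncut S (S.rot f) := by
      refine ⟨fun i j hij => hpr _ _ (hM'.symm _ _ hij), fun i hi => ?_,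
        fun i hi => hpr _ _ (hM'.symm _ _ hi)⟩
      have := hM'.unique hjr hi
      simp at this
    obtain ⟨Z, z1, z2, z3, z4, z5⟩ := (h.push hS hf hfe).exists_windsCW_of_uncut hS
      (x := S.rot f) ⟨_, hjr⟩ (hsv.symm.trans hfe) hu
      (fun hrot => absurd (S.rot.injective hrot ▸ hf) h.not_comp)
    exact ⟨Z, ⟨.head (.push X f hf hfe) z1.1, z1.2⟩, z2.tail (tighten_pushCW hM hf),
      (h.keeps_push hS hf hfe).trans z3, S.rot f, hsv.symm.trans hfe, z4, fun _ => z5⟩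
  · push Not at hend hcomp
    obtain ⟨c₀, hc₀, hu⟩ := exists_uncut hM h.noSideTurn e ht (h.no_loop e)
    exact ⟨X, ⟨.refl, hcomp, fun x hx hxe => absurd hxe (hend x hx)⟩, .refl, .refl _ X, c₀, hc₀, hu,
      fun hz => absurd hz (hend e .rfl)⟩

end Winding

/-- The ends of a multicurve at the endpoints of the edge of `e` are wound clockwise up to this
edge, and in a way that leaves room for winding them back after a positive smoothing. -/
structure Wound (S : TriSurface D) (e : D) (X : Diagram D) : Prop extends Winding S e X where
  endsOnlyIn : X.EndsOnlyIn S e e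
  endsOnlyIn_opp : X.EndsOnlyIn S (S.opp e) (S.opp e)
  uncut : ∃ c, S.SameVertex c e ∧ X.Uncut S c ∧ (X.HasEnd e → c = S.rot e → X.StartsAway S e)
  uncut_opp : ∃ c, S.SameVertex c (S.opp e) ∧ X.Uncut S c ∧
    (X.HasEnd (S.opp e) → c = S.rot (S.opp e) → X.StartsAway S (S.opp e))

lemma Wound.symm_edge {e : D} {X : Diagram D} (h : Wound S e X) : Wound S (S.opp e) X :=
  ⟨h.toWinding.symm_edge, h.endsOnlyIn_opp, by rw [S.opp_opp]; exact h.endsOnlyIn, h.uncut_opp,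
    by rw [S.opp_opp]; exact h.uncut⟩

/-- The ends of a reduced multicurve can be wound clockwise up to the edge of `e`. -/
lemma IsReduced.exists_wound [Finite D] (hS : S.Simple) {e : D} {α : Diagram D}
    (h : α.IsReduced S) (he : e ∉ α.comps) :
    ∃ X₁ X₂, WindsCW S e α X₁ ∧ WindsCW S (S.opp e) X₁ X₂ ∧ Wound S e X₂ ∧
      Relation.ReflTransGen (Tighten S) X₂ α ∧ X₂.cnt e = α.cnt e ∧
      ∀ u, X₂.EndsAt S u ↔ α.EndsAt S u := by
  have hW := Winding.of_reduced h he
  obtain ⟨X₁, a1, a2, a3, c₁, c2, c3, c4⟩ := hW.exists_windsCW hS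
    (fun x _ => h.noTurnBacks.vertex x)
  have hW1 := hW.of_windsCW hS a1
  have hW1' := hW1.symm_edge
  obtain ⟨X₂, b1, b2, b3, d₁, d2, d3, d4⟩ := hW1'.exists_windsCW hS
    (fun x hx => a3.tight_opp x hx (h.noTurnBacks.vertex x))
  have hW2 := (hW1'.of_windsCW hS b1).symm_edge
  rw [S.opp_opp] at hW2
  have o : ∀ {x}, S.SameVertex x e → S.SameVertex x (S.opp (S.opp e)) := fun hx => by
    rwa [S.opp_opp]
  refine ⟨X₁, X₂, a1, b1, ⟨hW2, ⟨fun f hf hfc => ?_, fun x hx hxe => ?_⟩, b1.2,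
    ⟨c₁, c2, b3.uncut_opp c₁ (o c2) c3, fun hz hc => ?_⟩, ⟨d₁, d2, d3, d4⟩⟩, b2.trans a2, ?_,
    fun u => (b3.endsAt u).trans (a3.endsAt u)⟩
  · exact a1.2.1 f hf ((b3.comps_opp f (o hf)).1 hfc)
  · exact a1.2.2 x hx ((b3.hasEnd_opp x (o hx)).1 hxe)
  · have := b3.startsAway_opp
    rw [S.opp_opp] at this
    exact this (c4 ((b3.hasEnd_opp e (o .rfl)).1 hz) hc)
  · have := b3.cnt
    rw [hW2.multicurve.cnt_opp, hW1.multicurve.cnt_opp] at this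
    exact this.trans a3.cnt

/-- The multicurve with its ends wound up is unique. -/
lemma IsReduced.wound_unique (hS : S.Simple) {e : D} {α X₁ X₂ Z₁ Z₂ : Diagram D}
    (h : α.IsReduced S) (he : e ∉ α.comps) (hX₁ : WindsCW S e α X₁)
    (hX₂ : WindsCW S (S.opp e) X₁ X₂) (hZ₁ : WindsCW S e α Z₁) (hZ₂ : WindsCW S (S.opp e) Z₁ Z₂) :
    X₂ = Z₂ := by
  have hW := Winding.of_reduced h he
  obtain rfl := hW.windsCW_unique hS hX₁ hZ₁
  exact (hW.of_windsCW hS hX₁).symm_edge.windsCW_unique hS hX₂ hZ₂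

end Diagram

namespace Diagram

variable {D : Type*} {S : TriSurface D}

/-! ### The positive smoothing -/

section smooth

variable {X : Diagram D} {e : D}

open Classical in
/-- The number of crossing points after a positive smoothing. -/
def posCnt (X : Diagram D) (S : TriSurface D) (e : D) : D → ℕ :=
  fun x => if x = e ∨ x = S.opp e then X.crossings e e (S.opp e) - 1 else X.cnt x

open Classical in
/-- The former names of the ports after a positive smoothing. -/
def posPort (X : Diagram D) (S : TriSurface D) (e : D) : Port D → Option (Port D)
  | .point x i => if x = e ∨ x = S.opp e then some (X.posSeq x i) else some (.point x i)
  | .vertex x =>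
      if (x = e ∨ x = S.opp e) ∧ X.HasEnd x then none
      else if x = S.next e ∧ ¬ X.HasEnd (S.opp e) then some (X.posSeq e (X.posLast e))
      else if x = S.next (S.opp e) ∧ ¬ X.HasEnd e then
        some (X.posSeq (S.opp e) (X.posLast (S.opp e)))
      else some (.vertex x)

lemma posSmooth_joined (X : Diagram D) (e : D) :
    (X.posSmooth S e).joined = X.renamed (X.posCnt S e) (X.posPort S e) := rfl

lemma posSmooth_cnt (X : Diagram D) (e : D) : (X.posSmooth S e).cnt = X.posCnt S e := rfl

open Classical in
lemma posSmooth_comps (X : Diagram D) (e : D) : (X.posSmooth S e).comps =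
    if X.crossings e e (S.opp e) = 0 then X.comps ∪ {e, S.opp e} else X.comps := rfl

lemma crossings_symm (h : X.IsMulticurve S) :
    X.crossings (S.opp e) (S.opp e) (S.opp (S.opp e)) = X.crossings e e (S.opp e) := by
  unfold crossings
  rw [S.opp_opp, h.cnt_opp]; omega

lemma posCnt_opp (h : X.IsMulticurve S) : X.posCnt S (S.opp e) = X.posCnt S e := by
  have oo := S.opp_opp e
  funext x
  simp only [posCnt, crossings_symm h]
  grind

lemma posPort_opp (X : Diagram D) (e : D) : X.posPort S (S.opp e) = X.posPort S e := by
  have n1 := S.opp_ne e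
  have n2 : S.next (S.opp e) ≠ S.next e := fun h => n1 (S.next_inj.1 h)
  have oo := S.opp_opp e
  funext p
  cases p <;> simp only [posPort] <;> grind

/-- The two directions of the edge play the same role. -/
lemma posSmooth_opp (h : X.IsMulticurve S) : X.posSmooth S (S.opp e) = X.posSmooth S e := by
  refine Diagram.ext (posCnt_opp h) ?_ ?_
  · rw [posSmooth_joined, posSmooth_joined, posCnt_opp h, posPort_opp]
  · rw [posSmooth_comps, posSmooth_comps, crossings_symm h, S.opp_opp, Set.pair_comm]

namespace Wound

lemma not_hasEnd_next (hS : S.Simple) (h : Wound S e X) : ¬ X.HasEnd (S.next e) := fun hx =>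
  hS.opp_ne_next e (h.endsOnlyIn_opp.2 _ (S.sameVertex_next e).symm hx).symm

lemma not_hasEnd_rot (hS : S.Simple) (h : Wound S e X) : ¬ X.HasEnd (S.next (S.opp e)) :=
  h.symm_edge.not_hasEnd_next hS

/-- An end at an endpoint of the edge is next to this edge. -/
lemma eq_of_hasEnd (h : Wound S e X) {x : D} (hx : X.HasEnd x) (hat : S.AtEdge e x) :
    x = e ∨ x = S.opp e :=
  hat.imp (fun h' => h.endsOnlyIn.2 x h' hx) (fun h' => h.endsOnlyIn_opp.2 x h' hx)

lemma not_comps (h : Wound S e X) {x : D} (hat : S.AtEdge e x) : x ∉ X.comps :=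
  hat.elim (h.endsOnlyIn.1 x) (h.endsOnlyIn_opp.1 x)

lemma posPort_inj (hS : S.Simple) (h : Wound S e X) {p p' r : Port D}
    (hp : p.Valid (X.posCnt S e)) (hp' : p'.Valid (X.posCnt S e)) (h1 : X.posPort S e p = some r)
    (h2 : X.posPort S e p' = some r) : p = p' := by
  have n1 := S.opp_ne e; have n2 := hS.opp_ne_next e; have n3 := S.next_ne e
  have n4 := S.next_ne (S.opp e); have n5 := hS.opp_ne_next (S.opp e); rw [S.opp_opp] at n5
  have n6 : S.next (S.opp e) ≠ S.next e := fun h => n1 (S.next_inj.1 h)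
  have hco := h.multicurve.cnt_opp e
  clear h
  by_cases a : X.HasEnd e <;> by_cases b : X.HasEnd (S.opp e) <;>
    cases p <;> cases p' <;> simp only [posPort, posSeq, posLast] at h1 h2 <;>
    simp only [Port.Valid, posCnt, crossings] at hp hp' <;> grind

lemma posPort_inTri {p r : Port D} (h1 : X.posPort S e p = some r) : S.InTri r.dart p.dart := by
  cases p <;> simp only [posPort, posSeq, posLast] at h1 <;> grind [Port.dart, TriSurface.InTri]

open Classical in
lemma posPort_surj (hS : S.Simple) (h : Wound S e X) {r s : Port D} (hr : X.joined r s) :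
    ∃ p : Port D, p.Valid (X.posCnt S e) ∧ X.posPort S e p = some r := by
  have n1 := S.opp_ne e; have n2 := hS.opp_ne_next e; have n3 := S.next_ne e
  have n4 := S.next_ne (S.opp e); have n5 := hS.opp_ne_next (S.opp e); rw [S.opp_opp] at n5
  have n6 : S.next (S.opp e) ≠ S.next e := fun h => n1 (S.next_inj.1 h)
  have hco := h.multicurve.cnt_opp e
  have hv := h.multicurve.valid _ _ hr
  have m1 := h.not_hasEnd_next hS
  have m2 := h.not_hasEnd_rot hS
  -- the ports in the sequence at `d` become crossing points, except possibly the last one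
  have key : ∀ d, (d = e ∨ d = S.opp e) → ∀ j,
      j < X.cnt d + (if X.HasEnd d then 1 else 0) → X.posSeq d j = r →
      ∃ p : Port D, p.Valid (X.posCnt S e) ∧ X.posPort S e p = some r := by
    rintro d hd j hj hjr
    by_cases hlt : j < X.crossings e e (S.opp e) - 1
    · refine ⟨.point d j, by simpa [Port.Valid, posCnt, hd] using hlt, ?_⟩
      simp [posPort, hd, hjr]
    · refine ⟨.vertex (S.next d), trivial, ?_⟩
      clear h hr hS hv
      simp only [crossings] at hlt
      simp only [posPort, posLast]
      subst hjr
      rcases hd with rfl | rfl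
      · by_cases a : X.HasEnd d <;> by_cases b : X.HasEnd (S.opp d) <;>
          simp only [a, b, if_true, if_false] at * <;> grind
      · by_cases a : X.HasEnd e <;> by_cases b : X.HasEnd (S.opp e) <;>
          simp only [a, b, if_true, if_false] at * <;> grind
  cases r with
  | point x i =>
    by_cases hx : x = e ∨ x = S.opp e
    · simp only [Port.Valid] at hv
      by_cases a : X.HasEnd x
      · exact key x hx (i + 1) (by simp only [a, if_true]; omega) (by simp [posSeq, a])
      · exact key x hx i (by simp only [a, if_false]; omega) (by simp [posSeq, a])
    · exact ⟨.point x i, by simpa [Port.Valid, posCnt, hx] using hv, by simp [posPort, hx]⟩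
  | vertex x =>
    have a : X.HasEnd x := ⟨_, hr⟩
    by_cases hx : x = e ∨ x = S.opp e
    · exact key x hx 0 (by simp [a]) (by simp [posSeq, a])
    · have e1 : x ≠ S.next e := by rintro rfl; exact m1 a
      have e2 : x ≠ S.next (S.opp e) := by rintro rfl; exact m2 a
      exact ⟨.vertex x, trivial, by simp [posPort, hx, e1, e2]⟩

open Classical in
/-- The renaming respects the order of the ports of the triangle of `e`. -/
lemma posPort_mono (hS : S.Simple) {p q r s : Port D}
    (hp : p.Valid (X.posCnt S e)) (hq : q.Valid (X.posCnt S e)) (h1 : X.posPort S e p = some r)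
    (h2 : X.posPort S e q = some s) (hpq : Before S e p q) : Before S e r s := by
  have n1 := S.next_ne e; have n2 := S.prev_ne e; have n3 := S.next_ne_prev e
  have n4 := S.opp_ne e; have n5 := hS.opp_ne_next e; have n6 := hS.opp_ne_prev e
  have n7 : S.next (S.opp e) ≠ e := hS.rot_ne e
  have n8 : S.next (S.opp e) ≠ S.next e := fun h => n4 (S.next_inj.1 h)
  have n9 : S.next (S.opp e) ≠ S.prev e := fun h => n5 (S.next_inj.1 h)
  have key : ∀ p r : Port D, S.InTri e p.dart → p.Valid (X.posCnt S e) →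
      X.posPort S e p = some r →
      (r = p ∧ (p.dart = e → p.rank = 0 ∧ ¬ X.HasEnd e) ∧
        (p.dart = S.next e → p.rank = 0 → X.HasEnd (S.opp e))) ∨
      (p.dart = e ∧ p.rank < X.crossings e e (S.opp e) ∧ 0 < p.rank ∧
        r.dart = e ∧ r.rank = p.rank - (if X.HasEnd e then 1 else 0)) ∨
      (p.dart = S.next e ∧ p.rank = 0 ∧ ¬ X.HasEnd (S.opp e) ∧
        r.dart = e ∧ r.rank = X.posLast e + (if X.HasEnd e then 0 else 1)) := by
    clear hS hp hq h1 h2 hpq p q r s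
    intro p r ht hp h1
    cases p with
    | point x i =>
      simp only [posPort, posSeq, Port.Valid, posCnt, Port.dart_point] at h1 ht hp
      rcases ht with rfl | rfl | rfl <;> grind [Port.dart, Port.rank]
    | vertex x =>
      simp only [posPort, posSeq, Port.dart_vertex] at h1 ht
      rcases ht with rfl | rfl | rfl <;> grind [Port.dart, Port.rank]
  have k1 := key p r hpq.inTri_left hp h1
  have k2 := key q s hpq.inTri_right hq h2
  clear key h1 h2 hp hq hS
  simp only [crossings, posLast] at k1 k2
  by_cases a : X.HasEnd e <;> by_cases b : X.HasEnd (S.opp e) <;>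
    simp only [a, b, if_true, if_false] at k1 k2 <;>
    simp only [Before] at * <;> grind

lemma posSmooth_planar (hS : S.Simple) (h : Wound S e X) : Planar S (X.posSmooth S e).joined := by
  have far : ∀ x, ¬ S.InTri e x → ¬ S.InTri (S.opp e) x → ∀ (p r : Port D), p.dart = x →
      X.posPort S e p = some r → r = p := by
    intro x h1 h2 p r hp h3
    simp only [TriSurface.InTri, not_or] at h1 h2
    cases p <;> simp only [posPort] at h3 <;> grind [Port.dart]
  refine h.multicurve.planar.renamed (fun p p' r hp hp' h1 h2 => h.posPort_inj hS hp hp' h1 h2)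
    (fun p r _ h1 => posPort_inTri h1) fun b => ?_
  by_cases hb : S.InTri e b
  · exact ⟨e, hb, fun p q r s _ _ hp hq h1 h2 _ _ => posPort_mono hS hp hq h1 h2⟩
  by_cases hb' : S.InTri (S.opp e) b
  · refine ⟨_, hb', fun p q r s _ _ hp hq h1 h2 _ _ => ?_⟩
    exact posPort_mono (e := S.opp e) hS (by rw [posCnt_opp h.multicurve]; exact hp)
      (by rw [posCnt_opp h.multicurve]; exact hq) (by rw [posPort_opp]; exact h1)
      (by rw [posPort_opp]; exact h2)
  · refine ⟨b, .rfl, fun p q r s _ _ hp hq h1 h2 _ _ hpq => ?_⟩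
    rw [far _ (fun h' => hb (h'.trans hpq.inTri_left.symm))
        (fun h' => hb' (h'.trans hpq.inTri_left.symm)) p r rfl h1,
      far _ (fun h' => hb (h'.trans hpq.inTri_right.symm))
        (fun h' => hb' (h'.trans hpq.inTri_right.symm)) q s rfl h2]
    exact hpq

end Wound
end smooth
end Diagram

namespace Diagram

variable {D : Type*} {S : TriSurface D} {X : Diagram D} {e : D}

/-! ### The positive smoothing unwinds when it is tightened -/

lemma posPort_dart_point {y : D} {i : ℕ} {s : Port D}
    (h : X.posPort S e (.point y i) = some s) : s.dart = y := by
  simp only [posPort, posSeq] at h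
  grind [Port.dart]

/-- A strand of the smoothed multicurve, in terms of the former names of its ends. -/
lemma posSmooth_of_joined {p q : Port D} (h : (X.posSmooth S e).joined p q) :
    ∃ r s, X.posPort S e p = some r ∧ X.posPort S e q = some s ∧ X.joined r s := h.2.2

namespace Wound

lemma posSmooth_full (hS : S.Simple) (h : Wound S e X) {p r s : Port D}
    (hp : p.Valid (X.posCnt S e)) (h1 : X.posPort S e p = some r) (hs : X.joined r s) :
    ∃ q, (X.posSmooth S e).joined p q := by
  obtain ⟨q, hq, h2⟩ := h.posPort_surj hS (h.multicurve.symm _ _ hs)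
  exact ⟨q, hp, hq, r, s, h1, h2, hs⟩

open Classical in
lemma posSeq_full (h : Wound S e X) {d : D} {j : ℕ}
    (hj : j < X.cnt d + (if X.HasEnd d then 1 else 0)) : ∃ s, X.joined (X.posSeq d j) s := by
  by_cases a : X.HasEnd d
  · simp only [a, if_true] at hj
    by_cases h0 : j = 0
    · obtain ⟨s, hs⟩ := a
      exact ⟨s, by simpa [posSeq, show X.HasEnd d from ⟨s, hs⟩, h0] using hs⟩
    · simp only [posSeq, a, h0, if_true, if_false]
      exact h.multicurve.full (by omega)
  · simp only [a, if_false] at hj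
    simp only [posSeq, a, if_false]
    exact h.multicurve.full hj

open Classical in
lemma posSeq_valid (h : Wound S e X) {d : D} {j : ℕ} {s : Port D}
    (hj : X.joined (X.posSeq d j) s) : j < X.cnt d + (if X.HasEnd d then 1 else 0) := by
  have := h.multicurve.valid _ _ hj
  by_cases a : X.HasEnd d
  · by_cases h0 : j = 0
    · simp [a, h0]
    · simp only [posSeq, a, h0, if_true, if_false, Port.Valid] at *; omega
  · simpa [posSeq, a] using this

lemma posPort_next (hS : S.Simple) (b : ¬ X.HasEnd (S.opp e)) :
    X.posPort S e (.vertex (S.next e)) = some (X.posSeq e (X.posLast e)) := by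
  have n2 := hS.opp_ne_next e; have n3 := S.next_ne e
  simp [posPort, n2.symm, n3, b]

open Classical in
lemma posSmooth_hasEnd_next (hS : S.Simple) (h : Wound S e X) :
    (X.posSmooth S e).HasEnd (S.next e) ↔
      ¬ X.HasEnd (S.opp e) ∧ 0 < X.crossings e e (S.opp e) := by
  have n2 := hS.opp_ne_next e; have n3 := S.next_ne e
  have n6 : S.next e ≠ S.next (S.opp e) := fun h => S.opp_ne e (S.next_inj.1 h).symm
  by_cases b : X.HasEnd (S.opp e)
  · simp only [b, not_true, false_and, iff_false]
    rintro ⟨q, hpq⟩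
    obtain ⟨r, s, h1, -, hj⟩ := posSmooth_of_joined hpq
    simp [posPort, n2.symm, n3, b, n6] at h1
    subst h1
    exact h.not_hasEnd_next hS ⟨_, hj⟩
  · simp only [b, not_false_iff, true_and]
    constructor
    · rintro ⟨q, hpq⟩
      obtain ⟨r, s, h1, -, hj⟩ := posSmooth_of_joined hpq
      rw [posPort_next hS b] at h1
      obtain rfl := Option.some.inj h1
      have := h.posSeq_valid hj
      simp only [crossings]; omega
    · intro hk
      have hlt : X.posLast e < X.cnt e + (if X.HasEnd e then 1 else 0) := by
        simp only [crossings, b, if_false] at hk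
        simp only [posLast]; omega
      obtain ⟨s, hs⟩ := h.posSeq_full hlt
      exact h.posSmooth_full hS trivial (posPort_next hS b) hs

lemma posSmooth_hasEnd (h : Wound S e X) {x : D} (h1 : x ≠ S.next e)
    (h2 : x ≠ S.next (S.opp e)) (hS : S.Simple) :
    (X.posSmooth S e).HasEnd x ↔ x ≠ e ∧ x ≠ S.opp e ∧ X.HasEnd x := by
  constructor
  · rintro ⟨q, hpq⟩
    obtain ⟨r, s, h3, -, hj⟩ := posSmooth_of_joined hpq
    by_cases hx : x = e ∨ x = S.opp e
    · by_cases a : X.HasEnd x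
      · simp [posPort, hx, a] at h3
      · simp [posPort, a, h1, h2] at h3
        subst h3
        exact absurd ⟨_, hj⟩ a
    · simp [posPort, hx, h1, h2] at h3
      subst h3
      push Not at hx
      exact ⟨hx.1, hx.2, _, hj⟩
  · rintro ⟨h3, h4, s, hs⟩
    exact h.posSmooth_full hS (p := .vertex x) trivial (by simp [posPort, h1, h2, h3, h4]) hs

/-- After the smoothing, there is an end at the initial vertex of `e` if and only if there was none
before. -/
lemma posSmooth_hasEnd_at (hS : S.Simple) (h : Wound S e X) {x : D} (hx : S.SameVertex x e) :
    (X.posSmooth S e).HasEnd x ↔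
      x = S.rot e ∧ ¬ X.HasEnd e ∧ 0 < X.crossings e e (S.opp e) := by
  have h1 : x ≠ S.next e := by
    rintro rfl; exact hS.no_one_cycle e hx.symm
  by_cases h2 : x = S.next (S.opp e)
  · subst h2
    have := h.symm_edge.posSmooth_hasEnd_next hS
    rw [posSmooth_opp h.multicurve, crossings_symm h.multicurve, S.opp_opp] at this
    rw [this, S.rot_eq]; simp
  · rw [h.posSmooth_hasEnd h1 h2 hS]
    constructor
    · rintro ⟨h3, -, h4⟩
      exact absurd (h.endsOnlyIn.2 x hx h4) h3
    · rintro ⟨rfl, -⟩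
      exact absurd rfl h2

lemma posSmooth_isMulticurve (hS : S.Simple) (h : Wound S e X) :
    (X.posSmooth S e).IsMulticurve S := by
  classical
  have hM := h.multicurve
  have hco := hM.cnt_opp e
  have oo := S.opp_opp e
  -- when there are no crossings, the edge becomes a component
  have hmem : ∀ f, f ∈ (X.posSmooth S e).comps →
      f ∈ X.comps ∨ (f = e ∨ f = S.opp e) ∧ X.crossings e e (S.opp e) = 0 := by
    intro f hf
    rw [posSmooth_comps] at hf
    split_ifs at hf with hk
    · rcases hf with hf | rfl | rfl <;> tauto
    · exact Or.inl hf
  have hat : ∀ {f}, f ∈ X.comps → ¬ S.AtEdge e f := fun hf h' => h.not_comps h' hf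
  have hend : ∀ {x y}, S.SameVertex x y → (X.posSmooth S e).HasEnd x → ¬ S.AtEdge e y →
      X.HasEnd x := by
    intro x y hxy hx hy
    have h1 : x ≠ S.next e := by
      rintro rfl; exact hy (Or.inr (hxy.symm.trans (S.sameVertex_next e).symm))
    have h2 : x ≠ S.next (S.opp e) := by
      rintro rfl; exact hy (Or.inl (hxy.symm.trans (S.sameVertex_rot e).symm))
    exact ((h.posSmooth_hasEnd h1 h2 hS).1 hx).2.2
  have hends : ∀ {x y}, S.SameVertex x e → S.SameVertex x y → (X.posSmooth S e).HasEnd x →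
      (X.posSmooth S e).HasEnd y → x = y := by
    intro x y hx hxy h1 h2
    rw [h.posSmooth_hasEnd_at hS hx] at h1
    rw [h.posSmooth_hasEnd_at hS (hxy.symm.trans hx)] at h2
    rw [h1.1, h2.1]
  refine .of_planar (h.posSmooth_planar hS) ?_ (fun p q hpq => hpq.1) ?_ ?_ ?_ ?_ ?_ ?_
  · intro x
    have := hM.cnt_opp x
    have := S.eq_opp_iff (a := x) (b := e)
    have := S.opp_inj (a := x) (b := e)
    simp only [posSmooth_cnt, posCnt]
    grind
  · intro d i hi
    by_cases hd : d = e ∨ d = S.opp e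
    · have hs : i < X.cnt d + (if X.HasEnd d then 1 else 0) := by
        simp only [posSmooth_cnt, posCnt, hd, if_true, crossings] at hi
        clear hmem hat hend hends h
        rcases hd with rfl | rfl <;> split_ifs at * <;> omega
      obtain ⟨s, hs⟩ := h.posSeq_full hs
      exact h.posSmooth_full hS hi (by simp [posPort, hd]) hs
    · simp only [posSmooth_cnt, posCnt, hd, if_false] at hi
      obtain ⟨s, hs⟩ := hM.full hi
      exact h.posSmooth_full hS (p := .point d i) (by simpa [Port.Valid, posCnt, hd] using hi)
        (by simp [posPort, hd]) hs
  · intro f hf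
    have hsub : X.comps ⊆ (X.posSmooth S e).comps := by
      rw [posSmooth_comps]; split_ifs
      exacts [Set.subset_union_left, subset_rfl]
    rcases hmem f hf with hf | ⟨hf, hk⟩
    · exact hsub (hM.comps_opp _ hf)
    · rw [posSmooth_comps, if_pos hk]
      rcases hf with rfl | rfl <;> simp [S.opp_opp]
  · intro f hf
    simp only [posSmooth_cnt, posCnt]
    rcases hmem f hf with hf | ⟨hf, hk⟩
    · have h1 : f ≠ e := fun h' => hat hf (Or.inl (h' ▸ .rfl))
      have h2 : f ≠ S.opp e := fun h' => hat hf (Or.inr (h' ▸ .rfl))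
      simpa [h1, h2] using hM.comps_cnt _ hf
    · simp [hf, hk]
  · intro x y hxy hx hy
    by_cases h1 : S.AtEdge e x
    · rcases h1 with h1 | h1
      · exact hends h1 hxy hx hy
      · -- the other endpoint, by symmetry
        have key := h.symm_edge
        have e1 := key.posSmooth_hasEnd_at hS h1
        have e2 := key.posSmooth_hasEnd_at hS (hxy.symm.trans h1)
        rw [posSmooth_opp hM] at e1 e2
        rw [(e1.1 hx).1, (e2.1 hy).1]
    · have h2 : ¬ S.AtEdge e y := fun h' => h1 (h'.of_sameVertex hxy)
      exact hM.ends hxy (hend hxy hx h2) (hend .rfl hy h2)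
  · intro x f hxf hx hf
    rcases hmem f hf with hf | ⟨hf, hk⟩
    · exact hM.end_comp hxf (hend hxf hx (hat hf)) hf
    · rcases hf with rfl | rfl
      · have := ((h.posSmooth_hasEnd_at hS hxf).1 hx).2.2
        omega
      · have e1 := h.symm_edge.posSmooth_hasEnd_at hS hxf
        rw [posSmooth_opp hM, crossings_symm hM] at e1
        have := (e1.1 hx).2.2
        omega
  · intro f g hfg hf hg
    rcases hmem f hf with hf | ⟨hf, hk⟩ <;> rcases hmem g hg with hg | ⟨hg, hk'⟩
    · exact hM.comp_unique _ _ hfg hf hg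
    · refine absurd ?_ (hat hf)
      rcases hg with rfl | rfl
      exacts [Or.inl hfg, Or.inr hfg]
    · refine absurd ?_ (hat hg)
      rcases hf with rfl | rfl
      exacts [Or.inl hfg.symm, Or.inr hfg.symm]
    · rcases hf with rfl | rfl <;> rcases hg with rfl | rfl
      · rfl
      · exact absurd hfg (hS.not_sameVertex_opp _)
      · exact absurd hfg.symm (hS.not_sameVertex_opp _)
      · rfl

lemma posSeq_eq (d : D) (j : ℕ) : X.posSeq d j = .vertex d ∨ ∃ i, X.posSeq d j = .point d i := by
  simp only [posSeq]; split_ifs <;> simp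

/-- The ports in the sequence along one side are not joined to each other. -/
lemma not_joined_posSeq (h : Wound S e X) (d : D) (i j : ℕ) :
    ¬ X.joined (X.posSeq d i) (X.posSeq d j) := by
  intro hj
  rcases posSeq_eq (X := X) d i with h1 | ⟨k, h1⟩ <;> rcases posSeq_eq (X := X) d j with h2 | ⟨l, h2⟩ <;>
    rw [h1, h2] at hj
  · exact h.multicurve.ne _ _ hj rfl
  · exact h.not_vertex_point _ _ hj
  · exact h.not_vertex_point _ _ (h.multicurve.symm _ _ hj)
  · exact h.noSideTurn _ _ _ hj

lemma posSmooth_noSideTurn (h : Wound S e X) : (X.posSmooth S e).NoSideTurn := by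
  intro d i j hpq
  obtain ⟨r, s, h1, h2, hj⟩ := posSmooth_of_joined hpq
  by_cases hd : d = e ∨ d = S.opp e
  · simp only [posPort, hd, if_true, Option.some.injEq] at h1 h2
    subst h1 h2
    exact h.not_joined_posSeq d i j hj
  · simp only [posPort, hd, if_false, Option.some.injEq] at h1 h2
    subst h1 h2
    exact h.noSideTurn _ _ _ hj

/-- Some corner at the initial vertex of `e` is left uncut, and is not blocked by an arc that crosses
the edge of `e` at its other endpoint. -/
lemma exists_uncut (hS : S.Simple) (h : Wound S e X) : ∃ c, S.SameVertex c e ∧ X.Uncut S c ∧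
    (c = S.rot e → X.StartsAway S e) := by
  obtain ⟨c, hc, hu, ha⟩ := h.uncut
  by_cases a : X.HasEnd e
  · exact ⟨c, hc, hu, ha a⟩
  by_cases hst : c = S.rot e → X.StartsAway S e
  · exact ⟨c, hc, hu, hst⟩
  -- the strand from the other endpoint cuts off the edge, hence there are no crossing points
  have hM := h.multicurve
  push Not at hst
  obtain ⟨rfl, hst⟩ := hst
  simp only [StartsAway, not_forall, not_not] at hst
  obtain ⟨q, hq, hqd⟩ := hst
  have n1 := S.next_ne (S.opp e); have n2 := S.prev_ne (S.opp e)
  have n3 := S.next_ne_prev (S.opp e)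
  rw [S.rot_eq] at hqd
  have h0 : X.cnt e = 0 := by
    rw [← hM.cnt_opp]
    by_contra h0
    obtain ⟨s, hs⟩ := hM.full (d := S.opp e) (i := 0) (by omega)
    obtain ⟨b1, b2⟩ := hM.planar.enclosed (b := S.opp e) hq hs (by simp [Before])
      (by simp [Before, hqd])
    have hsd : s.dart = S.opp e ∨ s.dart = S.next (S.opp e) := by
      simp only [Before] at b1 b2; grind
    cases s with
    | point x i =>
      rcases hsd with hx | hx <;> obtain rfl : x = _ := hx
      · exact h.noSideTurn _ _ _ hs
      · exact hu.point_point i 0 (by rw [S.prev_rot]; exact hM.symm _ _ hs)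
    | vertex x =>
      rcases hsd with hx | hx <;> obtain rfl : x = _ := hx
      · exact b1.ne rfl
      · exact h.not_hasEnd_rot hS ⟨_, hM.symm _ _ hs⟩
  refine ⟨e, .rfl, ⟨fun i j hij => ?_, fun i hi => a ⟨_, hi⟩, fun i hi => a ⟨_, hi⟩⟩, fun hr => ?_⟩
  · have := hM.lt_cnt hij; omega
  · exact absurd hr.symm (hS.rot_ne e)

lemma posPort_point {x : D} (h1 : x ≠ e) (h2 : x ≠ S.opp e) (i : ℕ) :
    X.posPort S e (.point x i) = some (.point x i) := by simp [posPort, h1, h2]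

/-- An uncut corner at the initial vertex of `e` is still uncut after the smoothing. -/
lemma posSmooth_uncut (hS : S.Simple) (h : Wound S e X) {c : D} (hc : S.SameVertex c e)
    (hu : X.Uncut S c) (ha : c = S.rot e → X.StartsAway S e) : (X.posSmooth S e).Uncut S c := by
  have hM := h.multicurve
  have hco : c ≠ S.opp e := by rintro rfl; exact hS.not_sameVertex_opp e hc.symm
  have hcn : c ≠ S.next e := by rintro rfl; exact hS.no_one_cycle e hc.symm
  have hpe : S.prev c ≠ e := fun h' => hcn (S.eq_next_iff.2 h'.symm)
  by_cases hce : c = e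
  · subst hce
    have hno : ¬ (X.posSmooth S c).HasEnd c := by
      rw [h.posSmooth_hasEnd_at hS .rfl]
      exact fun h' => hS.rot_ne c h'.1.symm
    refine ⟨?_, fun i hi => hno ⟨_, hi⟩, fun i hi => hno ⟨_, hi⟩⟩
    intro i j hpq
    obtain ⟨r, s, h1, h2, hj⟩ := posSmooth_of_joined hpq
    rw [posPort_point hpe (hS.opp_ne_prev c).symm] at h2
    simp only [posPort, true_or, if_true, Option.some.injEq] at h1 h2
    subst h1 h2
    rcases posSeq_eq (X := X) c i with h1 | ⟨k, h1⟩ <;> rw [h1] at hj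
    · exact hu.vertex_prev _ hj
    · exact hu.point_point _ _ hj
  by_cases hcr : c = S.rot e
  · have hst := ha hcr
    subst hcr
    have hpt : ∀ i j, ¬ X.joined (.point (S.rot e) i) (X.posSeq (S.opp e) j) := by
      intro i j hij
      rcases posSeq_eq (X := X) (S.opp e) j with h1 | ⟨k, h1⟩ <;> rw [h1] at hij
      · exact hst _ (hM.symm _ _ hij) rfl
      · exact hu.point_point i k (by rwa [S.prev_rot])
    have hv : ∀ q, ∀ r s, X.posPort S e (.vertex (S.rot e)) = some r → X.posPort S e q = some s →
        X.joined r s → r = X.posSeq (S.opp e) (X.posLast (S.opp e)) := by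
      intro q r s h1 h2 hj
      rw [← posPort_opp, S.rot_eq] at h1
      by_cases a : X.HasEnd e
      · have e1 := S.next_ne (S.opp e)
        have e2 : S.next (S.opp e) ≠ S.next e := fun h => S.opp_ne e (S.next_inj.1 h)
        have e3 : S.next (S.opp e) ≠ e := hce
        simp [posPort, S.opp_opp, e1, e2, e3, a] at h1
        subst h1
        exact absurd ⟨_, hj⟩ (h.not_hasEnd_rot hS)
      · rw [posPort_next hS (by rwa [S.opp_opp])] at h1
        exact (Option.some.inj h1).symm
    refine ⟨?_, ?_, ?_⟩
    · intro i j hpq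
      obtain ⟨r, s, h1, h2, hj⟩ := posSmooth_of_joined hpq
      rw [posPort_point hce hco] at h1
      simp only [S.prev_rot, posPort, or_true, if_true, Option.some.injEq] at h1 h2
      subst h1 h2
      exact hpt _ _ hj
    · intro i hpq
      obtain ⟨r, s, h1, h2, hj⟩ := posSmooth_of_joined hpq
      rw [hv _ r s h1 h2 hj] at hj
      rw [posPort_point hce hco] at h2
      obtain rfl := Option.some.inj h2
      exact hpt _ _ (hM.symm _ _ hj)
    · intro i hpq
      obtain ⟨r, s, h1, h2, hj⟩ := posSmooth_of_joined hpq
      rw [hv _ r s h1 h2 hj] at hj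
      simp only [S.prev_rot, posPort, or_true, if_true, Option.some.injEq] at h2
      subst h2
      exact h.not_joined_posSeq _ _ _ hj
  · have hpo : S.prev c ≠ S.opp e := fun h' => hcr (S.eq_next_iff.2 h'.symm)
    have hv : X.posPort S e (.vertex c) = some (.vertex c) := by
      have : c ≠ S.next (S.opp e) := hcr
      simp [posPort, hce, hco, hcn, this]
    refine ⟨?_, ?_, ?_⟩
    · intro i j hpq
      obtain ⟨r, s, h1, h2, hj⟩ := posSmooth_of_joined hpq
      rw [posPort_point hce hco] at h1
      rw [posPort_point hpe hpo] at h2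
      obtain rfl := Option.some.inj h1; obtain rfl := Option.some.inj h2
      exact hu.point_point _ _ hj
    · intro i hpq
      obtain ⟨r, s, h1, h2, hj⟩ := posSmooth_of_joined hpq
      rw [hv] at h1
      rw [posPort_point hce hco] at h2
      obtain rfl := Option.some.inj h1; obtain rfl := Option.some.inj h2
      exact hu.vertex_point _ hj
    · intro i hpq
      obtain ⟨r, s, h1, h2, hj⟩ := posSmooth_of_joined hpq
      rw [hv] at h1
      rw [posPort_point hpe hpo] at h2
      obtain rfl := Option.some.inj h1; obtain rfl := Option.some.inj h2
      exact hu.vertex_prev _ hj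

lemma posSmooth_no_loop_at (hS : S.Simple) (h : Wound S e X) {u : D} (hu : S.SameVertex u e) :
    ¬ (X.posSmooth S e).HasPunctureLoop S u := by
  obtain ⟨c, hc, hu', ha⟩ := h.exists_uncut hS
  exact (h.posSmooth_uncut hS hc hu' ha).no_puncture_loop (h.posSmooth_isMulticurve hS)
    (hc.trans hu.symm)

lemma posSmooth_no_loop (hS : S.Simple) (h : Wound S e X) (u : D) :
    ¬ (X.posSmooth S e).HasPunctureLoop S u := by
  by_cases hu : S.AtEdge e u
  · rcases hu with hu | hu
    · exact h.posSmooth_no_loop_at hS hu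
    · have := h.symm_edge.posSmooth_no_loop_at hS hu
      rwa [posSmooth_opp h.multicurve] at this
  rintro ⟨i, hi⟩
  refine h.no_loop u ⟨i, fun c hc => ?_⟩
  have hc1 : ∀ c, S.SameVertex c u → c ≠ e ∧ c ≠ S.opp e := by
    refine fun c hc => ⟨?_, ?_⟩ <;> rintro rfl
    exacts [hu (Or.inl hc.symm), hu (Or.inr hc.symm)]
  obtain ⟨h1, h2⟩ := hc1 c hc
  obtain ⟨h3, h4⟩ := hc1 _ ((S.sameVertex_rot c).symm.trans hc)
  have h5 : S.opp c ≠ e := fun h => h2 (by rw [← h, S.opp_opp])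
  have h6 : S.opp c ≠ S.opp e := fun h => h1 (S.opp_inj.1 h)
  have hcnt : (X.posSmooth S e).cnt c = X.cnt c := by simp [posSmooth_cnt, posCnt, h1, h2]
  obtain ⟨hlt, hpq⟩ := hi c hc
  obtain ⟨r, s, e1, e2, hj⟩ := posSmooth_of_joined hpq
  rw [posPort_point h5 h6] at e1
  rw [posPort_point h3 h4] at e2
  obtain rfl := Option.some.inj e1; obtain rfl := Option.some.inj e2
  rw [hcnt] at hlt hj
  exact ⟨hlt, hj⟩

/-- If an end appears at the initial vertex of `e`, it can be unwound. -/
lemma posSmooth_clearRun [Finite D] (hS : S.Simple) (h : Wound S e X) :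
    (X.posSmooth S e).ClearRun S e := by
  classical
  intro x hx hxe
  obtain ⟨rfl, a, hk⟩ := (h.posSmooth_hasEnd_at hS hx).1 hxe
  obtain ⟨c, hc, hu, ha⟩ := h.exists_uncut hS
  have hex : ∃ m : ℕ, (S.rot ^ m) (S.rot e) = c := by
    obtain ⟨m, -, hm⟩ := Equiv.Perm.SameCycle.exists_pow_eq' (hx.trans hc.symm)
    exact ⟨m, hm⟩
  refine ⟨Nat.find hex, fun l hl hle => ?_, ?_, fun hce q hq => ?_⟩
  · -- otherwise the run reaches the corner earlier
    refine Nat.find_min hex (m := Nat.find hex - (l + 1)) (by omega) ?_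
    have := Nat.find_spec hex
    rw [show Nat.find hex = (Nat.find hex - (l + 1)) + 1 + l by omega, pow_add,
      Equiv.Perm.mul_apply, hle, pow_succ, Equiv.Perm.mul_apply] at this
    exact this
  · rw [Nat.find_spec hex]
    exact h.posSmooth_uncut hS hc hu ha
  · rw [Nat.find_spec hex] at hce
    subst hce
    have hno : ¬ (X.posSmooth S c).HasEnd c := by
      rw [h.posSmooth_hasEnd_at hS .rfl]
      exact fun h' => hS.rot_ne c h'.1.symm
    refine ⟨?_, ?_⟩
    · rintro rfl
      exact hno ⟨_, (h.posSmooth_isMulticurve hS).symm _ _ hq⟩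
    · rintro i rfl
      have hb := ((h.posSmooth_hasEnd_next hS).1 ⟨_, hq⟩).1
      obtain ⟨r, s, h1, h2, hj⟩ := posSmooth_of_joined hq
      rw [posPort_point (S.prev_ne c) (hS.opp_ne_prev c).symm] at h2
      rw [posPort_next hS hb] at h1
      obtain rfl := Option.some.inj h1; obtain rfl := Option.some.inj h2
      simp only [posSeq, a, if_false] at hj
      exact hu.point_point _ _ hj

lemma posSmooth_ends_next (hS : S.Simple) (h : Wound S e X) {q : Port D}
    (hq : (X.posSmooth S e).joined (.vertex (S.next e)) q) :
    (∃ i, q = .point (S.next (S.next e)) i) ∨ (∃ i, q = .point (S.next e) i) ∨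
      q = .vertex (S.next (S.next e)) ∨ q = .vertex e := by
  have hM := h.posSmooth_isMulticurve hS
  have ht := hM.planar.inTri _ _ hq
  have hb := ((h.posSmooth_hasEnd_next hS).1 ⟨_, hq⟩).1
  cases q with
  | vertex y =>
    rcases ht with hy | hy | hy <;> simp at hy <;> subst hy
    · exact absurd rfl (hM.ne _ _ hq)
    · simp
    · simp
  | point y i =>
    rcases ht with hy | hy | hy <;> simp at hy <;> subst hy
    · simp
    · simp
    · exfalso
      obtain ⟨r, s, h1, h2, hj⟩ := posSmooth_of_joined hq
      rw [posPort_next hS hb] at h1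
      simp only [posPort, true_or, if_true, Option.some.injEq] at h1 h2
      subst h1 h2
      exact h.not_joined_posSeq _ _ _ hj

lemma posSmooth_ends (hS : S.Simple) (h : Wound S e X) {x : D} {q : Port D}
    (hq : (X.posSmooth S e).joined (.vertex x) q) : (∃ i, q = .point (S.next x) i) ∨
    (S.AtEdge e x ∧ ∃ i, q = .point x i) ∨ (S.AtEdge e x ∧ q = .vertex (S.next x)) ∨
    (S.AtEdge e (S.prev x) ∧ q = .vertex (S.prev x)) := by
  have hM := h.multicurve
  by_cases h1 : x = S.next e
  · subst h1
    have hat : S.AtEdge e (S.next e) := Or.inr (S.sameVertex_next e).symm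
    rcases h.posSmooth_ends_next hS hq with h' | h' | h' | h'
    · exact Or.inl h'
    · exact Or.inr (Or.inl ⟨hat, h'⟩)
    · exact Or.inr (Or.inr (Or.inl ⟨hat, h'⟩))
    · exact Or.inr (Or.inr (Or.inr ⟨by rw [S.prev_next]; exact Or.inl .rfl, by simpa using h'⟩))
  by_cases h2 : x = S.next (S.opp e)
  · subst h2
    have hat : S.AtEdge e (S.next (S.opp e)) := Or.inl (S.sameVertex_rot e).symm
    rw [← posSmooth_opp hM] at hq
    rcases h.symm_edge.posSmooth_ends_next hS hq with h' | h' | h' | h'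
    · exact Or.inl h'
    · exact Or.inr (Or.inl ⟨hat, h'⟩)
    · exact Or.inr (Or.inr (Or.inl ⟨hat, h'⟩))
    · exact Or.inr (Or.inr (Or.inr ⟨by rw [S.prev_next]; exact Or.inr .rfl, by simpa using h'⟩))
  obtain ⟨h3, h4, hx⟩ := (h.posSmooth_hasEnd h1 h2 hS).1 ⟨_, hq⟩
  have hat : ¬ S.AtEdge e x := fun h' => (h.eq_of_hasEnd hx h').elim h3 h4
  obtain ⟨r, s, e1, e2, hj⟩ := posSmooth_of_joined hq
  simp [posPort, h1, h2, h3, h4] at e1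
  subst e1
  -- the strand goes to the opposite side, or to the corner next to it
  have hsd : s.dart = S.next x := by
    rcases h.ends _ _ hj with ⟨i, rfl⟩ | ⟨h', rfl⟩ | ⟨h', -⟩ | ⟨h', -⟩
    · rfl
    · rfl
    · exact absurd h' hat
    · exact absurd h' hat
  have hnx : ∀ y, S.SameVertex (S.next x) y → s = .vertex (S.next x) → S.AtEdge e y →
      S.next x = e ∨ S.next x = S.opp e := by
    intro y hy hs hat'
    exact h.eq_of_hasEnd ⟨_, hM.symm _ _ (hs ▸ hj)⟩ (hat'.of_sameVertex hy)
  cases q with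
  | point y i =>
    have : y = S.next x := by
      rw [← hsd]; exact (posPort_dart_point e2).symm
    exact Or.inl ⟨i, by rw [this]⟩
  | vertex y =>
    by_cases hy1 : y = S.next e ∧ ¬ X.HasEnd (S.opp e)
    · obtain ⟨rfl, hb⟩ := hy1
      rw [posPort_next hS hb] at e2
      obtain rfl := Option.some.inj e2
      have hxe : S.next x = e := by
        rw [← hsd]
        rcases posSeq_eq (X := X) e (X.posLast e) with h' | ⟨k, h'⟩ <;> rw [h'] <;> rfl
      have hpx : S.prev x = S.next e := by rw [← hxe]; rfl
      refine Or.inr (Or.inr (Or.inr ⟨?_, by rw [hpx]⟩))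
      rw [hpx]; exact Or.inr (S.sameVertex_next e).symm
    by_cases hy2 : y = S.next (S.opp e) ∧ ¬ X.HasEnd e
    · obtain ⟨rfl, ha⟩ := hy2
      rw [← posPort_opp, posPort_next hS (by rwa [S.opp_opp])] at e2
      obtain rfl := Option.some.inj e2
      have hxe : S.next x = S.opp e := by
        rw [← hsd]
        rcases posSeq_eq (X := X) (S.opp e) (X.posLast (S.opp e)) with h' | ⟨k, h'⟩ <;> rw [h'] <;> rfl
      have hpx : S.prev x = S.next (S.opp e) := by rw [← hxe]; rfl
      refine Or.inr (Or.inr (Or.inr ⟨?_, by rw [hpx]⟩))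
      rw [hpx]; exact Or.inl (S.sameVertex_rot e).symm
    · -- an end next to the edge is not there any more
      exfalso
      have hs : s = .vertex y ∧ ¬ ((y = e ∨ y = S.opp e) ∧ X.HasEnd y) := by
        simp only [posPort, hy1, hy2, if_false] at e2
        split_ifs at e2 with h5
        exact ⟨(Option.some.inj e2).symm, h5⟩
      obtain ⟨rfl, hn⟩ := hs
      have hye : X.HasEnd y := ⟨_, hM.symm _ _ hj⟩
      rcases h.ends _ _ hj with ⟨i, hi⟩ | ⟨h', -⟩ | ⟨h', -⟩ | ⟨h', -⟩
      · simp at hi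
      · obtain rfl : y = S.next x := hsd
        exact hn ⟨h.eq_of_hasEnd hye h', hye⟩
      · exact hat h'
      · exact hat h'

/-- The positive smoothing can be pulled tight by unwinding its ends. -/
theorem posSmooth_unwinding [Finite D] (hS : S.Simple) (h : Wound S e X) :
    Unwinding S e (X.posSmooth S e) := by
  refine ⟨h.posSmooth_isMulticurve hS, h.posSmooth_noSideTurn, h.posSmooth_no_loop hS,
    fun x q hq => h.posSmooth_ends hS hq, h.posSmooth_clearRun hS, ?_⟩
  have := h.symm_edge.posSmooth_clearRun hS
  rwa [posSmooth_opp h.multicurve] at this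

lemma posSmooth_endsOnlyIn (hS : S.Simple) (h : Wound S e X)
    (hk : 0 < X.crossings e e (S.opp e)) : (X.posSmooth S e).EndsOnlyIn S e (S.rot e) := by
  refine ⟨fun f hf => ?_, fun x hx hxe => ((h.posSmooth_hasEnd_at hS hx).1 hxe).1⟩
  rw [posSmooth_comps, if_neg (by omega)]
  exact h.endsOnlyIn.1 f hf

lemma posSmooth_endsAt (hS : S.Simple) (h : Wound S e X) :
    (X.posSmooth S e).EndsAt S e ↔ ¬ X.EndsAt S e := by
  have hX : X.EndsAt S e ↔ X.HasEnd e := by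
    constructor
    · rintro ⟨x, hx, h' | h'⟩
      · rwa [← h.endsOnlyIn.2 x hx h']
      · exact absurd h' (h.endsOnlyIn.1 x hx)
    · exact fun h' => ⟨e, .rfl, Or.inl h'⟩
  rw [hX]
  by_cases hk : X.crossings e e (S.opp e) = 0
  · have a : ¬ X.HasEnd e := by
      intro a; simp [crossings, a] at hk
    refine iff_of_true ⟨e, .rfl, Or.inr ?_⟩ a
    rw [posSmooth_comps, if_pos hk]; simp
  · constructor
    · rintro ⟨x, hx, h' | h'⟩
      · exact ((h.posSmooth_hasEnd_at hS hx).1 h').2.1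
      · exact absurd h' ((h.posSmooth_endsOnlyIn hS (by omega)).1 x hx)
    · exact fun a => ⟨S.rot e, (S.sameVertex_rot e).symm,
        Or.inl ((h.posSmooth_hasEnd_at hS (S.sameVertex_rot e).symm).2 ⟨rfl, a, by omega⟩)⟩

end Wound
end Diagram

namespace Diagram

variable {D : Type*} {S : TriSurface D} {X : Diagram D} {e : D}

/-! ### The negative smoothing undoes the positive one -/

open Classical in
/-- The former names of the ports after a negative smoothing. -/
def negPort (X : Diagram D) (S : TriSurface D) (e : D) : Port D → Option (Port D)
  | .point x i =>
      if x = e ∨ x = S.opp e then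
        some (X.negSeq S x (if X.HasEnd (S.rot x) then i else i + 1))
      else some (.point x i)
  | .vertex x =>
      if (x = S.next e ∨ x = S.next (S.opp e)) ∧ X.HasEnd x then none
      else if (x = e ∨ x = S.opp e) ∧ ¬ X.HasEnd (S.rot x) then some (X.negSeq S x 0)
      else some (.vertex x)

open Classical in
/-- The number of crossing points after a negative smoothing. -/
def negCnt (X : Diagram D) (S : TriSurface D) (e : D) : D → ℕ :=
  fun x => if x = e ∨ x = S.opp e then
    X.crossings e (S.rot e) (S.rot (S.opp e)) - 1 else X.cnt x

lemma negSmooth_joined (X : Diagram D) (e : D) :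
    (X.negSmooth S e).joined = X.renamed (X.negCnt S e) (X.negPort S e) := rfl

lemma negSmooth_cnt (X : Diagram D) (e : D) : (X.negSmooth S e).cnt = X.negCnt S e := rfl

open Classical in
lemma negSmooth_comps (X : Diagram D) (e : D) : (X.negSmooth S e).comps =
    if X.crossings e (S.rot e) (S.rot (S.opp e)) = 0 then X.comps ∪ {e, S.opp e} else X.comps := rfl

namespace Wound

open Classical in
/-- The smoothing renames the ports at `e` by `posSeq`, and the negative smoothing reads off this
sequence again, shifted by one step if an end has appeared in the meantime.  Without any crossing
this fails, since then the edge itself has become a component. -/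
lemma negSmooth_posSmooth (hS : S.Simple) (h : Wound S e X)
    (hk : 0 < X.crossings e e (S.opp e)) : (X.posSmooth S e).negSmooth S e = X := by
  have hM := h.multicurve
  have hco := hM.cnt_opp e
  have oo := S.opp_opp e
  set Y := X.posSmooth S e with hY
  have r1 : Y.HasEnd (S.next (S.opp e)) ↔ ¬ X.HasEnd e := by
    have := h.posSmooth_hasEnd_at hS (S.sameVertex_rot e).symm
    rw [S.rot_eq] at this
    rw [this]; tauto
  have r2 : Y.HasEnd (S.next e) ↔ ¬ X.HasEnd (S.opp e) := by
    rw [h.posSmooth_hasEnd_next hS]; tauto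
  have hYcnt : ∀ x, Y.cnt x = if x = e ∨ x = S.opp e then X.crossings e e (S.opp e) - 1
      else X.cnt x := fun x => rfl
  have hcross : Y.crossings e (S.rot e) (S.rot (S.opp e)) = X.cnt e + 1 := by
    simp only [crossings, S.rot_eq, oo, r1, r2, hYcnt, true_or, if_true]
    simp only [crossings] at hk
    by_cases a : X.HasEnd e <;> by_cases b : X.HasEnd (S.opp e) <;>
      simp only [a, b, if_true, if_false, not_true, not_false_iff] at * <;> omega
  have hcnt : Y.negCnt S e = X.cnt := by
    funext x
    simp only [negCnt, hcross, hYcnt]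
    grind
  have n1 := S.opp_ne e; have n2 := hS.opp_ne_next e; have n3 := S.next_ne e
  have n4 := S.next_ne (S.opp e); have n5 := hS.opp_ne_next (S.opp e); rw [oo] at n5
  have n6 : S.next (S.opp e) ≠ S.next e := fun h => n1 (S.next_inj.1 h)
  have m1 := h.not_hasEnd_next hS
  have m2 := h.not_hasEnd_rot hS
  have y1 : Y.cnt e = X.crossings e e (S.opp e) - 1 := by simp [hYcnt]
  have y2 : Y.cnt (S.opp e) = X.crossings e e (S.opp e) - 1 := by simp [hYcnt]
  -- the sequence of ports at `d` is read off from the smoothed multicurve by `negSeq`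
  have hseq : ∀ d, (d = e ∨ d = S.opp e) → ∀ j, j < X.cnt d + (if X.HasEnd d then 1 else 0) →
      (Y.negSeq S d j).Valid (X.posCnt S e) ∧
        X.posPort S e (Y.negSeq S d j) = some (X.posSeq d j) := by
    intro d hd j hj
    have hcd : Y.cnt d = X.crossings e e (S.opp e) - 1 := by rcases hd with rfl | rfl <;> assumption
    simp only [negSeq, hcd]
    by_cases h1 : j < X.crossings e e (S.opp e) - 1
    · rw [if_pos h1]
      exact ⟨by simpa [Port.Valid, posCnt, hd] using h1, by simp [posPort, hd]⟩
    · have hlast : j = X.crossings e e (S.opp e) - 1 ∧ j = X.posLast d ∧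
          ((d = e → ¬ X.HasEnd (S.opp e)) ∧ (d = S.opp e → ¬ X.HasEnd e)) := by
        simp only [crossings, posLast] at *
        clear_value Y
        clear hcnt hcross hYcnt r1 r2 hY
        rcases hd with rfl | rfl
        · by_cases a : X.HasEnd d <;> by_cases b : X.HasEnd (S.opp d) <;>
            simp only [a, b, if_true, if_false] at * <;> grind
        · by_cases a : X.HasEnd e <;> by_cases b : X.HasEnd (S.opp e) <;>
            simp only [a, b, if_true, if_false] at * <;> grind
      obtain ⟨e1, e2, e3⟩ := hlast
      rw [if_neg h1, if_pos e1, e2]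
      refine ⟨trivial, ?_⟩
      rcases hd with rfl | rfl
      · exact posPort_next hS (e3.1 rfl)
      · rw [← posPort_opp]
        exact posPort_next hS (by rw [oo]; exact e3.2 rfl)
  have hrot : ∀ d, (d = e ∨ d = S.opp e) → (Y.HasEnd (S.rot d) ↔ ¬ X.HasEnd d) := by
    rintro d (rfl | rfl)
    · exact r1
    · rw [S.rot_eq, oo]; exact r2
  have hforth : ∀ p : Port D, p.Valid X.cnt → (∀ x, p = .vertex x → X.HasEnd x) →
      ∃ r, Y.negPort S e p = some r ∧ r.Valid (X.posCnt S e) ∧ X.posPort S e r = some p := by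
    intro p hp hv
    cases p with
    | point x i =>
      by_cases hx : x = e ∨ x = S.opp e
      · simp only [Port.Valid] at hp
        by_cases a : X.HasEnd x
        · obtain ⟨s1, s2⟩ := hseq x hx (i + 1) (by simp only [a, if_true]; omega)
          exact ⟨_, by simp [negPort, hx, hrot x hx, a], s1, by simpa [posSeq, a] using s2⟩
        · obtain ⟨s1, s2⟩ := hseq x hx i (by simp only [a, if_false]; omega)
          exact ⟨_, by simp [negPort, hx, hrot x hx, a], s1, by simpa [posSeq, a] using s2⟩
      · refine ⟨.point x i, by simp [negPort, hx], by simpa [Port.Valid, posCnt, hx] using hp,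
          by simp [posPort, hx]⟩
    | vertex x =>
      have hx := hv x rfl
      have e1 : x ≠ S.next e := by rintro rfl; exact m1 hx
      have e2 : x ≠ S.next (S.opp e) := by rintro rfl; exact m2 hx
      by_cases h1 : x = e ∨ x = S.opp e
      · obtain ⟨s1, s2⟩ := hseq x h1 0 (by simp only [hx, if_true]; omega)
        exact ⟨_, by simp [negPort, h1, e1, e2, hrot x h1, hx], s1, by simpa [posSeq, hx] using s2⟩
      · exact ⟨.vertex x, by simp [negPort, h1, e1, e2], trivial, by simp [posPort, h1, e1, e2]⟩
  have hother : ∀ (p r : Port D) s, p.Valid X.cnt → Y.negPort S e p = some r →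
      X.posPort S e r = some s → (∀ x, s = .vertex x → X.HasEnd x) → s = p := by
    intro p r s hp h1 h2 hs
    by_cases hv : ∀ x, p = .vertex x → X.HasEnd x
    · obtain ⟨r', h3, -, h4⟩ := hforth p hp hv
      rw [h1] at h3
      obtain rfl := Option.some.inj h3
      rw [h2] at h4
      exact Option.some.inj h4
    · -- no strand ends at a vertex that is not in use
      push Not at hv
      obtain ⟨x, rfl, hx⟩ := hv
      have h3 : r = .vertex x ∧ ¬ ((x = S.next e ∨ x = S.next (S.opp e)) ∧ Y.HasEnd x) := by
        simp only [negPort] at h1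
        split_ifs at h1 with g1 g2
        · exact absurd (not_not.1 fun h' => g2.2 ((hrot x g2.1).2 h')) hx
        · exact ⟨(Option.some.inj h1).symm, g1⟩
      obtain ⟨rfl, h3⟩ := h3
      simp only [posPort] at h2
      split_ifs at h2 with g1 g2 g3
      · exact absurd ⟨Or.inl g2.1, g2.1 ▸ r2.2 g2.2⟩ h3
      · exact absurd ⟨Or.inr g3.1, g3.1 ▸ r1.2 g3.2⟩ h3
      · exact (Option.some.inj h2).symm
  refine Diagram.ext hcnt ?_ ?_
  · funext p q
    rw [negSmooth_joined, hcnt, eq_iff_iff]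
    constructor
    · rintro ⟨hp, hq, p₁, q₁, h1, h2, hj⟩
      obtain ⟨p₂, q₂, h3, h4, hj⟩ := posSmooth_of_joined hj
      rw [← hother p p₁ p₂ hp h1 h3 (by rintro x rfl; exact ⟨_, hj⟩),
        ← hother q q₁ q₂ hq h2 h4 (by rintro x rfl; exact ⟨_, hM.symm _ _ hj⟩)]
      exact hj
    · intro hj
      have hj' := hM.symm _ _ hj
      obtain ⟨p₁, h1, v1, h3⟩ := hforth p (hM.valid _ _ hj) (by rintro x rfl; exact ⟨_, hj⟩)
      obtain ⟨q₁, h2, v2, h4⟩ := hforth q (hM.valid _ _ hj') (by rintro x rfl; exact ⟨_, hj'⟩)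
      exact ⟨hM.valid _ _ hj, hM.valid _ _ hj', p₁, q₁, h1, h2, v1, v2, p, q, h3, h4, hj⟩
  · rw [negSmooth_comps, hcross, if_neg (by omega), hY, posSmooth_comps, if_neg (by omega)]

end Wound
end Diagram

/-! ### Reversing the orientation -/

namespace TriSurface

variable {D : Type*}

/-- The same triangulated surface with the opposite orientation.  A dart keeps its triangle and its
side, but the side is directed the other way. -/
def mirror (S : TriSurface D) : TriSurface D where
  next := S.next⁻¹
  opp := S.opp
  next_next_next d := by
    rw [Equiv.Perm.inv_eq_iff_eq, Equiv.Perm.inv_eq_iff_eq, Equiv.Perm.inv_eq_iff_eq,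
      S.next_next_next]
  next_ne d h := S.next_ne d (Equiv.Perm.inv_eq_iff_eq.1 h).symm
  opp_opp := S.opp_opp
  opp_ne := S.opp_ne
  connected d d' := by
    obtain ⟨g, hg, h⟩ := S.connected d d'
    refine ⟨g, ?_, h⟩
    refine (Subgroup.closure_le _).2 ?_ hg
    rintro x (rfl | rfl)
    · have : (S.next⁻¹)⁻¹ ∈ Subgroup.closure {S.next⁻¹, S.opp} :=
        inv_mem (Subgroup.subset_closure (by simp))
      rwa [inv_inv] at this
    · exact Subgroup.subset_closure (by simp)

variable (S : TriSurface D)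

@[simp] lemma mirror_next (d : D) : S.mirror.next d = S.prev d :=
  Equiv.Perm.inv_eq_iff_eq.2 (S.next_prev d).symm
@[simp] lemma mirror_opp : S.mirror.opp = S.opp := rfl
@[simp] lemma mirror_prev (d : D) : S.mirror.prev d = S.next d := by
  change S.mirror.next (S.mirror.next d) = _; simp
lemma mirror_rot (d : D) : S.mirror.rot d = S.prev (S.opp d) :=
  S.mirror_next _

lemma mirror_mirror : S.mirror.mirror = S := by
  cases S
  simp [mirror]

lemma sameVertex_mirror (d d' : D) :
    S.mirror.SameVertex d d' ↔ S.SameVertex (S.next d) (S.next d') := by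
  have : S.mirror.rot = S.next⁻¹ * S.rot⁻¹ * S.next⁻¹⁻¹ := by
    ext d
    rw [mirror_rot]
    have : S.rot⁻¹ (S.next d) = S.opp d := by
      rw [Equiv.Perm.inv_eq_iff_eq, S.rot_opp]
    simp only [inv_inv, Equiv.Perm.mul_apply, this]
    rw [eq_comm, Equiv.Perm.inv_eq_iff_eq, S.next_prev]
  unfold SameVertex
  rw [this, Equiv.Perm.sameCycle_conj, inv_inv, Equiv.Perm.sameCycle_inv]

lemma sameVertex_mirror_opp (d d' : D) :
    S.mirror.SameVertex (S.opp d) (S.opp d') ↔ S.SameVertex d d' := by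
  rw [sameVertex_mirror]
  have h := S.sameVertex_rot d
  have h' := S.sameVertex_rot d'
  exact ⟨fun k => h.trans (k.trans h'.symm), fun k => h.symm.trans (k.trans h')⟩

variable {S}

lemma Simple.mirror (hS : S.Simple) : S.mirror.Simple where
  no_one_cycle d h := by
    rw [sameVertex_mirror, mirror_next, S.next_prev] at h
    exact hS.no_one_cycle d h.symm
  no_two_cycle d d' h h' := by
    rw [sameVertex_mirror] at h h'
    simp only [mirror_next, S.next_prev] at h'
    exact hS.no_two_cycle d d' h' h

lemma inTri_mirror (b x : D) : S.mirror.InTri b x ↔ S.InTri b x := by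
  simp only [InTri, mirror_next, mirror_prev]; tauto

end TriSurface

namespace Diagram

variable {D : Type*} {S : TriSurface D} {X Y : Diagram D}

/-- The name of a port after the orientation has been reversed. -/
def mirrorPort (S : TriSurface D) (cnt : D → ℕ) : Port D → Port D
  | .point x i => .point x (cnt x - 1 - i)
  | .vertex x => .vertex (S.next x)

/-- The same multicurve, with respect to the opposite orientation. -/
def mirror (S : TriSurface D) (X : Diagram D) : Diagram D where
  cnt := X.cnt
  joined p q := p.Valid X.cnt ∧ q.Valid X.cnt ∧
    X.joined (mirrorPort S X.cnt p) (mirrorPort S X.cnt q)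
  comps := X.comps

lemma mirrorPort_valid {cnt : D → ℕ} {p : Port D} (hp : p.Valid cnt) :
    (mirrorPort S cnt p).Valid cnt := by
  cases p <;> simp only [mirrorPort, Port.Valid] at * ; omega

lemma mirrorPort_mirrorPort {cnt : D → ℕ} {p : Port D} (hp : p.Valid cnt) :
    mirrorPort S cnt (mirrorPort S.mirror cnt p) = p := by
  cases p <;> simp only [mirrorPort, Port.Valid, TriSurface.mirror_next, S.next_prev] at *
  congr 1; omega

lemma mirrorPort_mirrorPort' {cnt : D → ℕ} {p : Port D} (hp : p.Valid cnt) :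
    mirrorPort S.mirror cnt (mirrorPort S cnt p) = p := by
  have := mirrorPort_mirrorPort (S := S.mirror) hp
  rwa [S.mirror_mirror] at this

/-- The conditions under which reversing the orientation twice gives back the diagram, and the moves
below correspond to their mirror images.  The diagrams in the middle of a sequence of moves satisfy
them without being known to be multicurves. -/
structure Proper (S : TriSurface D) (X : Diagram D) : Prop where
  cnt_opp : ∀ d, X.cnt (S.opp d) = X.cnt d
  symm : ∀ p q, X.joined p q → X.joined q p
  valid : ∀ p q, X.joined p q → p.Valid X.cnt
  comps_opp : ∀ d, d ∈ X.comps → S.opp d ∈ X.comps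

lemma IsMulticurve.proper (h : X.IsMulticurve S) : Proper S X :=
  ⟨h.cnt_opp, h.symm, h.valid, h.comps_opp⟩

lemma Proper.mirror (h : Proper S X) : Proper S.mirror (X.mirror S) :=
  ⟨h.cnt_opp, fun _ _ hpq => ⟨hpq.2.1, hpq.1, h.symm _ _ hpq.2.2⟩, fun _ _ hpq => hpq.1,
    h.comps_opp⟩

lemma Proper.mirror_mirror (h : Proper S X) : (X.mirror S).mirror S.mirror = X := by
  refine Diagram.ext rfl ?_ rfl
  funext p q
  rw [eq_iff_iff]
  constructor
  · rintro ⟨hp, hq, -, -, hj⟩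
    change X.joined (mirrorPort S X.cnt (mirrorPort S.mirror X.cnt p))
      (mirrorPort S X.cnt (mirrorPort S.mirror X.cnt q)) at hj
    rwa [mirrorPort_mirrorPort (cnt := X.cnt) hp, mirrorPort_mirrorPort (cnt := X.cnt) hq] at hj
  · intro hj
    have hp := h.valid _ _ hj
    have hq := h.valid _ _ (h.symm _ _ hj)
    refine ⟨hp, hq, mirrorPort_valid hp, mirrorPort_valid hq, ?_⟩
    change X.joined (mirrorPort S X.cnt (mirrorPort S.mirror X.cnt p))
      (mirrorPort S X.cnt (mirrorPort S.mirror X.cnt q))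
    rwa [mirrorPort_mirrorPort hp, mirrorPort_mirrorPort hq]

/-- A strand, seen with the opposite orientation. -/
lemma Proper.mirror_joined (h : Proper S X) {p q : Port D} (hj : X.joined p q) :
    (X.mirror S).joined (mirrorPort S.mirror X.cnt p) (mirrorPort S.mirror X.cnt q) := by
  have hp := h.valid _ _ hj
  have hq := h.valid _ _ (h.symm _ _ hj)
  refine ⟨mirrorPort_valid hp, mirrorPort_valid hq, ?_⟩
  rwa [mirrorPort_mirrorPort hp, mirrorPort_mirrorPort hq]

lemma Proper.mirror_hasEnd (h : Proper S X) (c : D) :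
    (X.mirror S).HasEnd c ↔ X.HasEnd (S.next c) := by
  constructor
  · rintro ⟨q, -, -, hj⟩
    exact ⟨_, hj⟩
  · rintro ⟨q, hj⟩
    have := h.mirror_joined hj
    simp only [mirrorPort, TriSurface.mirror_next, S.prev_next] at this
    exact ⟨_, this⟩

lemma before_mirror {cnt : D → ℕ} {b : D} {p q : Port D} (hp : p.Valid cnt) (hq : q.Valid cnt)
    (hpb : p ≠ .vertex b) (h : Before S.mirror b p q) :
    Before S (S.next b) (mirrorPort S cnt q) (mirrorPort S cnt p) := by
  have n1 := S.next_ne b; have n2 := S.prev_ne b; have n3 := S.next_ne_prev b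
  have e1 := S.prev_next b; have e2 := S.next_prev b
  have e3 : S.next (S.next b) = S.prev b := rfl
  cases p <;> cases q <;> simp only [Before, mirrorPort, TriSurface.mirror_next,
    TriSurface.mirror_prev, Port.Valid, Port.dart_point, Port.dart_vertex, Port.rank_point,
    Port.rank_vertex] at hp hq hpb h ⊢ <;> grind

lemma before_mirror_vertex {cnt : D → ℕ} {b : D} {q : Port D} (hq : S.InTri b q.dart)
    (hqb : q ≠ .vertex b) : Before S (S.next b) (.vertex (S.next b)) (mirrorPort S cnt q) := by
  have n1 := S.next_ne b; have n2 := S.prev_ne b; have n3 := S.next_ne_prev b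
  have e1 := S.prev_next b; have e2 := S.next_prev b
  have e3 : S.next (S.next b) = S.prev b := rfl
  cases q <;> simp only [Before, mirrorPort, TriSurface.InTri, Port.dart_point, Port.dart_vertex,
    Port.rank_point, Port.rank_vertex] at hq hqb ⊢ <;> grind

lemma IsMulticurve.mirror (h : X.IsMulticurve S) : (X.mirror S).IsMulticurve S.mirror := by
  have hP := h.proper
  have hend := hP.mirror_hasEnd
  refine .of_planar ⟨hP.mirror.symm, ?_, ?_, ?_, ?_⟩ h.cnt_opp (fun p q hpq => hpq.1) ?_
    h.comps_opp h.comps_cnt ?_ ?_ ?_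
  · rintro p q ⟨hp, hq, hj⟩ rfl
    exact h.ne _ _ hj rfl
  · rintro p q ⟨hp, hq, hj⟩
    rw [TriSurface.inTri_mirror]
    have := h.planar.inTri _ _ hj
    have key : ∀ r : Port D, S.InTri r.dart (mirrorPort S X.cnt r).dart := by
      intro r; cases r
      · exact .rfl
      · exact S.inTri_next _
    exact (key p).trans (this.trans (key q).symm)
  · rintro p q q' ⟨hp, hq, hj⟩ ⟨-, hq', hj'⟩
    rw [← mirrorPort_mirrorPort' (S := S) hq, h.unique hj hj', mirrorPort_mirrorPort' hq']
  · rintro b p q r s ⟨hp, hq, hpq⟩ ⟨hr, hs, hrs⟩ ⟨h1, h2, h3⟩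
    have first : ∀ {x y : Port D}, Before S.mirror b x y → y ≠ .vertex b := by
      rintro x y hxy rfl
      rw [before_iff, Port.dart_vertex, TriSurface.place_self] at hxy
      simp at hxy
    have a2 := before_mirror hr hq (first h1) h2
    have a3 := before_mirror hq hs (first h2) h3
    by_cases hpb : p = .vertex b
    · subst hpb
      refine h.noncrossing (S.next b) _ _ _ _ hpq (h.symm _ _ hrs) ⟨?_, a3, a2⟩
      exact before_mirror_vertex ((TriSurface.inTri_mirror _ _).1 h3.inTri_right) (first h3)
    · have a1 := before_mirror hp hr hpb h1
      exact h.noncrossing (S.next b) _ _ _ _ (h.symm _ _ hrs) (h.symm _ _ hpq) ⟨a3, a2, a1⟩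
  · intro d i hi
    have hi' : i < X.cnt d := hi
    obtain ⟨q, hq⟩ := h.full (d := d) (i := X.cnt d - 1 - i) (by omega)
    have := hP.mirror_joined hq
    rw [show mirrorPort S.mirror X.cnt (.point d (X.cnt d - 1 - i)) = .point d i by
      simp only [mirrorPort]; congr 1; omega] at this
    exact ⟨_, this⟩
  · intro c c' hcc hc hc'
    rw [hend] at hc hc'
    rw [TriSurface.sameVertex_mirror] at hcc
    exact S.next_inj.1 (h.ends hcc hc hc')
  · intro c f hcf hc hf
    rw [hend] at hc
    rw [TriSurface.sameVertex_mirror] at hcf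
    exact h.end_comp (hcf.trans (S.sameVertex_next f).symm) hc (h.comps_opp _ hf)
  · intro f f' hff hf hf'
    rw [TriSurface.sameVertex_mirror] at hff
    refine S.opp_inj.1 (h.comp_unique _ _ ?_ (h.comps_opp _ hf) (h.comps_opp _ hf'))
    exact (S.sameVertex_next f).trans (hff.trans (S.sameVertex_next f').symm)

lemma HasPunctureLoop.of_mirror (h : X.IsMulticurve S) {u : D}
    (hu : (X.mirror S).HasPunctureLoop S.mirror (S.opp u)) : X.HasPunctureLoop S u := by
  obtain ⟨i, hi⟩ := hu
  refine ⟨fun c => i (S.opp c), fun c hc => ?_⟩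
  have hc1 := (hi (S.opp c) ((S.sameVertex_mirror_opp _ _).2 hc)).1
  have hc2 : (X.mirror S).cnt (S.opp c) = X.cnt c := h.cnt_opp c
  have hr := hi (S.opp (S.rot c))
    ((S.sameVertex_mirror_opp _ _).2 ((S.sameVertex_rot c).symm.trans hc))
  rw [hc2] at hc1
  refine ⟨hc1, ?_⟩
  obtain ⟨h1, -, -, hj⟩ := hr
  have hr2 : (X.mirror S).cnt (S.opp (S.rot c)) = X.cnt (S.rot c) := h.cnt_opp _
  rw [hr2] at h1 hj
  simp only [mirrorPort, TriSurface.mirror_rot, TriSurface.mirror_opp, S.opp_opp, S.prev_rot,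
    h.cnt_opp] at hj
  rw [show X.cnt (S.rot c) - 1 - (X.cnt (S.rot c) - 1 - i (S.opp (S.rot c))) =
    i (S.opp (S.rot c)) by omega] at hj
  exact h.symm _ _ hj

lemma IsReduced.mirror (h : X.IsReduced S) : (X.mirror S).IsReduced S.mirror where
  multicurve := h.multicurve.mirror
  noTurnBacks := by
    refine ⟨fun d i j hj => h.noTurnBacks.side _ _ _ hj.2.2, ?_⟩
    rintro c q ⟨-, hq, hj⟩
    obtain ⟨i, hi⟩ := h.noTurnBacks.vertex _ _ hj
    rw [← mirrorPort_mirrorPort' (S := S) hq, hi]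
    exact ⟨X.cnt (S.prev c) - 1 - i, by
      simp only [mirrorPort, TriSurface.mirror_next, S.next_next]⟩
  no_puncture_loop u hu := by
    rw [← S.opp_opp u] at hu
    exact h.no_puncture_loop _ (hu.of_mirror h.multicurve)

lemma endsAt_mirror (h : X.IsMulticurve S) (d : D) :
    (X.mirror S).EndsAt S.mirror (S.opp d) ↔ X.EndsAt S d := by
  have hend := h.proper.mirror_hasEnd
  constructor
  · rintro ⟨c, hc, h'⟩
    rw [← S.opp_opp c, S.sameVertex_mirror_opp] at hc
    rcases h' with h' | h'
    · rw [hend] at h'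
      exact ⟨_, (S.sameVertex_next c).symm.trans hc, Or.inl h'⟩
    · exact ⟨_, hc, Or.inr (h.comps_opp _ h')⟩
  · rintro ⟨c, hc, h' | h'⟩
    · refine ⟨S.prev c, ?_, Or.inl ((hend _).2 (by rwa [S.next_prev]))⟩
      rw [← S.opp_opp (S.prev c), S.sameVertex_mirror_opp]
      exact (S.sameVertex_opp_prev c).trans hc
    · exact ⟨S.opp c, (S.sameVertex_mirror_opp _ _).2 hc, Or.inr (h.comps_opp _ h')⟩

/-! ### The moves with the opposite orientation -/

/-- A renaming of ports, seen with the opposite orientation. -/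
lemma mirror_renamed (hX : Proper S X) {cnt' : D → ℕ} {old old' : Port D → Option (Port D)}
    (h : ∀ p r : Port D, p.Valid cnt' → r.Valid X.cnt →
      (∀ x, r = .vertex x → X.HasEnd (S.next x)) →
      (old (mirrorPort S cnt' p) = some (mirrorPort S X.cnt r) ↔ old' p = some r)) (p q : Port D) :
    (p.Valid cnt' ∧ q.Valid cnt' ∧
      X.renamed cnt' old (mirrorPort S cnt' p) (mirrorPort S cnt' q)) ↔
      (X.mirror S).renamed cnt' old' p q := by
  constructor
  · rintro ⟨hp, hq, -, -, r, s, h1, h2, hj⟩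
    have hr := hX.valid _ _ hj
    have hs := hX.valid _ _ (hX.symm _ _ hj)
    rw [← mirrorPort_mirrorPort (S := S) hr, h _ _ hp (mirrorPort_valid hr)] at h1
    · rw [← mirrorPort_mirrorPort (S := S) hs, h _ _ hq (mirrorPort_valid hs)] at h2
      · exact ⟨hp, hq, _, _, h1, h2, hX.mirror_joined hj⟩
      · intro x hx
        cases s <;> simp only [mirrorPort, reduceCtorEq, Port.vertex.injEq] at hx
        rw [← hx, TriSurface.mirror_next, S.next_prev]
        exact ⟨_, hX.symm _ _ hj⟩
    · intro x hx
      cases r <;> simp only [mirrorPort, reduceCtorEq, Port.vertex.injEq] at hx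
      rw [← hx, TriSurface.mirror_next, S.next_prev]
      exact ⟨_, hj⟩
  · rintro ⟨hp, hq, r, s, h1, h2, hr, hs, hj⟩
    refine ⟨hp, hq, mirrorPort_valid hp, mirrorPort_valid hq, _, _, (h _ _ hp hr ?_).2 h1,
      (h _ _ hq hs ?_).2 h2, hj⟩
    · rintro x rfl; exact ⟨_, hj⟩
    · rintro x rfl; exact ⟨_, hX.symm _ _ hj⟩

/-- A renaming that gives every port a former name, seen with the opposite orientation. -/
lemma mirror_port {cnt' : D → ℕ} {J J' : Port D → Port D → Prop} {f f' : Port D → Port D}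
    (hJ : ∀ p q, J p q ↔ p.Valid cnt' ∧ q.Valid cnt' ∧ X.joined (f p) (f q))
    (hJ' : ∀ p q, J' p q ↔ p.Valid cnt' ∧ q.Valid cnt' ∧ (X.mirror S).joined (f' p) (f' q))
    (h : ∀ p : Port D, p.Valid cnt' → f (mirrorPort S cnt' p) = mirrorPort S X.cnt (f' p) ∧
      (f' p).Valid X.cnt) (p q : Port D) :
    (p.Valid cnt' ∧ q.Valid cnt' ∧ J (mirrorPort S cnt' p) (mirrorPort S cnt' q)) ↔ J' p q := by
  rw [hJ, hJ']
  constructor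
  · rintro ⟨hp, hq, -, -, hj⟩
    rw [(h p hp).1, (h q hq).1] at hj
    exact ⟨hp, hq, (h p hp).2, (h q hq).2, hj⟩
  · rintro ⟨hp, hq, -, -, hj⟩
    refine ⟨hp, hq, mirrorPort_valid hp, mirrorPort_valid hq, ?_⟩
    rwa [(h p hp).1, (h q hq).1]

lemma windCW_mirror (h : Proper S X) (c : D) :
    (X.windCW S c).mirror S = (X.mirror S).windCCW S.mirror (S.opp c) := by
  have hco := h.cnt_opp c
  have n1 := S.opp_ne c
  have oo := S.opp_opp c
  have e1 := S.next_prev c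
  have e2 := S.prev_next c
  have e3 : S.next (S.opp c) = S.rot c := rfl
  have e4 := S.prev_rot c
  have hcnt : (X.mirror S).cntAdd S.mirror (S.opp c) = X.cntAdd S c := by
    funext x; simp only [cntAdd, TriSurface.mirror_opp, oo, mirror]; grind
  refine Diagram.ext hcnt.symm ?_ rfl
  funext p q
  have key := mirror_renamed h (cnt' := X.cntAdd S c) (old := windCWPort c)
    (old' := (X.mirror S).windCCWPort S.mirror (S.opp c)) ?_ p q
  · rw [windCCW_joined, hcnt, ← key, eq_iff_iff]
    change p.Valid (X.cntAdd S c) ∧ q.Valid (X.cntAdd S c) ∧ (X.renamed (X.cntAdd S c) (windCWPort c) (mirrorPort S (X.cntAdd S c) p)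
        (mirrorPort S (X.cntAdd S c) q) ∨
      IsPair (.vertex (S.rot c)) (.point (S.opp c) (X.cnt c)) (mirrorPort S (X.cntAdd S c) p)
        (mirrorPort S (X.cntAdd S c) q)) ↔ _ ∨ IsPair (.vertex (S.opp c)) (.point (S.opp c) 0) p q
    have hpair : p.Valid (X.cntAdd S c) → q.Valid (X.cntAdd S c) →
        (IsPair (.vertex (S.rot c)) (.point (S.opp c) (X.cnt c)) (mirrorPort S (X.cntAdd S c) p)
          (mirrorPort S (X.cntAdd S c) q) ↔ IsPair (.vertex (S.opp c)) (.point (S.opp c) 0) p q) := by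
      have hv : ∀ x, S.next x = S.rot c ↔ x = S.opp c := fun x => S.next_inj
      intro hp hq
      clear key h
      cases p <;> cases q <;> simp only [IsPair, mirrorPort, cntAdd, Port.Valid] at * <;> grind
    have hpv : IsPair (.vertex (S.opp c)) (.point (S.opp c) 0) p q →
        p.Valid (X.cntAdd S c) ∧ q.Valid (X.cntAdd S c) := by
      rintro (⟨rfl, rfl⟩ | ⟨rfl, rfl⟩) <;> simp [Port.Valid, cntAdd]
    constructor
    · rintro ⟨hp, hq, h' | h'⟩
      exacts [Or.inl ⟨hp, hq, h'⟩, Or.inr ((hpair hp hq).1 h')]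
    · rintro (⟨hp, hq, h'⟩ | h')
      · exact ⟨hp, hq, Or.inl h'⟩
      · obtain ⟨hp, hq⟩ := hpv h'
        exact ⟨hp, hq, Or.inr ((hpair hp hq).2 h')⟩
  · intro p r hp hr hrv
    have i1 : ∀ x y, S.next x = S.next y ↔ x = y := fun x y => S.next_inj
    have i2 : ∀ x, S.next x = c ↔ x = S.prev c := fun x => by rw [eq_comm, S.eq_next_iff]
    have hm : (X.mirror S).cnt (S.opp c) = X.cnt c := hco
    have mr : S.mirror.rot (S.opp c) = S.prev c := by rw [S.mirror_rot, oo]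
    clear h hcnt
    cases p <;> cases r <;> simp only [windCWPort, windCCWPort, mirrorPort, cntAdd, Port.Valid,
      TriSurface.mirror_opp, mr, oo, hm] at hp hr ⊢ <;> grind

lemma pushCW_mirror (X : Diagram D) (f : D) :
    (X.pushCW S f).mirror S = (X.mirror S).pushCCW S.mirror (S.opp f) := by
  refine Diagram.ext rfl ?_ ?_
  · funext p q
    have hpair : IsPair (.vertex (S.opp f)) (.vertex (S.rot f)) (mirrorPort S X.cnt p)
          (mirrorPort S X.cnt q) ↔
        IsPair (.vertex (S.opp f)) (.vertex (S.prev (S.opp f))) p q := by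
      have hv : ∀ x, S.next x = S.rot f ↔ x = S.opp f := fun x => S.next_inj
      have hv' : ∀ x, S.next x = S.opp f ↔ x = S.prev (S.opp f) := fun x => by
        rw [eq_comm, S.eq_next_iff]
      cases p <;> cases q <;> simp only [IsPair, mirrorPort] <;> grind
    have hpv : IsPair (.vertex (S.opp f)) (.vertex (S.prev (S.opp f))) p q →
        p.Valid X.cnt ∧ q.Valid X.cnt := by
      rintro (⟨rfl, rfl⟩ | ⟨rfl, rfl⟩) <;> simp [Port.Valid]
    simp only [mirror, pushCW, pushCCW, TriSurface.mirror_next, eq_iff_iff]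
    tauto
  · simp only [mirror, pushCW, pushCCW, TriSurface.mirror_opp, S.opp_opp, Set.pair_comm]

lemma pushToEdge_mirror (X : Diagram D) (d : D) :
    (X.pushToEdge S d).mirror S = (X.mirror S).pushToEdge S.mirror d := by
  refine Diagram.ext rfl ?_ rfl
  funext p q
  have hpair : IsPair (.vertex d) (.vertex (S.next d)) (mirrorPort S X.cnt p)
        (mirrorPort S X.cnt q) ↔ IsPair (.vertex d) (.vertex (S.prev d)) p q := by
    have hv : ∀ x, S.next x = S.next d ↔ x = d := fun x => S.next_inj
    have hv' : ∀ x, S.next x = d ↔ x = S.prev d := fun x => by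
      rw [eq_comm, S.eq_next_iff]
    cases p <;> cases q <;> simp only [IsPair, mirrorPort] <;> grind
  simp only [mirror, pushToEdge, TriSurface.mirror_next, eq_iff_iff]
  tauto

lemma slideCW_mirror (h : Proper S X) {d : D} (hd : 0 < X.cnt d) :
    (X.slideCW S d).mirror S = (X.mirror S).slideCCW S.mirror (S.opp d) := by
  have hco := h.cnt_opp d
  have n1 := S.opp_ne d
  have oo := S.opp_opp d
  have hcnt : (X.mirror S).cntSub S.mirror (S.opp d) = X.cntSub S d := by
    funext x; simp only [cntSub, TriSurface.mirror_opp, oo, mirror]; grind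
  refine Diagram.ext hcnt.symm ?_ rfl
  funext p q
  rw [eq_iff_iff]
  refine mirror_port (S := S) (X := X) (slideCW_joined X d)
    (fun p q => by rw [slideCCW_joined, hcnt]) ?_ p q
  intro p hp
  have hv : ∀ x, S.next x = S.rot d ↔ x = S.opp d := fun x => S.next_inj
  clear h
  cases p <;> simp only [slidePort, slideCCWPort, mirrorPort, cntSub, Port.Valid] at * <;>
    grind [Port.Valid, mirrorPort]

open Classical in
/-- The former names of the ports after `removeTurnBack`. -/
def turnBackPort (X : Diagram D) (S : TriSurface D) (d : D) (i : ℕ) : Port D → Port D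
  | .point x k =>
      if x = d then .point x (if k < i then k else k + 2)
      else if x = S.opp d then .point x (if k < X.cnt d - 2 - i then k else k + 2)
      else .point x k
  | .vertex x => .vertex x

lemma removeTurnBack_mirror (h : Proper S X) {d : D} {i : ℕ} (hi : i + 2 ≤ X.cnt d) :
    (X.removeTurnBack S d i).mirror S =
      (X.mirror S).removeTurnBack S.mirror d (X.cnt d - 2 - i) := by
  classical
  have hco := h.cnt_opp d
  have n1 := S.opp_ne d
  let cnt' : D → ℕ := fun x => if x = d ∨ x = S.opp d then X.cnt x - 2 else X.cnt x
  have hport : ∀ p : Port D, p.Valid cnt' →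
      X.turnBackPort S d i (mirrorPort S cnt' p) =
        mirrorPort S X.cnt (X.turnBackPort S d (X.cnt d - 2 - i) p) ∧
      (X.turnBackPort S d (X.cnt d - 2 - i) p).Valid X.cnt := by
    intro p hp
    clear h
    cases p <;> simp only [turnBackPort, mirrorPort, Port.Valid, cnt'] at * <;>
      grind [Port.Valid, mirrorPort]
  refine Diagram.ext rfl ?_ rfl
  funext p q
  have m1 : mirrorPort S X.cnt (.point (S.opp d) (X.cnt d - 2 - (X.cnt d - 2 - i))) =
      .point (S.opp d) (X.cnt d - 2 - i + 1) := by
    simp only [mirrorPort]; congr 1; omega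
  have m2 : mirrorPort S X.cnt (.point (S.opp d) (X.cnt d - 2 - (X.cnt d - 2 - i) + 1)) =
      .point (S.opp d) (X.cnt d - 2 - i) := by
    simp only [mirrorPort]; congr 1; omega
  have v1 : (Port.point (S.opp d) (X.cnt d - 2 - (X.cnt d - 2 - i))).Valid X.cnt := by
    simp only [Port.Valid]; omega
  have v2 : (Port.point (S.opp d) (X.cnt d - 2 - (X.cnt d - 2 - i) + 1)).Valid X.cnt := by
    simp only [Port.Valid]; omega
  have hL : ∀ p q, (X.removeTurnBack S d i).joined p q ↔ p.Valid cnt' ∧ q.Valid cnt' ∧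
      (X.joined (X.turnBackPort S d i p) (X.turnBackPort S d i q) ∨
        (X.joined (X.turnBackPort S d i p) (.point (S.opp d) (X.cnt d - 2 - i)) ∧
          X.joined (X.turnBackPort S d i q) (.point (S.opp d) (X.cnt d - 2 - i + 1))) ∨
        (X.joined (X.turnBackPort S d i q) (.point (S.opp d) (X.cnt d - 2 - i)) ∧
          X.joined (X.turnBackPort S d i p) (.point (S.opp d) (X.cnt d - 2 - i + 1)))) := by
    intro p q; cases p <;> cases q <;> rfl
  have hR : ∀ p q, ((X.mirror S).removeTurnBack S.mirror d (X.cnt d - 2 - i)).joined p q ↔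
      p.Valid cnt' ∧ q.Valid cnt' ∧
      ((X.mirror S).joined (X.turnBackPort S d (X.cnt d - 2 - i) p)
          (X.turnBackPort S d (X.cnt d - 2 - i) q) ∨
        ((X.mirror S).joined (X.turnBackPort S d (X.cnt d - 2 - i) p)
            (.point (S.opp d) (X.cnt d - 2 - (X.cnt d - 2 - i))) ∧
          (X.mirror S).joined (X.turnBackPort S d (X.cnt d - 2 - i) q)
            (.point (S.opp d) (X.cnt d - 2 - (X.cnt d - 2 - i) + 1))) ∨
        ((X.mirror S).joined (X.turnBackPort S d (X.cnt d - 2 - i) q)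
            (.point (S.opp d) (X.cnt d - 2 - (X.cnt d - 2 - i))) ∧
          (X.mirror S).joined (X.turnBackPort S d (X.cnt d - 2 - i) p)
            (.point (S.opp d) (X.cnt d - 2 - (X.cnt d - 2 - i) + 1)))) := by
    intro p q; cases p <;> cases q <;> rfl
  rw [hR, eq_iff_iff]
  change (p.Valid cnt' ∧ q.Valid cnt' ∧ (X.removeTurnBack S d i).joined (mirrorPort S cnt' p)
    (mirrorPort S cnt' q)) ↔ _
  rw [hL]
  refine and_congr_right fun hp => and_congr_right fun hq => ?_
  obtain ⟨p1, p2⟩ := hport p hp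
  obtain ⟨q1, q2⟩ := hport q hq
  have w1 := mirrorPort_valid (S := S) hp
  have w2 := mirrorPort_valid (S := S) hq
  rw [p1, q1]
  simp only [mirror, m1, m2, v1, v2, p2, q2, w1, w2, true_and]
  tauto

end Diagram

namespace Diagram

variable {D : Type*} {S : TriSurface D} {X Y : Diagram D}

/-! ### Sequences of moves with the opposite orientation -/

lemma renamed_symm (h : Proper S X) {cnt' : D → ℕ} {old : Port D → Option (Port D)} {p q : Port D}
    (hpq : X.renamed cnt' old p q) : X.renamed cnt' old q p := by
  obtain ⟨hp, hq, r, s, h1, h2, hj⟩ := hpq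
  exact ⟨hq, hp, s, r, h2, h1, h.symm _ _ hj⟩

lemma isPair_symm {α : Type*} {a b p q : α} (h : IsPair a b p q) : IsPair a b q p := by
  unfold IsPair at *; tauto

lemma Proper.windCW (h : Proper S X) (c : D) : Proper S (X.windCW S c) := by
  have n1 := S.opp_ne c
  refine ⟨cntAdd_opp h.cnt_opp, ?_, ?_, h.comps_opp⟩
  · rintro p q (hpq | hpq)
    exacts [Or.inl (renamed_symm h hpq), Or.inr (isPair_symm hpq)]
  · rintro p q (hpq | ⟨rfl, -⟩ | ⟨rfl, -⟩)
    · exact hpq.1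
    · trivial
    · have := h.cnt_opp c
      simp only [Port.Valid, windCW_cnt, cntAdd, or_true, if_true]; omega

lemma Proper.windCCW (h : Proper S X) (c : D) : Proper S (X.windCCW S c) := by
  refine ⟨cntAdd_opp h.cnt_opp, ?_, ?_, h.comps_opp⟩
  · rintro p q (hpq | hpq)
    exacts [Or.inl (renamed_symm h hpq), Or.inr (isPair_symm hpq)]
  · rintro p q (hpq | ⟨rfl, -⟩ | ⟨rfl, -⟩)
    · exact hpq.1
    · trivial
    · simp only [Port.Valid, windCCW_cnt, cntAdd, true_or, if_true]; omega

lemma comps_sdiff_opp (h : Proper S X) {f d : D} (hd : d ∈ X.comps \ {f, S.opp f}) :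
    S.opp d ∈ X.comps \ {f, S.opp f} := by
  refine ⟨h.comps_opp _ hd.1, ?_⟩
  rintro (h' | h')
  · exact hd.2 (Or.inr (S.eq_opp_iff.1 h'.symm))
  · exact hd.2 (Or.inl (S.opp_inj.1 h'))

lemma Proper.pushCW (h : Proper S X) (f : D) : Proper S (X.pushCW S f) := by
  refine ⟨h.cnt_opp, ?_, ?_, fun d => comps_sdiff_opp h⟩
  · rintro p q (hpq | hpq)
    exacts [Or.inl (h.symm _ _ hpq), Or.inr (isPair_symm hpq)]
  · rintro p q (hpq | ⟨rfl, -⟩ | ⟨rfl, -⟩)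
    exacts [h.valid _ _ hpq, trivial, trivial]

lemma Proper.pushCCW (h : Proper S X) (f : D) : Proper S (X.pushCCW S f) := by
  refine ⟨h.cnt_opp, ?_, ?_, fun d => comps_sdiff_opp h⟩
  · rintro p q (hpq | hpq)
    exacts [Or.inl (h.symm _ _ hpq), Or.inr (isPair_symm hpq)]
  · rintro p q (hpq | ⟨rfl, -⟩ | ⟨rfl, -⟩)
    exacts [h.valid _ _ hpq, trivial, trivial]

lemma Proper.tighten (h : Proper S X) (hY : Tighten S X Y) : Proper S Y := by
  cases hY with
  | slideCW d hd =>
    refine ⟨cntSub_opp h.cnt_opp, ?_, ?_, h.comps_opp⟩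
    · intro p q; simp only [slideCW_joined]
      exact fun ⟨h1, h2, h3⟩ => ⟨h2, h1, h.symm _ _ h3⟩
    · intro p q; simp only [slideCW_joined]; exact fun h => h.1
  | slideCCW d h₀ hd =>
    refine ⟨cntSub_opp h.cnt_opp, ?_, ?_, h.comps_opp⟩
    · intro p q; simp only [slideCCW_joined]
      exact fun ⟨h1, h2, h3⟩ => ⟨h2, h1, h.symm _ _ h3⟩
    · intro p q; simp only [slideCCW_joined]; exact fun h => h.1
  | removeTurnBack d i hd h' =>
    refine ⟨fun x => ?_, ?_, fun p q hpq => hpq.1, h.comps_opp⟩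
    · have := h.cnt_opp x
      have := S.eq_opp_iff (a := x) (b := d)
      have := S.opp_inj (a := x) (b := d)
      simp only [removeTurnBack]; grind
    · rintro p q ⟨h1, h2, h3 | h3 | h3⟩
      · exact ⟨h2, h1, Or.inl (h.symm _ _ h3)⟩
      · exact ⟨h2, h1, Or.inr (Or.inr h3)⟩
      · exact ⟨h2, h1, Or.inr (Or.inl h3)⟩
  | pushToEdge d h₀ hd =>
    refine ⟨h.cnt_opp, fun p q hpq => ⟨h.symm _ _ hpq.1, fun h' => hpq.2 (isPair_symm h')⟩,
      fun p q hpq => h.valid _ _ hpq.1, ?_⟩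
    rintro x (hx | rfl | rfl)
    · exact Or.inl (h.comps_opp _ hx)
    · exact Or.inr (Or.inr rfl)
    · exact Or.inr (Or.inl (S.opp_opp _))

lemma Proper.stepCW (h : Proper S X) {d : D} (hY : StepCW S d X Y) : Proper S Y := by
  cases hY with
  | push f hf hfd => exact h.pushCW f
  | wind c hc hcd hne => exact h.windCW c

lemma Proper.stepCCW (h : Proper S X) {d : D} (hY : StepCCW S d X Y) : Proper S Y := by
  cases hY with
  | push f hf hfd => exact h.pushCCW f
  | wind c hc hcd hne => exact h.windCCW c

lemma windCCW_mirror (h : Proper S X) (c : D) :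
    (X.windCCW S c).mirror S = (X.mirror S).windCW S.mirror (S.opp c) := by
  have := windCW_mirror h.mirror (S.opp c)
  rw [h.mirror_mirror, S.mirror_mirror, TriSurface.mirror_opp, S.opp_opp] at this
  rw [← this]
  have h2 := (h.mirror.windCW (S.opp c)).mirror_mirror
  rwa [S.mirror_mirror] at h2

lemma pushCCW_mirror (h : Proper S X) (c : D) :
    (X.pushCCW S c).mirror S = (X.mirror S).pushCW S.mirror (S.opp c) := by
  have := pushCW_mirror (S := S.mirror) (X.mirror S) (S.opp c)
  rw [h.mirror_mirror, S.mirror_mirror, TriSurface.mirror_opp, S.opp_opp] at this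
  rw [← this]
  have h2 := (h.mirror.pushCW (S.opp c)).mirror_mirror
  rwa [S.mirror_mirror] at h2

lemma StepCW.mirror (h : Proper S X) {d : D} (hY : StepCW S d X Y) :
    StepCCW S.mirror (S.opp d) (X.mirror S) (Y.mirror S) := by
  cases hY with
  | push f hf hfd =>
    rw [pushCW_mirror]
    exact .push _ _ (h.comps_opp _ hf) ((S.sameVertex_mirror_opp _ _).2 hfd)
  | wind c hc hcd hne =>
    rw [windCW_mirror h]
    refine .wind _ _ ?_ ((S.sameVertex_mirror_opp _ _).2 hcd) fun h' => hne (S.opp_inj.1 h')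
    rwa [S.mirror_rot, S.opp_opp, h.mirror_hasEnd, S.next_prev]

lemma StepCCW.mirror (h : Proper S X) {d : D} (hY : StepCCW S d X Y) :
    StepCW S.mirror (S.opp d) (X.mirror S) (Y.mirror S) := by
  cases hY with
  | push f hf hfd =>
    rw [pushCCW_mirror h]
    exact .push _ _ (h.comps_opp _ hf) ((S.sameVertex_mirror_opp _ _).2 hfd)
  | wind c hc hcd hne =>
    rw [windCCW_mirror h]
    refine .wind _ _ ?_ ((S.sameVertex_mirror_opp _ _).2 hcd) fun h' => hne (S.opp_inj.1 h')
    rwa [h.mirror_hasEnd]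

lemma EndsOnlyIn.mirror (h : Proper S X) {d c : D} (hd : X.EndsOnlyIn S d c) :
    (X.mirror S).EndsOnlyIn S.mirror (S.opp d) (S.prev c) := by
  constructor
  · intro f hf hfc
    rw [← S.opp_opp f, S.sameVertex_mirror_opp] at hf
    exact hd.1 _ hf (h.comps_opp _ hfc)
  · intro x hx hxe
    rw [h.mirror_hasEnd] at hxe
    rw [← S.opp_opp x, S.sameVertex_mirror_opp] at hx
    exact S.eq_next_iff.1 (hd.2 _ ((S.sameVertex_next x).symm.trans hx) hxe).symm

lemma WindsCW.mirror (h : Proper S X) {d : D} (hY : WindsCW S d X Y) :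
    WindsCCW S.mirror (S.opp d) (X.mirror S) (Y.mirror S) ∧ Proper S Y := by
  obtain ⟨h1, h2⟩ := hY
  have : Relation.ReflTransGen (StepCCW S.mirror (S.opp d)) (X.mirror S) (Y.mirror S) ∧
      Proper S Y := by
    clear h2
    induction h1 with
    | refl => exact ⟨.refl, h⟩
    | tail _ hs ih => exact ⟨ih.1.tail (hs.mirror ih.2), ih.2.stepCW hs⟩
  refine ⟨⟨this.1, ?_⟩, this.2⟩
  rw [S.mirror_rot, S.opp_opp]
  exact h2.mirror this.2

lemma WindsCCW.mirror (h : Proper S X) {d : D} (hY : WindsCCW S d X Y) :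
    WindsCW S.mirror (S.opp d) (X.mirror S) (Y.mirror S) ∧ Proper S Y := by
  obtain ⟨h1, h2⟩ := hY
  have : Relation.ReflTransGen (StepCW S.mirror (S.opp d)) (X.mirror S) (Y.mirror S) ∧
      Proper S Y := by
    clear h2
    induction h1 with
    | refl => exact ⟨.refl, h⟩
    | tail _ hs ih => exact ⟨ih.1.tail (hs.mirror ih.2), ih.2.stepCCW hs⟩
  refine ⟨⟨this.1, ?_⟩, this.2⟩
  have := h2.mirror this.2
  rwa [S.prev_rot] at this

lemma slideCCW_mirror (h : Proper S X) {d : D} (hd : 0 < X.cnt d) (hp : Proper S.mirror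
    ((X.mirror S).slideCW S.mirror (S.opp d))) :
    (X.slideCCW S d).mirror S = (X.mirror S).slideCW S.mirror (S.opp d) := by
  have := slideCW_mirror h.mirror (d := S.opp d) ((h.cnt_opp d).symm ▸ hd)
  rw [h.mirror_mirror, S.mirror_mirror, TriSurface.mirror_opp, S.opp_opp] at this
  rw [← this]
  have h2 := hp.mirror_mirror
  rwa [S.mirror_mirror] at h2

lemma Tighten.mirror (h : Proper S X) (hY : Tighten S X Y) :
    Tighten S.mirror (X.mirror S) (Y.mirror S) := by
  have hr : ∀ d, S.mirror.rot (S.opp d) = S.prev d := fun d => by rw [S.mirror_rot, S.opp_opp]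
  cases hY with
  | slideCW d hd =>
    have h0 : 0 < X.cnt d := h.valid _ _ (h.symm _ _ hd)
    rw [slideCW_mirror h h0]
    refine .slideCCW _ _ ((h.cnt_opp d).symm ▸ h0) ?_
    have := h.mirror_joined hd
    simp only [mirrorPort, TriSurface.mirror_next] at this
    have hc : (X.mirror S).cnt (S.opp d) = X.cnt d := h.cnt_opp d
    rw [hr, TriSurface.mirror_opp, S.opp_opp, hc]
    exact this
  | slideCCW d h₀ hd =>
    have hj : (X.mirror S).joined (.vertex (S.opp d)) (.point (S.opp d) 0) := by
      have := h.mirror_joined hd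
      simp only [mirrorPort, TriSurface.mirror_next, S.prev_rot] at this
      rwa [h.cnt_opp, Nat.sub_self] at this
    have hT := Tighten.slideCW (S := S.mirror) _ _ hj
    rw [slideCCW_mirror h h₀ (h.mirror.tighten hT)]
    exact hT
  | removeTurnBack d i hd h' =>
    have hlt : i + 1 < X.cnt d := h.valid _ _ (h.symm _ _ hd)
    have hco := h.cnt_opp d
    rw [removeTurnBack_mirror h (by omega)]
    refine .removeTurnBack _ _ _ ?_ fun hj => h' ?_
    · have := h.mirror_joined (h.symm _ _ hd)
      simp only [mirrorPort] at this
      rwa [show X.cnt d - 1 - (i + 1) = X.cnt d - 2 - i by omega,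
        show X.cnt d - 1 - i = X.cnt d - 2 - i + 1 by omega] at this
    · obtain ⟨v1, v2, hj⟩ := hj
      have hj := h.symm _ _ hj
      simp only [mirrorPort, TriSurface.mirror_opp, mirror, Port.Valid, h.cnt_opp] at hj v1 v2
      rwa [show X.cnt d - 1 - (X.cnt d - 2 - (X.cnt d - 2 - i) + 1) = X.cnt d - 2 - i by omega,
        show X.cnt d - 1 - (X.cnt d - 2 - (X.cnt d - 2 - i)) = X.cnt d - 2 - i + 1 by omega] at hj
  | pushToEdge d h₀ hd =>
    rw [pushToEdge_mirror]
    refine .pushToEdge _ _ h₀ ?_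
    have := h.mirror_joined (h.symm _ _ hd)
    simpa [mirrorPort] using this

lemma tightens_mirror (h : Proper S X) (hY : Relation.ReflTransGen (Tighten S) X Y) :
    Relation.ReflTransGen (Tighten S.mirror) (X.mirror S) (Y.mirror S) ∧ Proper S Y := by
  induction hY with
  | refl => exact ⟨.refl, h⟩
  | tail _ hs ih => exact ⟨ih.1.tail (hs.mirror ih.2), ih.2.tighten hs⟩

open Classical in
lemma crossings_mirror (h : Proper S X) (e : D) :
    (X.mirror S).crossings (S.opp e) (S.mirror.rot (S.opp e)) (S.mirror.rot (S.opp (S.opp e))) =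
      X.crossings e e (S.opp e) := by
  unfold crossings
  rw [S.mirror_rot, S.mirror_rot, h.mirror_hasEnd, h.mirror_hasEnd, S.next_prev, S.next_prev,
    S.opp_opp, show (X.mirror S).cnt (S.opp e) = X.cnt e from h.cnt_opp e]

set_option maxHeartbeats 1000000 in
/-- The positive smoothing becomes the negative one when the orientation is reversed. -/
lemma posSmooth_mirror (hS : S.Simple) (h : Proper S X) (e : D) :
    (X.posSmooth S e).mirror S = (X.mirror S).negSmooth S.mirror (S.opp e) := by
  have hco := h.cnt_opp e
  have n1 := S.opp_ne e
  have oo := S.opp_opp e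
  have hk := crossings_mirror h e
  have hcnt : (X.mirror S).negCnt S.mirror (S.opp e) = X.posCnt S e := by
    funext x
    have hx : (X.mirror S).cnt x = X.cnt x := rfl
    simp only [negCnt, posCnt, TriSurface.mirror_opp, hk, hx]
    grind
  refine Diagram.ext hcnt.symm ?_ ?_
  · funext p q
    have key := mirror_renamed h (cnt' := X.posCnt S e) (old := X.posPort S e)
      (old' := (X.mirror S).negPort S.mirror (S.opp e)) ?_ p q
    · rw [negSmooth_joined, hcnt, ← key]; rfl
    · intro p r hp hr hrv
      have hE : ∀ c, (X.mirror S).HasEnd (S.prev c) ↔ X.HasEnd c := fun c => by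
        rw [h.mirror_hasEnd, S.next_prev]
      have hE' : ∀ c, (X.mirror S).HasEnd c ↔ X.HasEnd (S.next c) := h.mirror_hasEnd
      have hc : (X.mirror S).cnt = X.cnt := rfl
      have hrot : ∀ x, (X.mirror S).HasEnd (S.mirror.rot x) ↔ X.HasEnd (S.opp x) := fun x => by
        rw [S.mirror_rot, hE]
      have i1 : ∀ x y, S.next x = S.next y ↔ x = y := fun x y => S.next_inj
      have i2 : ∀ x y, S.next x = y ↔ x = S.prev y := fun x y => by rw [eq_comm, S.eq_next_iff]
      have i3 : ∀ x, S.prev (S.next x) = x := S.prev_next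
      have n2 : S.prev (S.opp e) ≠ e := fun h' => hS.opp_ne_next e (S.eq_next_iff.2 h'.symm)
      have n3 : S.prev (S.opp e) ≠ S.opp e := S.prev_ne _
      have n4 : S.prev e ≠ e := S.prev_ne _
      have n5 : S.prev e ≠ S.opp e := (hS.opp_ne_prev e).symm
      have n6 : S.next e ≠ S.next (S.opp e) := fun h' => n1 (S.next_inj.1 h').symm
      clear hk hcnt h hS
      cases p with
      | point x i =>
        by_cases hx : x = e ∨ x = S.opp e
        · simp only [Port.Valid, posCnt, hx, if_true, crossings] at hp
          have hx' : x = S.opp e ∨ x = S.opp (S.opp e) := by rw [oo]; exact hx.symm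
          simp only [posPort, negPort, mirrorPort, posCnt, hx, hx', if_true, TriSurface.mirror_opp,
            hE, negSeq, hc, posSeq, crossings, TriSurface.mirror_next,
            Option.some.injEq]
          rw [hrot]
          rcases hx with rfl | rfl
          · by_cases a : X.HasEnd x <;> by_cases b : X.HasEnd (S.opp x) <;>
              cases r <;> simp only [a, b, if_true, if_false, Port.Valid] at hp hr ⊢ <;>
              split_ifs <;> simp only [Port.point.injEq, Port.vertex.injEq, reduceCtorEq] <;>
              first
                | omega
                | grind
          · by_cases a : X.HasEnd e <;> by_cases b : X.HasEnd (S.opp e) <;>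
              cases r <;> simp only [oo, a, b, if_true, if_false, Port.Valid] at hp hr ⊢ <;>
              split_ifs <;> simp only [Port.point.injEq, Port.vertex.injEq, reduceCtorEq] <;>
              first
                | omega
                | grind
        · have hx' : ¬ (x = S.opp e ∨ x = S.opp (S.opp e)) := by rw [oo]; exact fun h => hx h.symm
          simp only [Port.Valid, posCnt, hx, if_false] at hp
          simp only [posPort, negPort, mirrorPort, posCnt, hx, hx', if_false, TriSurface.mirror_opp,
            Option.some.injEq]
          cases r <;> simp only [mirrorPort, Port.Valid, Port.point.injEq, reduceCtorEq] at hr ⊢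
          constructor <;> rintro ⟨rfl, _⟩ <;> exact ⟨rfl, by omega⟩
      | vertex x =>
        have hn : ∀ x, S.mirror.next x = S.prev x := S.mirror_next
        have ho : ∀ x, S.mirror.opp x = S.opp x := fun _ => rfl
        simp only [posPort, negPort, mirrorPort]
        cases r <;> split_ifs <;> simp only [mirrorPort, Option.some.injEq, reduceCtorEq,
          Port.vertex.injEq, Port.point.injEq, posSeq, posLast, negSeq] <;>
          simp only [mirrorPort, Port.Valid] at hr hrv <;> constructor <;> intro hh <;>
          (try split_ifs at hh) <;> (try split_ifs) <;>
          first
            | (simp only [Port.point.injEq] at hh ⊢; obtain ⟨rfl, _⟩ := hh; constructor <;> grind)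
            | grind
  · change (X.posSmooth S e).comps = _
    rw [negSmooth_comps, posSmooth_comps]
    simp only [TriSurface.mirror_opp, hk]
    rw [oo, Set.pair_comm]; rfl

lemma posCnt_opp_dart (h : ∀ d, X.cnt (S.opp d) = X.cnt d) (e d : D) :
    X.posCnt S e (S.opp d) = X.posCnt S e d := by
  have oo := S.opp_opp
  simp only [posCnt]
  grind

lemma Proper.posSmooth (h : Proper S X) (e : D) : Proper S (X.posSmooth S e) := by
  refine ⟨posCnt_opp_dart h.cnt_opp e, fun p q hpq =>
    renamed_symm (cnt' := X.posCnt S e) (old := X.posPort S e) h hpq, fun p q hpq => hpq.1, ?_⟩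
  intro d hd
  have oo := S.opp_opp
  have hc := h.comps_opp d
  rw [posSmooth_comps] at hd ⊢
  split_ifs at hd ⊢
  · rcases hd with hd | rfl | rfl
    exacts [Or.inl (hc hd), Or.inr (Or.inr rfl), Or.inr (Or.inl (oo e))]
  · exact hc hd

lemma Proper.negSmooth (h : Proper S X) (e : D) : Proper S (X.negSmooth S e) := by
  refine ⟨?_, fun p q hpq =>
    renamed_symm (cnt' := X.negCnt S e) (old := X.negPort S e) h hpq, fun p q hpq => hpq.1, ?_⟩
  · intro d
    have oo := S.opp_opp
    have := h.cnt_opp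
    rw [negSmooth_cnt]
    simp only [negCnt]
    grind
  · intro d hd
    have oo := S.opp_opp
    have hc := h.comps_opp d
    rw [negSmooth_comps] at hd ⊢
    split_ifs at hd ⊢
    · rcases hd with hd | rfl | rfl
      exacts [Or.inl (hc hd), Or.inr (Or.inr rfl), Or.inr (Or.inl (oo e))]
    · exact hc hd

lemma negSmooth_mirror (hS : S.Simple) (h : Proper S X) (e : D) :
    (X.negSmooth S e).mirror S = (X.mirror S).posSmooth S.mirror (S.opp e) := by
  have h1 := posSmooth_mirror hS.mirror h.mirror (S.opp e)
  rw [S.mirror_mirror, h.mirror_mirror, TriSurface.mirror_opp, S.opp_opp] at h1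
  have h2 := (h.mirror.posSmooth (S.opp e)).mirror_mirror
  rw [S.mirror_mirror, h1] at h2
  exact h2

end Diagram

namespace Diagram

variable {D : Type*} {S : TriSurface D} {X : Diagram D} {e : D} {α β γ : Diagram D}

/-! ### The resolutions of a multicurve that does not contain the edge -/

/-- `β` is isotopic to the positive resolution of `e` and `α`, where `e` is not a component
of `α`. -/
def PosRes (S : TriSurface D) (e : D) (α β : Diagram D) : Prop :=
  ∃ X₁ X₂, WindsCW S e α X₁ ∧ WindsCW S (S.opp e) X₁ X₂ ∧
    Relation.ReflTransGen (Tighten S) (X₂.posSmooth S e) β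

/-- `β` is isotopic to the negative resolution of `e` and `α`, where `e` is not a component
of `α`. -/
def NegRes (S : TriSurface D) (e : D) (α β : Diagram D) : Prop :=
  ∃ X₁ X₂, WindsCCW S e α X₁ ∧ WindsCCW S (S.opp e) X₁ X₂ ∧
    Relation.ReflTransGen (Tighten S) (X₂.negSmooth S e) β

lemma PosRes.mirror (hS : S.Simple) (h : Proper S α) (hβ : PosRes S e α β) :
    NegRes S.mirror (S.opp e) (α.mirror S) (β.mirror S) ∧ Proper S β := by
  obtain ⟨X₁, X₂, h1, h2, h3⟩ := hβ
  obtain ⟨m1, p1⟩ := h1.mirror h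
  obtain ⟨m2, p2⟩ := h2.mirror p1
  obtain ⟨m3, p3⟩ := tightens_mirror (p2.posSmooth e) h3
  rw [posSmooth_mirror hS p2] at m3
  exact ⟨⟨_, _, m1, m2, m3⟩, p3⟩

lemma NegRes.mirror (hS : S.Simple) (h : Proper S α) (hβ : NegRes S e α β) :
    PosRes S.mirror (S.opp e) (α.mirror S) (β.mirror S) ∧ Proper S β := by
  obtain ⟨X₁, X₂, h1, h2, h3⟩ := hβ
  obtain ⟨m1, p1⟩ := h1.mirror h
  obtain ⟨m2, p2⟩ := h2.mirror p1
  obtain ⟨m3, p3⟩ := tightens_mirror (p2.negSmooth e) h3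
  rw [negSmooth_mirror hS p2] at m3
  exact ⟨⟨_, _, m1, m2, m3⟩, p3⟩

lemma PosRes.of_mirror (hS : S.Simple) (hα : Proper S α) (hβ : Proper S β)
    (h : PosRes S.mirror (S.opp e) (α.mirror S) (β.mirror S)) : NegRes S e α β := by
  have := (h.mirror hS.mirror hα.mirror).1
  rwa [S.mirror_mirror, hα.mirror_mirror, hβ.mirror_mirror, TriSurface.mirror_opp,
    S.opp_opp] at this

lemma NegRes.of_mirror (hS : S.Simple) (hα : Proper S α) (hβ : Proper S β)
    (h : NegRes S.mirror (S.opp e) (α.mirror S) (β.mirror S)) : PosRes S e α β := by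
  have := (h.mirror hS.mirror hα.mirror).1
  rwa [S.mirror_mirror, hα.mirror_mirror, hβ.mirror_mirror, TriSurface.mirror_opp,
    S.opp_opp] at this

/-- The positive resolution has only one reduced form: winding the ends up and pulling them tight are
both deterministic. -/
lemma PosRes.unique [Finite D] (hS : S.Simple) (hα : α.IsReduced S) (he : e ∉ α.comps)
    (hβ : β.IsReduced S) (hγ : γ.IsReduced S) (h : PosRes S e α β) (h' : PosRes S e α γ) :
    β = γ := by
  obtain ⟨X₁, X₂, h1, h2, h3⟩ := h
  obtain ⟨Z₁, Z₂, k1, k2, k3⟩ := h'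
  obtain ⟨W₁, W₂, w1, w2, hW, -⟩ := hα.exists_wound hS he
  obtain rfl := hα.wound_unique hS he h1 h2 w1 w2
  obtain rfl := hα.wound_unique hS he k1 k2 h1 h2
  exact (hW.posSmooth_unwinding hS).eq_of_tighten hS h3 k3 hβ hγ

lemma NegRes.unique [Finite D] (hS : S.Simple) (hα : α.IsReduced S) (he : e ∉ α.comps)
    (hβ : β.IsReduced S) (hγ : γ.IsReduced S) (h : NegRes S e α β) (h' : NegRes S e α γ) :
    β = γ := by
  have pα := hα.multicurve.proper
  have he' : S.opp e ∉ (α.mirror S).comps := fun h => he (by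
    have := pα.comps_opp _ h
    rwa [S.opp_opp] at this)
  have := PosRes.unique hS.mirror hα.mirror he' hβ.mirror hγ.mirror (h.mirror hS pα).1
    (h'.mirror hS pα).1
  rw [← hβ.multicurve.proper.mirror_mirror, this, hγ.multicurve.proper.mirror_mirror]

/-- Add the edge of `e` as a component. -/
def addEdge (X : Diagram D) (S : TriSurface D) (e : D) : Diagram D :=
  { X with comps := X.comps ∪ {e, S.opp e} }

lemma Wound.hasEnd_iff (h : Wound S e X) : X.HasEnd e ↔ X.EndsAt S e := by
  refine ⟨fun hx => ⟨e, .refl _ _, Or.inl hx⟩, ?_⟩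
  rintro ⟨c, hc, hx | hx⟩
  · rwa [h.endsOnlyIn.2 c hc hx] at hx
  · exact absurd hx (h.endsOnlyIn.1 c hc)

/-- A multicurve disjoint from the edge is not changed by the smoothing, except that the edge
becomes a component. -/
lemma posSmooth_eq_addEdge (h : X.IsMulticurve S) (h0 : X.cnt e = 0) (h1 : ¬ X.EndsAt S e)
    (h2 : ¬ X.EndsAt S (S.opp e)) : X.posSmooth S e = X.addEdge S e := by
  have a1 : ¬ X.HasEnd e := fun hx => h1 ⟨e, .refl _ _, Or.inl hx⟩
  have a2 : ¬ X.HasEnd (S.opp e) := fun hx => h2 ⟨_, .refl _ _, Or.inl hx⟩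
  have a3 : ¬ X.HasEnd (S.next e) := fun hx => h2 ⟨_, (S.sameVertex_next e).symm, Or.inl hx⟩
  have a4 : ¬ X.HasEnd (S.next (S.opp e)) := fun hx => h1 ⟨_, by
    have := (S.sameVertex_next (S.opp e)).symm
    rwa [S.opp_opp] at this, Or.inl hx⟩
  have h0' : X.cnt (S.opp e) = 0 := (h.cnt_opp e).trans h0
  have hk : X.crossings e e (S.opp e) = 0 := by simp [crossings, h0, a1, a2]
  have hcnt : X.posCnt S e = X.cnt := by
    funext x
    simp only [posCnt, hk]
    grind
  -- without crossings every strand keeps its ports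
  have hold : ∀ p q, X.joined p q → X.posPort S e p = some p := by
    intro p q hpq
    have hv := h.valid _ _ hpq
    cases p with
    | point x i =>
      simp only [Port.Valid] at hv
      simp only [posPort]
      grind
    | vertex x =>
      have hx : X.HasEnd x := ⟨q, hpq⟩
      simp only [posPort]
      grind
  have hold' : ∀ p p₀ q, X.posPort S e p = some p₀ → X.joined p₀ q → p₀ = p := by
    intro p p₀ q hp hpq
    have hv := h.valid _ _ hpq
    cases p with
    | point x i =>
      simp only [posPort, posSeq, a1, a2] at hp
      grind
    | vertex x =>
      simp only [posPort, posSeq, posLast, a1, a2] at hp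
      have : ∀ i, X.joined (.point e i) q → False := fun i hi => by
        have := h.valid _ _ hi
        simp only [Port.Valid] at this; omega
      have : ∀ i, X.joined (.point (S.opp e) i) q → False := fun i hi => by
        have := h.valid _ _ hi
        simp only [Port.Valid] at this; omega
      grind
  refine Diagram.ext hcnt ?_ ?_
  · funext p q
    refine propext ⟨?_, fun hpq => ⟨?_, ?_, p, q, hold _ _ hpq, hold _ _ (h.symm _ _ hpq), hpq⟩⟩
    · rintro hpq
      obtain ⟨-, -, r, s, hr, hs, hj⟩ := hpq
      obtain rfl := hold' _ _ _ hr hj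
      obtain rfl := hold' _ _ _ hs (h.symm _ _ hj)
      exact hj
    · change p.Valid (X.posCnt S e)
      exact hcnt ▸ h.valid _ _ hpq
    · change q.Valid (X.posCnt S e)
      exact hcnt ▸ h.valid _ _ (h.symm _ _ hpq)
  · rw [posSmooth_comps, if_pos hk]; rfl

lemma Wound.posSmooth_endsAt_opp [Finite D] (hS : S.Simple) (h : Wound S e X) :
    (X.posSmooth S e).EndsAt S (S.opp e) ↔ ¬ X.EndsAt S (S.opp e) := by
  rw [← posSmooth_opp h.multicurve]
  exact h.symm_edge.posSmooth_endsAt hS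

/-- The positive resolution exists, it exchanges the shared endpoints for the others, and unless the
multicurve is disjoint from the edge it is undone by the negative resolution. -/
theorem IsReduced.exists_posRes [Finite D] (hS : S.Simple) (hα : α.IsReduced S)
    (he : e ∉ α.comps) : ∃ β, β.IsReduced S ∧ PosRes S e α β ∧
      (β.EndsAt S e ↔ ¬ α.EndsAt S e) ∧ (β.EndsAt S (S.opp e) ↔ ¬ α.EndsAt S (S.opp e)) ∧
      ((¬ α.EndsAt S e ∧ β = α.addEdge S e) ∨
        (e ∉ β.comps ∧ NegRes S e β α ∧ (α.EndsAt S e → α.EndsAt S (S.opp e) → β.cnt e ≠ 0))) := by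
  obtain ⟨X₁, X₂, w1, w2, hW, hT, hc, hE⟩ := hα.exists_wound hS he
  have e1 : X₂.HasEnd e ↔ α.EndsAt S e := hW.hasEnd_iff.trans (hE e)
  have e2 : X₂.HasEnd (S.opp e) ↔ α.EndsAt S (S.opp e) := hW.symm_edge.hasEnd_iff.trans (hE _)
  by_cases hk : X₂.crossings e e (S.opp e) = 0
  · have hk' := hk
    simp only [crossings, Nat.add_eq_zero_iff, ite_eq_right_iff, one_ne_zero, imp_false] at hk'
    have k1 := (not_congr e1).1 hk'.1.2
    have k2 := (not_congr e2).1 hk'.2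
    have n1 : α.EndsOnlyIn S e e := ⟨fun f hf hf' => k1 ⟨f, hf, Or.inr hf'⟩,
      fun x hx hx' => absurd ⟨x, hx, Or.inl hx'⟩ k1⟩
    have n2 : α.EndsOnlyIn S (S.opp e) (S.opp e) := ⟨fun f hf hf' => k2 ⟨f, hf, Or.inr hf'⟩,
      fun x hx hx' => absurd ⟨x, hx, Or.inl hx'⟩ k2⟩
    obtain rfl := hα.wound_unique hS he (⟨.refl, n1⟩ : WindsCW S e α α) ⟨.refl, n2⟩ w1 w2
    have hY := posSmooth_eq_addEdge hα.multicurve hk'.1.1 k1 k2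
    refine ⟨α.posSmooth S e, ⟨hW.posSmooth_isMulticurve hS, ?_, hW.posSmooth_no_loop hS⟩,
      ⟨_, _, w1, w2, .refl⟩, hW.posSmooth_endsAt hS, hW.posSmooth_endsAt_opp hS,
      Or.inl ⟨k1, hY⟩⟩
    rw [hY]
    exact ⟨hα.noTurnBacks.side, hα.noTurnBacks.vertex⟩
  · have hk0 := Nat.pos_of_ne_zero hk
    have hop : (X₂.posSmooth S e).EndsOnlyIn S (S.opp e) (S.rot (S.opp e)) := by
      rw [← posSmooth_opp hW.multicurve]
      exact hW.symm_edge.posSmooth_endsOnlyIn hS (by rwa [crossings_symm hW.multicurve])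
    obtain ⟨β, hβ, hT', ⟨Y₁, y1, y2⟩, hcnt, hcomp, hEnds⟩ :=
      (hW.posSmooth_unwinding hS).exists_reduced hS (hW.posSmooth_endsOnlyIn hS hk0) hop
    refine ⟨β, hβ, ⟨_, _, w1, w2, hT'⟩,
      (hEnds e).trans ((hW.posSmooth_endsAt hS).trans (not_congr (hE e))),
      (hEnds _).trans ((hW.posSmooth_endsAt_opp hS).trans (not_congr (hE _))), Or.inr ⟨?_, ?_, ?_⟩⟩
    · rw [hcomp, posSmooth_comps, if_neg hk]
      exact hW.endsOnlyIn.1 e (.refl _ _)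
    · exact ⟨_, _, y1, y2, by rwa [hW.negSmooth_posSmooth hS hk0]⟩
    · intro a b
      rw [hcnt, posSmooth_cnt]
      simp only [posCnt, true_or, if_true, crossings, e1.2 a, e2.2 b]
      omega

/-- The mirror image of `IsReduced.exists_posRes`. -/
theorem IsReduced.exists_negRes [Finite D] (hS : S.Simple) (hα : α.IsReduced S)
    (he : e ∉ α.comps) : ∃ β, β.IsReduced S ∧ NegRes S e α β ∧
      (β.EndsAt S e ↔ ¬ α.EndsAt S e) ∧ (β.EndsAt S (S.opp e) ↔ ¬ α.EndsAt S (S.opp e)) ∧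
      ((¬ α.EndsAt S e ∧ β = α.addEdge S e) ∨
        (e ∉ β.comps ∧ PosRes S e β α ∧ (α.EndsAt S e → α.EndsAt S (S.opp e) → β.cnt e ≠ 0))) := by
  have pα := hα.multicurve.proper
  have mm := S.mirror_mirror
  have he' : S.opp e ∉ (α.mirror S).comps := fun h => he (by
    have := pα.comps_opp _ h
    rwa [S.opp_opp] at this)
  obtain ⟨β', hβ', hr, h1, h2, h3⟩ := hα.mirror.exists_posRes hS.mirror he'
  -- the mirror image of `β'` is the required multicurve
  obtain ⟨β, hβ, rfl⟩ : ∃ β : Diagram D, β.IsReduced S ∧ β.mirror S = β' := by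
    have := hβ'.mirror
    rw [mm] at this
    refine ⟨_, this, ?_⟩
    have := hβ'.multicurve.proper.mirror_mirror
    rwa [mm] at this
  have pβ := hβ.multicurve.proper
  have a1 := endsAt_mirror hα.multicurve e
  have a2 := endsAt_mirror hα.multicurve (S.opp e)
  have b1 := endsAt_mirror hβ.multicurve e
  have b2 := endsAt_mirror hβ.multicurve (S.opp e)
  rw [S.mirror_opp] at h2 h3
  refine ⟨β, hβ, hr.of_mirror hS pα pβ, by rw [← a1, ← b1]; exact h1, by rw [← a2, ← b2]; exact h2,
    ?_⟩
  rcases h3 with ⟨h3, h4⟩ | ⟨h3, h4, h5⟩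
  · refine Or.inl ⟨by rwa [a1] at h3, ?_⟩
    have := congrArg (Diagram.mirror S.mirror) h4
    rw [pβ.mirror_mirror] at this
    rw [this]
    have h6 := pα.mirror_mirror
    refine Diagram.ext rfl ?_ ?_
    · change ((α.mirror S).mirror S.mirror).joined = α.joined
      rw [h6]
    · change α.comps ∪ {S.opp e, S.opp (S.opp e)} = α.comps ∪ {e, S.opp e}
      rw [S.opp_opp, Set.pair_comm]
  · refine Or.inr ⟨fun h => h3 (pβ.comps_opp _ h), h4.of_mirror hS pβ pα, fun x y => ?_⟩
    have := h5 (a1.2 x) (a2.2 y)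
    rwa [show (β.mirror S).cnt (S.opp e) = β.cnt e from pβ.cnt_opp e] at this

end Diagram

namespace Diagram

variable {D : Type*} {S : TriSurface D} {X Y : Diagram D} {e x y : D}

/-! ### The loop around an edge -/

/-- A side with one endpoint on `e` has its other endpoint outside `e`, by the absence of one-cycles
and two-cycles. -/
lemma IsSpoke.not_opp (hS : S.Simple) (hx : IsSpoke S e x) : ¬ IsSpoke S e (S.opp x) := by
  rintro ⟨h, -, -⟩
  obtain ⟨h', h1, h2⟩ := hx
  rcases h' with h' | h' <;> rcases h with h | h
  · exact hS.not_sameVertex_opp x (h'.trans h.symm)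
  · exact h1 (hS.eq_of_sameVertex h' h)
  · exact h2 (hS.eq_opp h' h)
  · exact hS.not_sameVertex_opp x (h'.trans h.symm)

open Classical in
/-- The side to which the loop around the edge `e` runs from the side `x`, in the triangle
of `x`. -/
def loopSide (S : TriSurface D) (e x : D) : D :=
  if S.prev x = e ∨ S.prev x = S.opp e then S.next x else S.prev x

lemma sameVertex_edge_next (S : TriSurface D) {d : D} (hd : d = e ∨ d = S.opp e) :
    S.SameVertex (S.next d) e ∨ S.SameVertex (S.next d) (S.opp e) := by
  rcases hd with rfl | rfl
  · exact Or.inr (S.sameVertex_next _).symm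
  · have := (S.sameVertex_next (S.opp e)).symm
    rw [S.opp_opp] at this
    exact Or.inl this

lemma IsSpoke.next (hS : S.Simple) {d : D} (hd : d = e ∨ d = S.opp e) :
    IsSpoke S e (S.next d) := by
  refine ⟨sameVertex_edge_next S hd, ?_⟩
  have h1 := S.next_ne d
  have h2 := hS.opp_ne_next d
  rcases hd with rfl | rfl
  · exact ⟨h1, h2.symm⟩
  · rw [S.opp_opp] at h2
    exact ⟨h2.symm, h1⟩

lemma IsSpoke.opp_prev (hS : S.Simple) {d : D} (hd : d = e ∨ d = S.opp e) :
    IsSpoke S e (S.opp (S.prev d)) := by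
  have h1 := S.sameVertex_opp_prev d
  have h2 := hS.opp_ne_next (S.prev d)
  have h3 := S.prev_ne d
  have h4 := S.opp_inj (a := S.prev d) (b := d)
  rw [S.next_prev] at h2
  rcases hd with rfl | rfl
  · exact ⟨Or.inl h1, h2, fun h => h3 (S.opp_inj.1 h)⟩
  · exact ⟨Or.inr h1, fun h => h3 (S.opp_inj.1 (by rw [h, S.opp_opp])), h2⟩

lemma IsSpoke.loopSide (hS : S.Simple) (hx : IsSpoke S e x) :
    IsSpoke S e (S.opp (loopSide S e x)) := by
  unfold Diagram.loopSide
  split_ifs with h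
  · have := IsSpoke.opp_prev hS h
    rwa [S.prev_prev] at this
  · push Not at h
    refine ⟨?_, fun h' => h.2 ?_, fun h' => h.1 (S.opp_inj.1 h')⟩
    · have := S.sameVertex_opp_prev x
      exact hx.1.imp this.trans this.trans
    · rw [← h', S.opp_opp]

lemma loopSide_inj (hx : IsSpoke S e x) (hy : IsSpoke S e y)
    (h : loopSide S e x = loopSide S e y) : x = y := by
  have n1 := S.next_inj (a := x) (b := y)
  have h1 := hx.2
  have h2 := hy.2
  have p1 := S.next_prev x
  have p2 := S.next_prev y
  have q1 := S.prev_next x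
  have q2 := S.prev_next y
  have r1 := S.next_next x
  have r2 := S.next_next y
  unfold loopSide at h
  split_ifs at h <;> grind

lemma exists_loopSide (hS : S.Simple) (hx : IsSpoke S e (S.opp x)) :
    ∃ y, IsSpoke S e y ∧ loopSide S e y = x := by
  by_cases h : S.next x = e ∨ S.next x = S.opp e
  · refine ⟨S.prev x, ?_, ?_⟩
    · have := IsSpoke.next hS h
      rwa [S.next_next] at this
    · rw [loopSide, if_pos (by rwa [S.prev_prev]), S.next_prev]
  · refine ⟨S.next x, ?_, ?_⟩
    · push Not at h
      refine ⟨?_, h⟩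
      have := (S.sameVertex_next x).symm
      exact hx.1.imp this.trans this.trans
    · rw [loopSide, if_neg, S.prev_next]
      rw [S.prev_next]
      rintro (rfl | rfl)
      exacts [hx.2.2 rfl, hx.2.1 (S.opp_opp e)]

open Classical in
/-- The number of crossing points after the loop around the edge `e` has been added. -/
def encircleCnt (X : Diagram D) (S : TriSurface D) (e x : D) : ℕ :=
  X.cnt x + (if IsSpoke S e x then 1 else 0) + (if IsSpoke S e (S.opp x) then 1 else 0)

open Classical in
/-- The former names of the ports, before the loop around the edge `e` was added. -/
def encirclePort (S : TriSurface D) (e : D) : Port D → Option (Port D)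
  | .point x i =>
      if IsSpoke S e x then (if i = 0 then none else some (.point x (i - 1))) else some (.point x i)
  | .vertex x => some (.vertex x)

/-- The strands of the loop around the edge `e`. -/
def loopStrand (X : Diagram D) (S : TriSurface D) (e : D) (p q : Port D) : Prop :=
  ∃ x, IsSpoke S e x ∧ IsPair (.point x 0)
    (.point (loopSide S e x) (X.encircleCnt S e (loopSide S e x) - 1)) p q

lemma encircle_cnt (X : Diagram D) (e : D) : (X.encircle S e).cnt = X.encircleCnt S e := rfl

lemma encircleCnt_edge (h : X.cnt e = 0) : X.encircleCnt S e e = 0 := by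
  simp [encircleCnt, IsSpoke, h]

lemma encircleCnt_opp (h : X.IsMulticurve S) (x : D) :
    X.encircleCnt S e (S.opp x) = X.encircleCnt S e x := by
  unfold encircleCnt
  rw [S.opp_opp, h.cnt_opp]; omega

lemma encirclePort_dart {p q : Port D} (h : encirclePort S e p = some q) : q.dart = p.dart := by
  cases p <;> simp only [encirclePort] at h <;> grind [Port.dart]

/-- The two kinds of strands of the loop in a uniform description. -/
lemma encircle_joined (hS : S.Simple) (h : X.IsMulticurve S) (p q : Port D) :
    (X.encircle S e).joined p q ↔
      X.renamed (X.encircleCnt S e) (encirclePort S e) p q ∨ X.loopStrand S e p q := by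
  classical
  refine or_congr ?_ ?_
  · constructor
    · rintro ⟨p₀, q₀, rfl, rfl, hj⟩
      refine ⟨?_, ?_, p₀, q₀, ?_, ?_, hj⟩
      · have := h.valid _ _ hj
        cases p₀ <;> simp_all [Port.Valid, encircleCnt]; omega
      · have := h.valid _ _ (h.symm _ _ hj)
        cases q₀ <;> simp_all [Port.Valid, encircleCnt]; omega
      · cases p₀ <;> simp only [encirclePort]
        split_ifs <;> simp_all
      · cases q₀ <;> simp only [encirclePort]
        split_ifs <;> simp_all
    · rintro ⟨-, -, p₀, q₀, hp, hq, hj⟩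
      refine ⟨p₀, q₀, ?_, ?_, hj⟩
      · cases p <;> simp only [encirclePort] at hp <;> grind
      · cases q <;> simp only [encirclePort] at hq <;> grind
  · constructor
    · rintro (⟨c, hc, hc', hp⟩ | ⟨d, hd, hp⟩)
      · refine ⟨c, hc, ?_⟩
        rw [loopSide, if_neg]
        · exact hp
        · rintro (h' | h')
          · rw [h'] at hc'; exact hc'.2.2 rfl
          · rw [h', S.opp_opp] at hc'; exact hc'.2.1 rfl
      · refine ⟨_, IsSpoke.next hS hd, ?_⟩
        rw [loopSide, S.prev_next, if_pos hd]
        exact hp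
    · rintro ⟨x, hx, hp⟩
      have hx' := hx.loopSide hS
      unfold loopSide at hp hx'
      split_ifs at hp hx' with h'
      · refine Or.inr ⟨S.prev x, h', ?_⟩
        rw [S.next_prev, S.prev_prev]
        exact hp
      · exact Or.inl ⟨x, hx, hx', hp⟩

/-- A multicurve that contains the edge `e` has no ends at the corners at its endpoints. -/
lemma IsMulticurve.not_hasEnd_of_comp (h : X.IsMulticurve S) (he : e ∈ X.comps)
    (hx : S.SameVertex x e ∨ S.SameVertex x (S.opp e)) : ¬ X.HasEnd x := fun h' =>
  hx.elim (fun hx => h.end_comp hx h' he) (fun hx => h.end_comp hx h' (h.comps_opp _ he))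

lemma encircle_planar (hS : S.Simple) (h : X.IsMulticurve S) (he : e ∈ X.comps) :
    Planar S (X.encircle S e).joined := by
  classical
  have P1 : Planar S (X.renamed (X.encircleCnt S e) (encirclePort S e)) := by
    refine h.planar.renamed ?_ ?_ ?_
    · intro p p' r hp hp' h1 h2
      cases p <;> cases p' <;> simp only [encirclePort] at h1 h2 <;> grind
    · intro p r hp h1
      rw [encirclePort_dart h1]; exact .rfl
    · intro b
      refine ⟨b, .rfl, ?_⟩
      rintro p q r s p' q' hp hq h1 h2 - - hpq
      cases p <;> cases q <;> simp only [encirclePort] at h1 h2 <;> simp only [Before] at * <;>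
        grind [Port.dart, Port.rank]
  have hpos : ∀ x, IsSpoke S e x → 0 < X.encircleCnt S e (loopSide S e x) ∧
      X.encircleCnt S e (loopSide S e x) = X.cnt (loopSide S e x) + 1 ∧
      ¬ IsSpoke S e (loopSide S e x) := by
    intro x hx
    have h1 := hx.loopSide hS
    have h2 := h1.not_opp hS
    rw [S.opp_opp] at h2
    simp [encircleCnt, h1, h2]
  have hsymm : ∀ p q, X.loopStrand S e p q → X.loopStrand S e q p := by
    rintro p q ⟨x, hx, hp⟩
    exact ⟨x, hx, isPair_symm hp⟩
  have hK : ∀ p q, X.loopStrand S e p q → p.Valid (X.encircleCnt S e) := by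
    rintro p q ⟨x, hx, ⟨rfl, rfl⟩ | ⟨rfl, rfl⟩⟩
    · simp [Port.Valid, encircleCnt, hx]
    · have := hpos x hx
      simp only [Port.Valid]; omega
  have hfun : (X.encircle S e).joined = fun p q =>
      X.renamed (X.encircleCnt S e) (encirclePort S e) p q ∨ X.loopStrand S e p q := by
    funext p q
    exact propext (encircle_joined hS h p q)
  rw [hfun]
  refine P1.add hsymm ?_ ?_ ?_
  · rintro p q q' ⟨x, hx, h1⟩ ⟨y, hy, h2⟩
    have := loopSide_inj hx hy
    have := hpos x hx
    have := hpos y hy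
    unfold IsPair at h1 h2
    grind
  · rintro p q q' ⟨x, hx, h1⟩ ⟨hp, -, p₀, q₀, h2, h3, hj⟩
    have := hpos x hx
    have hv := h.valid _ _ hj
    rcases h1 with ⟨rfl, rfl⟩ | ⟨rfl, rfl⟩
    · simp [encirclePort, hx] at h2
    · simp only [encirclePort, this.2.2, if_false, Option.some.injEq] at h2
      subst h2
      simp only [Port.Valid] at hv
      omega
  · rintro p q ⟨x, hx, hpq⟩
    obtain ⟨c1, c2, c3⟩ := hpos x hx
    have hxx : loopSide S e x ≠ x := fun h' => c3 (by rwa [h'])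
    -- no strand ends between the two points where the loop leaves the triangle
    have hr : ∀ r s, (X.renamed (X.encircleCnt S e) (encirclePort S e) r s ∨
        X.loopStrand S e r s) → r.Valid (X.encircleCnt S e) ∧
          ∀ y, r = .vertex y → ¬ (S.SameVertex y e ∨ S.SameVertex y (S.opp e)) := by
      rintro r s (hrs | hrs)
      · refine ⟨hrs.1, ?_⟩
        rintro y rfl hy
        obtain ⟨-, -, r₀, s₀, h1, -, hj⟩ := hrs
        simp only [encirclePort, Option.some.injEq] at h1
        subst h1
        exact h.not_hasEnd_of_comp he hy ⟨_, hj⟩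
      · refine ⟨hK _ _ hrs, ?_⟩
        rintro y rfl
        obtain ⟨z, hz, hp | hp⟩ := hrs <;> simp at hp
    have hadj : ∀ r s, (X.renamed (X.encircleCnt S e) (encirclePort S e) r s ∨
        X.loopStrand S e r s) →
        ¬ (Before S (loopSide S e x) (.point x 0) r ∧ Before S (loopSide S e x) r
          (.point (loopSide S e x) (X.encircleCnt S e (loopSide S e x) - 1))) ∧
        ¬ (Before S (loopSide S e x)
          (.point (loopSide S e x) (X.encircleCnt S e (loopSide S e x) - 1)) r ∧
            Before S (loopSide S e x) r (.point x 0)) := by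
      intro r s hrs
      obtain ⟨hv, hv'⟩ := hr r s hrs
      have n1 := S.next_ne x; have n2 := S.prev_ne x; have n3 := S.next_ne_prev x
      have v1 := hx.1
      unfold loopSide at c1 c2 hxx ⊢
      split_ifs at * with h'
      · have v2 : X.encircleCnt S e (S.prev x) = 0 := by
          have := encircleCnt_edge (S := S) (h.comps_cnt _ he)
          rcases h' with h' | h'
          · rwa [h']
          · rwa [h', encircleCnt_opp h]
        have v3 : S.SameVertex (S.prev x) e ∨ S.SameVertex (S.prev x) (S.opp e) := by
          rcases h' with h' | h' <;> rw [h']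
          exacts [Or.inl .rfl, Or.inr .rfl]
        simp only [Before, S.next_next, S.prev_next]
        clear hrs hr hK hsymm hpos P1 hfun
        cases r with
        | point y j =>
          simp only [Port.Valid] at hv
          simp only [Port.dart, Port.rank]
          grind
        | vertex y =>
          have := hv' y rfl
          simp only [Port.dart, Port.rank]
          grind
      · simp only [Before, S.next_prev, S.prev_prev]
        clear hrs hr hK hsymm hpos P1 hfun
        cases r with
        | point y j =>
          simp only [Port.Valid] at hv
          simp only [Port.dart, Port.rank]
          grind
        | vertex y =>
          have := hv' y rfl
          simp only [Port.dart, Port.rank]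
          grind
    have t1 : S.InTri (loopSide S e x) x := by
      unfold loopSide
      split_ifs
      · exact (S.inTri_next x).symm
      · exact (S.inTri_prev x).symm
    rcases hpq with ⟨rfl, rfl⟩ | ⟨rfl, rfl⟩
    · exact ⟨by simp [hxx.symm], _, t1, .rfl, fun r s hrs => hadj r s hrs⟩
    · exact ⟨by simp [hxx], _, .rfl, t1, fun r s hrs => (hadj r s hrs).symm⟩

lemma encircle_symm (h : X.IsMulticurve S) {p q : Port D} (hpq : (X.encircle S e).joined p q) :
    (X.encircle S e).joined q p := by
  rcases hpq with ⟨p₀, q₀, h1, h2, hj⟩ | ⟨c, h1, h2, h3⟩ | ⟨d, h1, h2⟩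
  · exact Or.inl ⟨q₀, p₀, h2, h1, h.symm _ _ hj⟩
  · exact Or.inr (Or.inl ⟨c, h1, h2, isPair_symm h3⟩)
  · exact Or.inr (Or.inr ⟨d, h1, isPair_symm h2⟩)

lemma encircle_hasEnd (hS : S.Simple) (h : X.IsMulticurve S) (x : D) :
    (X.encircle S e).HasEnd x ↔ X.HasEnd x := by
  classical
  constructor
  · rintro ⟨q, hq⟩
    rcases (encircle_joined hS h _ _).1 hq with ⟨-, -, p₀, q₀, h1, -, hj⟩ | ⟨y, -, hp | hp⟩
    · simp only [encirclePort, Option.some.injEq] at h1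
      subst h1
      exact ⟨_, hj⟩
    · simp at hp
    · simp at hp
  · rintro ⟨q, hq⟩
    exact ⟨_, Or.inl ⟨.vertex x, q, rfl, rfl, hq⟩⟩

lemma IsMulticurve.not_spoke_of_comp (h : X.IsMulticurve S) (he : e ∈ X.comps) (hx : x ∈ X.comps) :
    ¬ IsSpoke S e x := fun hs => hs.1.elim (fun h' => hs.2.1 (h.comp_unique _ _ h' hx he))
  (fun h' => hs.2.2 (h.comp_unique _ _ h' hx (h.comps_opp _ he)))

lemma encircle_isMulticurve (hS : S.Simple) (h : X.IsMulticurve S) (he : e ∈ X.comps) :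
    (X.encircle S e).IsMulticurve S := by
  classical
  refine IsMulticurve.of_planar (encircle_planar hS h he) (encircleCnt_opp h) ?_ ?_ ?_ ?_ ?_ ?_ ?_
  · rintro p q hpq
    rcases (encircle_joined hS h _ _).1 hpq with hj | ⟨x, hx, ⟨rfl, -⟩ | ⟨rfl, -⟩⟩
    · exact hj.1
    · simp [Port.Valid, encircle_cnt, encircleCnt, hx]
    · have := hx.loopSide hS
      simp [Port.Valid, encircle_cnt, encircleCnt, this]
  · intro d i hi
    rw [encircle_cnt] at hi
    -- an old crossing point
    have hold : ∀ j, j < X.cnt d → encirclePort S e (.point d i) = some (.point d j) →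
        ∃ q, (X.encircle S e).joined (.point d i) q := by
      intro j hj hp
      obtain ⟨q, hq⟩ := h.full hj
      refine ⟨_, Or.inl ⟨.point d j, q, ?_, rfl, hq⟩⟩
      simp only [encirclePort] at hp
      grind
    have hx := fun hd : IsSpoke S e d => hd.not_opp hS
    by_cases hd : IsSpoke S e d
    · by_cases hi0 : i = 0
      · subst hi0
        exact ⟨_, (encircle_joined hS h _ _).2 (Or.inr ⟨d, hd, Or.inl ⟨rfl, rfl⟩⟩)⟩
      · refine hold (i - 1) ?_ (by simp [encirclePort, hd, hi0])
        simp only [encircleCnt, hd, hx hd, if_true, if_false] at hi; omega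
    · by_cases hd' : IsSpoke S e (S.opp d)
      · by_cases hi0 : i = X.cnt d
        · obtain ⟨y, hy, rfl⟩ := exists_loopSide hS hd'
          refine ⟨_, (encircle_joined hS h _ _).2 (Or.inr ⟨y, hy, Or.inr ⟨?_, rfl⟩⟩)⟩
          simp [encircleCnt, hd, hd', hi0]
        · refine hold i ?_ (by simp [encirclePort, hd])
          simp only [encircleCnt, hd, hd', if_true, if_false] at hi; omega
      · refine hold i ?_ (by simp [encirclePort, hd])
        simpa only [encircleCnt, hd, hd', if_false, add_zero] using hi
  · exact fun d hd => comps_sdiff_opp h.proper hd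
  · intro d hd
    have h1 := h.not_spoke_of_comp he hd.1
    have h2 := h.not_spoke_of_comp he (h.comps_opp _ hd.1)
    simp [encircle_cnt, encircleCnt, h1, h2, h.comps_cnt _ hd.1]
  · intro c c' hc h1 h2
    rw [encircle_hasEnd hS h] at h1 h2
    exact h.ends hc h1 h2
  · intro c f hc h1 h2
    rw [encircle_hasEnd hS h] at h1
    exact h.end_comp hc h1 h2.1
  · exact fun f f' hf h1 h2 => h.comp_unique f f' hf h1.1 h2.1

lemma encircle_noTurnBacks (hS : S.Simple) (h : X.IsReduced S) :
    (X.encircle S e).NoTurnBacks S := by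
  classical
  constructor
  · intro d i j hj
    rcases (encircle_joined hS h.multicurve _ _).1 hj with
      ⟨-, -, p₀, q₀, h1, h2, hj⟩ | ⟨x, hx, hp⟩
    · have := h.noTurnBacks.side d
      simp only [encirclePort] at h1 h2
      grind
    · have := hx.loopSide hS
      have := hx.not_opp hS
      unfold IsPair at hp
      grind
  · intro c q hj
    rcases (encircle_joined hS h.multicurve _ _).1 hj with
      ⟨-, -, p₀, q₀, h1, h2, hj⟩ | ⟨x, hx, hp⟩
    · simp only [encirclePort, Option.some.injEq] at h1
      subst h1
      obtain ⟨i, rfl⟩ := h.noTurnBacks.vertex _ _ hj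
      have := encirclePort_dart h2
      cases q with
      | point y j => exact ⟨j, by simp only [Port.dart] at this; rw [this]⟩
      | vertex y => simp [encirclePort] at h2
    · unfold IsPair at hp
      simp at hp

/-- The crossing point number `i` with the side `x` lies on the loop around the edge `e`. -/
def IsLoopPoint (X : Diagram D) (S : TriSurface D) (e x : D) (i : ℕ) : Prop :=
  (IsSpoke S e x ∧ i = 0) ∨ (IsSpoke S e (S.opp x) ∧ i = X.cnt x)

lemma isLoopPoint_opp (hS : S.Simple) (h : X.IsMulticurve S) {i : ℕ}
    (hi : i < X.encircleCnt S e x) :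
    X.IsLoopPoint S e (S.opp x) (X.encircleCnt S e x - 1 - i) ↔ X.IsLoopPoint S e x i := by
  have h1 : IsSpoke S e x → ¬ IsSpoke S e (S.opp x) := fun h => h.not_opp hS
  unfold IsLoopPoint encircleCnt at *
  rw [S.opp_opp, h.cnt_opp]
  by_cases a : IsSpoke S e x <;> by_cases b : IsSpoke S e (S.opp x) <;> simp [a, b] at * <;> omega

/-- A strand of the new multicurve belongs to the loop if one of its crossing points does. -/
lemma loopStrand_iff (hS : S.Simple) (h : X.IsMulticurve S) {i : ℕ} {q : Port D}
    (hj : (X.encircle S e).joined (.point x i) q) :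
    X.loopStrand S e (.point x i) q ↔ X.IsLoopPoint S e x i := by
  classical
  have hcnt : ∀ y, IsSpoke S e y →
      X.encircleCnt S e (loopSide S e y) - 1 = X.cnt (loopSide S e y) := by
    intro y hy
    have h1 := hy.loopSide hS
    have h2 := h1.not_opp hS
    rw [S.opp_opp] at h2
    simp [encircleCnt, h1, h2]
  constructor
  · rintro ⟨y, hy, ⟨h1, -⟩ | ⟨h1, -⟩⟩ <;> rw [Port.point.injEq] at h1 <;> obtain ⟨rfl, rfl⟩ := h1
    · exact Or.inl ⟨hy, rfl⟩
    · exact Or.inr ⟨hy.loopSide hS, hcnt y hy⟩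
  · intro hl
    rcases (encircle_joined hS h _ _).1 hj with ⟨-, -, p₀, q₀, h1, h2, hj⟩ | hl
    · exfalso
      have hv := h.valid _ _ hj
      rcases hl with ⟨a, rfl⟩ | ⟨a, rfl⟩
      · simp [encirclePort, a] at h1
      · have b := a.not_opp hS
        rw [S.opp_opp] at b
        simp only [encirclePort, b, if_false, Option.some.injEq] at h1
        subst h1
        simp [Port.Valid] at hv
    · exact hl

/-- A corner that the loop around `e` cuts off is either at an endpoint of `e`, or it is opposite to
`e` in one of the two triangles at `e`. -/
lemma loopStrand_corner (hS : S.Simple) {i j : ℕ}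
    (h : X.loopStrand S e (.point (S.opp x) i) (.point (S.rot x) j)) :
    IsSpoke S e x ∨ S.prev (S.opp x) = e ∨ S.prev (S.opp x) = S.opp e := by
  obtain ⟨y, hy, ⟨h1, h2⟩ | ⟨h1, h2⟩⟩ := h <;> rw [Port.point.injEq] at h1 h2 <;>
    obtain ⟨h1, -⟩ := h1 <;> obtain ⟨h2, -⟩ := h2
  · subst h1
    unfold loopSide at h2
    split_ifs at h2 with h'
    · exact Or.inr h'
    · exact absurd h2 (S.next_ne_prev _)
  · have := hy.loopSide hS
    rw [← h1, S.opp_opp] at this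
    exact Or.inl this

/-- A property that is invariant under a permutation is constant on its cycles. -/
lemma _root_.TriSurface.sameCycle_iff {f : Equiv.Perm D} {P : D → Prop} (h : ∀ x, P (f x) ↔ P x)
    {a b : D} (hab : f.SameCycle a b) : P a ↔ P b := by
  obtain ⟨n, rfl⟩ := hab
  induction n using Int.induction_on with
  | zero => simp
  | succ n ih => rw [add_comm, zpow_add, zpow_one, Equiv.Perm.mul_apply, h]; exact ih
  | pred n ih =>
    rw [ih, ← h ((f ^ (-(n : ℤ) - 1)) a), ← Equiv.Perm.mul_apply, ← zpow_one_add]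
    simp

/-- If the loop around `e` contains a puncture loop, then at the vertex of this puncture loop there
are only the two triangles at `e`. -/
lemma encircle_corner_of_loop (hS : S.Simple) (h : X.IsReduced S) {u : D}
    (hu : (X.encircle S e).HasPunctureLoop S u) {c : D} (hcu : S.SameVertex c u) :
    S.prev (S.opp c) = e ∨ S.prev (S.opp c) = S.opp e := by
  classical
  have hM := h.multicurve
  obtain ⟨i, hi⟩ := hu
  have hsymm : ∀ p q, X.loopStrand S e p q → X.loopStrand S e q p := by
    rintro p q ⟨x, hx, hp⟩
    exact ⟨x, hx, isPair_symm hp⟩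
  have hiff : ∀ c, S.SameVertex c u →
      (X.loopStrand S e (.point (S.opp c) (X.encircleCnt S e c - 1 - i c))
        (.point (S.rot c) (i (S.rot c))) ↔ X.IsLoopPoint S e c (i c)) := by
    intro c hc
    obtain ⟨h1, h2⟩ := hi c hc
    rw [encircle_cnt] at h1 h2
    rw [← isLoopPoint_opp hS hM h1, ← loopStrand_iff hS hM h2]
  have hrot : ∀ c, S.SameVertex c u →
      (X.IsLoopPoint S e (S.rot c) (i (S.rot c)) ↔ X.IsLoopPoint S e c (i c)) := by
    intro c hc
    obtain ⟨h1, h2⟩ := hi c hc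
    rw [← hiff c hc, ← loopStrand_iff hS hM (encircle_symm hM h2)]
    exact ⟨hsymm _ _, hsymm _ _⟩
  have hall : ∀ c, S.SameVertex c u → (X.IsLoopPoint S e c (i c) ↔ X.IsLoopPoint S e u (i u)) := by
    intro c hc
    have hv : ∀ x, S.SameVertex (S.rot x) u ↔ S.SameVertex x u := fun x =>
      ⟨(S.sameVertex_rot x).trans, (S.sameVertex_rot x).symm.trans⟩
    have := TriSurface.sameCycle_iff (f := S.rot)
      (P := fun x => S.SameVertex x u ∧ X.IsLoopPoint S e x (i x)) (fun x => by
        rw [hv]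
        exact and_congr_right (hrot x)) hc
    exact ⟨fun h' => (this.1 ⟨hc, h'⟩).2, fun h' => (this.2 ⟨.refl _ _, h'⟩).2⟩
  by_cases hl : X.IsLoopPoint S e u (i u)
  · rcases loopStrand_corner hS ((hiff c hcu).2 ((hall c hcu).2 hl)) with hc | hc
    · -- the loop does not cross `e`
      exfalso
      obtain ⟨f, hf, hfu⟩ : ∃ f, (f = e ∨ f = S.opp e) ∧ S.SameVertex f u :=
        hc.1.elim (fun h' => ⟨e, Or.inl rfl, h'.symm.trans hcu⟩)
          (fun h' => ⟨S.opp e, Or.inr rfl, h'.symm.trans hcu⟩)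
      rcases (hall f hfu).2 hl with ⟨h', -⟩ | ⟨h', -⟩
      · exact hf.elim h'.2.1 h'.2.2
      · rcases hf with rfl | rfl
        exacts [h'.2.2 rfl, h'.2.1 (S.opp_opp e)]
    · exact hc
  · -- the puncture loop was already there before
    exfalso
    refine h.no_puncture_loop u ⟨fun c => if IsSpoke S e c then i c - 1 else i c, fun c hc => ?_⟩
    obtain ⟨h1, h2⟩ := hi c hc
    have n1 := (not_congr (hall c hc)).2 hl
    have n2 := (not_congr (hall _ ((S.sameVertex_rot c).symm.trans hc))).2 hl
    have n3 : ¬ X.loopStrand S e (.point (S.opp c) (X.encircleCnt S e c - 1 - i c))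
        (.point (S.rot c) (i (S.rot c))) := fun h' => n1 ((hiff c hc).1 h')
    rcases (encircle_joined hS hM _ _).1 h2 with ⟨-, -, p₀, q₀, h3, h4, hj⟩ | h3
    swap
    · exact absurd h3 n3
    have hoc : IsSpoke S e c → ¬ IsSpoke S e (S.opp c) := fun h' => h'.not_opp hS
    have hco := hM.cnt_opp c
    rw [encircle_cnt] at h1 h3
    unfold IsLoopPoint at n1 n2
    unfold encircleCnt at h1 h3
    have e2 : q₀ = .point (S.rot c) (if IsSpoke S e (S.rot c) then i (S.rot c) - 1
        else i (S.rot c)) := by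
      simp only [encirclePort] at h4
      grind
    have e1 : i c - (if IsSpoke S e c then 1 else 0) < X.cnt c ∧ p₀ = .point (S.opp c)
        (X.cnt c - 1 - (if IsSpoke S e c then i c - 1 else i c)) := by
      simp only [encirclePort] at h3
      by_cases a : IsSpoke S e c
      · have b := hoc a
        simp only [a, b, if_true, if_false] at *
        grind
      · by_cases b : IsSpoke S e (S.opp c)
        · simp only [a, b, if_true, if_false] at *
          grind
        · simp only [a, b, if_true, if_false] at *
          grind
    obtain ⟨e1, rfl⟩ := e1
    subst e2
    refine ⟨?_, hj⟩
    dsimp only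
    split_ifs at e1 ⊢ <;> omega

end Diagram

namespace TriSurface

variable {D : Type*} {S : TriSurface D} {f : D}

lemma card_quotient_eq_two {s : Setoid D} {a b : D} (h : ∀ d, s d a ∨ s d b) (hab : ¬ s a b) :
    Nat.card (Quotient s) = 2 := by
  rw [← Nat.card_fin 2]
  refine (Nat.card_eq_of_bijective ![Quotient.mk s a, Quotient.mk s b] ⟨?_, ?_⟩).symm
  · intro i j hij
    have hab' : ¬ s b a := fun h => hab (s.symm h)
    fin_cases i <;> fin_cases j <;> simp_all [Quotient.eq]
  · intro q
    induction q using Quotient.inductionOn with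
    | h d =>
      rcases h d with h | h
      exacts [⟨0, (Quotient.sound h).symm⟩, ⟨1, (Quotient.sound h).symm⟩]

lemma card_quotient_eq_three {s : Setoid D} {a b c : D} (h : ∀ d, s d a ∨ s d b ∨ s d c)
    (hab : ¬ s a b) (hac : ¬ s a c) (hbc : ¬ s b c) : Nat.card (Quotient s) = 3 := by
  rw [← Nat.card_fin 3]
  refine (Nat.card_eq_of_bijective ![Quotient.mk s a, Quotient.mk s b, Quotient.mk s c]
    ⟨?_, ?_⟩).symm
  · intro i j hij
    have hab' : ¬ s b a := fun h => hab (s.symm h)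
    have hac' : ¬ s c a := fun h => hac (s.symm h)
    have hbc' : ¬ s c b := fun h => hbc (s.symm h)
    fin_cases i <;> fin_cases j <;> simp_all [Quotient.eq]
  · intro q
    induction q using Quotient.inductionOn with
    | h d =>
      rcases h d with h | h | h
      exacts [⟨0, (Quotient.sound h).symm⟩, ⟨1, (Quotient.sound h).symm⟩,
        ⟨2, (Quotient.sound h).symm⟩]

/-- Two triangles with all three sides in common form a sphere with three vertices. -/
lemma Simple.three_punctured_sphere (hS : S.Simple) (h1 : S.opp (S.prev f) = S.next (S.opp f))
    (h2 : S.opp (S.next f) = S.prev (S.opp f)) : S.eulerChar = 2 ∧ Nat.card S.Vertex = 3 := by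
  have oo := S.opp_opp
  have h1' : S.opp (S.next (S.opp f)) = S.prev f := by rw [← h1, oo]
  have h2' : S.opp (S.prev (S.opp f)) = S.next f := by rw [← h2, oo]
  have hall : ∀ d, S.InTri f d ∨ S.InTri (S.opp f) d := by
    intro d
    obtain ⟨g, hg, rfl⟩ := S.connected f d
    have key : ∀ g ∈ Subgroup.closure ({S.next, S.opp} : Set (Equiv.Perm D)), ∀ x,
        (S.InTri f (g x) ∨ S.InTri (S.opp f) (g x)) ↔ (S.InTri f x ∨ S.InTri (S.opp f) x) := by
      intro g hg
      induction hg using Subgroup.closure_induction with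
      | mem g hg =>
        intro x
        rcases hg with rfl | rfl
        · have : ∀ b, S.InTri b (S.next x) ↔ S.InTri b x := fun b =>
            ⟨fun h => h.trans (S.inTri_next x).symm, fun h => h.trans (S.inTri_next x)⟩
          rw [this, this]
        · have key : ∀ x, (S.InTri f x ∨ S.InTri (S.opp f) x) →
              (S.InTri f (S.opp x) ∨ S.InTri (S.opp f) (S.opp x)) := by
            rintro x ((rfl | rfl | rfl) | (rfl | rfl | rfl)) <;>
              simp [InTri, h1, h2, h1', h2', oo]
          refine ⟨fun h => ?_, key x⟩
          have := key _ h
          rwa [oo] at this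
      | one => intro x; rfl
      | mul g g' _ _ hg hg' => intro x; rw [Equiv.Perm.mul_apply, hg, hg']
      | inv g _ hg => intro x; rw [← hg (g⁻¹ x)]; simp
    exact (key g hg f).2 (Or.inl .rfl)
  have v1 : S.SameVertex f (S.next (S.opp f)) := S.sameVertex_rot f
  have v2 : S.SameVertex (S.opp f) (S.next f) := S.sameVertex_next f
  have v3 : S.SameVertex (S.prev f) (S.prev (S.opp f)) := by
    have := S.sameVertex_rot (S.prev f)
    rwa [S.rot_eq, h1, S.next_next] at this
  have hV : Nat.card S.Vertex = 3 := by
    refine card_quotient_eq_three (a := f) (b := S.next f) (c := S.prev f) ?_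
      (hS.no_one_cycle f) (hS.not_sameVertex_prev f) (hS.not_sameVertex_next_prev f)
    intro d
    rcases hall d with (rfl | rfl | rfl) | (rfl | rfl | rfl)
    exacts [Or.inl .rfl, Or.inr (Or.inl .rfl), Or.inr (Or.inr .rfl), Or.inr (Or.inl v2),
      Or.inl v1.symm, Or.inr (Or.inr v3.symm)]
  have hE : Nat.card S.Edge = 3 := by
    have hopp : ∀ a b, S.opp.SameCycle a b → b = a ∨ b = S.opp a := fun a b hab =>
      (sameCycle_iff (P := fun x => x = a ∨ x = S.opp a) (fun x => by
        have := S.opp_inj (a := x) (b := a)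
        have := S.eq_opp_iff (a := x) (b := a)
        grind) hab).1 (Or.inl rfl)
    have hso : ∀ a, S.opp.SameCycle (S.opp a) a := fun a => ⟨1, by simp [oo]⟩
    refine card_quotient_eq_three (a := f) (b := S.next f) (c := S.prev f) ?_ (fun h => ?_)
      (fun h => ?_) (fun h => ?_)
    · intro d
      rcases hall d with (rfl | rfl | rfl) | (rfl | rfl | rfl)
      · exact Or.inl (.refl _ _)
      · exact Or.inr (Or.inl (.refl _ _))
      · exact Or.inr (Or.inr (.refl _ _))
      · exact Or.inl (hso f)
      · rw [← h1]; exact Or.inr (Or.inr (hso _))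
      · rw [← h2]; exact Or.inr (Or.inl (hso _))
    · exact (hopp _ _ h).elim (S.next_ne f) (hS.opp_ne_next f).symm
    · exact (hopp _ _ h).elim (S.prev_ne f) (hS.opp_ne_prev f).symm
    · exact (hopp _ _ h).elim (S.next_ne_prev f).symm (hS.opp_ne_next (S.next f)).symm
  have hT : Nat.card S.Triangle = 2 := by
    have hnext : ∀ a b, S.next.SameCycle a b → S.InTri a b := fun a b hab =>
      (sameCycle_iff (P := fun x => S.InTri a x) (fun x =>
        ⟨fun h => h.trans (S.inTri_next x).symm, fun h => h.trans (S.inTri_next x)⟩) hab).1 .rfl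
    have hsn : ∀ a b, S.InTri a b → S.next.SameCycle b a := by
      rintro a b (rfl | rfl | rfl)
      · exact .refl _ _
      · exact Equiv.Perm.SameCycle.symm ⟨1, by simp⟩
      · exact ⟨1, by simp⟩
    refine card_quotient_eq_two (a := f) (b := S.opp f) ?_
      (fun h => hS.not_inTri_opp f (hnext _ _ h))
    exact fun d => (hall d).imp (hsn _ _) (hsn _ _)
  refine ⟨?_, hV⟩
  rw [eulerChar, hV, hE, hT]
  norm_num

end TriSurface

namespace Diagram

variable {D : Type*} {S : TriSurface D} {X Y : Diagram D} {e x y : D}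

/-- Replacing the edge `e` by the loop around it gives a reduced multicurve.  Here the exclusion of the
three-punctured sphere is needed, where this loop is also the loop around the third puncture. -/
theorem encircle_isReduced (hS : S.LocallyPlanar) (h : X.IsReduced S) (he : e ∈ X.comps) :
    (X.encircle S e).IsReduced S := by
  refine ⟨encircle_isMulticurve hS.simple h.multicurve he, encircle_noTurnBacks hS.simple h,
    fun u hu => hS.not_three_punctured_sphere ?_⟩
  -- the puncture loop is at a vertex `u` with two edges, which are opposite to `e` in its two triangles
  have hv := fun c => encircle_corner_of_loop hS.simple h hu (c := c)
  have r1 := S.sameVertex_rot u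
  have r2 := S.sameVertex_rot (S.rot u)
  have q0 := hv u .rfl
  have q1 := hv _ r1.symm
  have q2 := hv _ (r1.trans r2).symm
  have hne := hS.simple.rot_ne u
  have hne' := hS.simple.rot_ne (S.rot u)
  have oo := S.opp_opp e
  obtain ⟨f, hf, hfo⟩ : ∃ f, S.prev (S.opp u) = f ∧ S.prev (S.opp (S.rot u)) = S.opp f := by
    have : S.prev (S.opp (S.rot u)) ≠ S.prev (S.opp u) := fun h' => hne (S.opp_inj.1 (by
      rw [← S.next_prev (S.opp (S.rot u)), h', S.next_prev]))
    refine ⟨_, rfl, ?_⟩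
    grind
  have hff : S.prev (S.opp (S.rot (S.rot u))) = f := by
    have : S.prev (S.opp (S.rot (S.rot u))) ≠ S.prev (S.opp (S.rot u)) := fun h' =>
      hne' (S.opp_inj.1 (by
        rw [← S.next_prev (S.opp (S.rot (S.rot u))), h', S.next_prev]))
    have := S.opp_ne f
    grind
  have a0 : S.opp u = S.next f := by rw [← hf, S.next_prev]
  have a1 : S.opp (S.rot u) = S.next (S.opp f) := by rw [← hfo, S.next_prev]
  have a2 : S.opp (S.rot (S.rot u)) = S.next f := by rw [← hff, S.next_prev]
  rw [S.rot_eq, a1, S.next_next] at a2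
  rw [S.rot_eq, a0, S.next_next] at a1
  exact hS.simple.three_punctured_sphere a1 (by rw [← a2, S.opp_opp])

/-- Once the component `e` is gone, no arc ends at the endpoints of `e`. -/
lemma not_endsAt_sdiff (h : X.IsMulticurve S) (he : e ∈ X.comps)
    (hY : ∀ x, Y.HasEnd x → X.HasEnd x) (hc : Y.comps = X.comps \ {e, S.opp e}) {d : D}
    (hd : d = e ∨ d = S.opp e) : ¬ Y.EndsAt S d := by
  have hd' : d ∈ X.comps := by
    rcases hd with rfl | rfl
    exacts [he, h.comps_opp _ he]
  rintro ⟨c, hcd, hx | hx⟩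
  · exact h.end_comp hcd (hY _ hx) hd'
  · rw [hc] at hx
    obtain rfl := h.comp_unique _ _ hcd hx.1 hd'
    exact hx.2 hd

lemma encircle_inj (hS : S.Simple) (hX : X.IsMulticurve S) (hY : Y.IsMulticurve S)
    (heX : e ∈ X.comps) (heY : e ∈ Y.comps) (h : X.encircle S e = Y.encircle S e) : X = Y := by
  classical
  have hle : ∀ {X Y : Diagram D}, X.IsMulticurve S → Y.IsMulticurve S →
      X.encircle S e = Y.encircle S e → ∀ p q, X.joined p q → Y.joined p q := by
    intro X Y hX hY h p q hpq
    let rename : Port D → Port D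
      | .point x i => .point x (i + if IsSpoke S e x then 1 else 0)
      | .vertex x => .vertex x
    have hj : (X.encircle S e).joined (rename p) (rename q) := Or.inl ⟨p, q, rfl, rfl, hpq⟩
    rw [h] at hj
    have hcnt : X.cnt = Y.cnt := by
      funext x
      have := congrFun (congrArg Diagram.cnt h) x
      rw [encircle_cnt, encircle_cnt] at this
      unfold encircleCnt at this
      omega
    have hren : ∀ p, encirclePort S e (rename p) = some p := by
      rintro (_ | _) <;> simp only [encirclePort, rename]
      grind
    rcases (encircle_joined hS hY _ _).1 hj with ⟨-, -, p₀, q₀, h1, h2, hj⟩ | ⟨x, hx, hp⟩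
    · rw [hren] at h1 h2
      obtain rfl := Option.some.inj h1
      obtain rfl := Option.some.inj h2
      exact hj
    · exfalso
      have key : ∀ p, rename p ≠ .point x 0 := by
        intro p
        cases p <;> simp only [rename] <;> grind
      unfold IsPair at hp
      grind
  refine Diagram.ext ?_ ?_ ?_
  · funext x
    have := congrFun (congrArg Diagram.cnt h) x
    rw [encircle_cnt, encircle_cnt] at this
    unfold encircleCnt at this
    omega
  · funext p q
    exact propext ⟨hle hX hY h p q, hle hY hX h.symm p q⟩
  · have := congrArg Diagram.comps h
    have h1 : {e, S.opp e} ⊆ X.comps := by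
      rintro x (rfl | rfl)
      exacts [heX, hX.comps_opp _ heX]
    have h2 : {e, S.opp e} ⊆ Y.comps := by
      rintro x (rfl | rfl)
      exacts [heY, hY.comps_opp _ heY]
    change X.comps \ {e, S.opp e} = Y.comps \ {e, S.opp e} at this
    rw [← Set.sdiff_union_of_subset h1, this, Set.sdiff_union_of_subset h2]

lemma eraseEdge_inj (hX : X.IsMulticurve S) (hY : Y.IsMulticurve S)
    (heX : e ∈ X.comps) (heY : e ∈ Y.comps) (h : X.eraseEdge S e = Y.eraseEdge S e) : X = Y := by
  refine Diagram.ext (congrArg Diagram.cnt h :) (congrArg Diagram.joined h :) ?_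
  have := congrArg Diagram.comps h
  have h1 : {e, S.opp e} ⊆ X.comps := by
    rintro x (rfl | rfl)
    exacts [heX, hX.comps_opp _ heX]
  have h2 : {e, S.opp e} ⊆ Y.comps := by
    rintro x (rfl | rfl)
    exacts [heY, hY.comps_opp _ heY]
  change X.comps \ {e, S.opp e} = Y.comps \ {e, S.opp e} at this
  rw [← Set.sdiff_union_of_subset h1, this, Set.sdiff_union_of_subset h2]

lemma eraseEdge_isReduced (h : X.IsReduced S) : (X.eraseEdge S e).IsReduced S := by
  have hM := h.multicurve
  refine ⟨IsMulticurve.of_planar hM.planar hM.cnt_opp hM.valid (fun _ _ => hM.full)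
    (fun d hd => comps_sdiff_opp hM.proper hd) (fun d hd => hM.comps_cnt d hd.1)
    (fun _ _ => hM.ends) (fun _ _ hc h1 h2 => hM.end_comp hc h1 h2.1)
    (fun f f' hf h1 h2 => hM.comp_unique f f' hf h1.1 h2.1),
    ⟨h.noTurnBacks.side, h.noTurnBacks.vertex⟩, h.no_puncture_loop⟩

end Diagram

namespace Diagram

variable {D : Type*} {S : TriSurface D} {e : D} {α β : Diagram D}

/-! ### The resolution maps -/

lemma addEdge_inj (hα : e ∉ α.comps) (hα' : S.opp e ∉ α.comps) (hβ : e ∉ β.comps)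
    (hβ' : S.opp e ∉ β.comps) (h : α.addEdge S e = β.addEdge S e) : α = β := by
  refine Diagram.ext (congrArg Diagram.cnt h :) (congrArg Diagram.joined h :) ?_
  have := congrArg Diagram.comps h
  change α.comps ∪ {e, S.opp e} = β.comps ∪ {e, S.opp e} at this
  ext x
  have hx := Set.ext_iff.1 this x
  simp only [Set.mem_union, Set.mem_insert_iff, Set.mem_singleton_iff] at hx
  grind

lemma mem_comps_addEdge (α : Diagram D) (S : TriSurface D) (e : D) :
    e ∈ (α.addEdge S e).comps := Or.inr (Or.inl rfl)

lemma IsReduced.opp_not_comps (h : α.IsReduced S) (he : e ∉ α.comps) : S.opp e ∉ α.comps :=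
  fun h' => he (by
    have := h.multicurve.comps_opp _ h'
    rwa [S.opp_opp] at this)

lemma endsAt_of_comp (h : α.IsMulticurve S) (he : e ∈ α.comps) :
    α.EndsAt S e ∧ α.EndsAt S (S.opp e) :=
  ⟨⟨e, .rfl, Or.inr he⟩, ⟨_, .rfl, Or.inr (h.comps_opp _ he)⟩⟩

/-- `β` is the resolution of `α`, in one of the two directions.  `R` is the resolution in the opposite
direction, for multicurves that do not contain the edge, and `L` is the resolution in this direction
of the multicurves that do.  The three cases are those of a multicurve containing the edge, one
disjoint from it, and one that crosses it or shares an endpoint with it; the last conditions tell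
the results apart. -/
structure ResolvesTo (S : TriSurface D) (e : D) (R : Diagram D → Diagram D → Prop)
    (L : Diagram D → Diagram D) (α β : Diagram D) : Prop where
  reduced : β.IsReduced S
  endsAt : β.EndsAt S e ↔ ¬ α.EndsAt S e
  endsAt_opp : β.EndsAt S (S.opp e) ↔ ¬ α.EndsAt S (S.opp e)
  cases : (e ∈ α.comps ∧ β = L α ∧ β.cnt e = 0 ∧ e ∉ β.comps) ∨
    (e ∉ α.comps ∧ ¬ α.EndsAt S e ∧ β = α.addEdge S e) ∨
    (e ∉ α.comps ∧ e ∉ β.comps ∧ R β α ∧ (α.EndsAt S e → α.EndsAt S (S.opp e) → β.cnt e ≠ 0))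

/-- The multicurve can be recovered from its resolution.  If two multicurves had the same resolution in
different cases, they would share different numbers of endpoints with the edge, or one result but not
the other would contain or cross the edge. -/
lemma ResolvesTo.inj {R : Diagram D → Diagram D → Prop} {L : Diagram D → Diagram D}
    (hR : ∀ {α β γ : Diagram D}, α.IsReduced S → e ∉ α.comps → β.IsReduced S → γ.IsReduced S →
      R α β → R α γ → β = γ)
    (hL : ∀ {α β : Diagram D}, α.IsMulticurve S → β.IsMulticurve S → e ∈ α.comps → e ∈ β.comps →
      L α = L β → α = β) {α α' β : Diagram D} (hα : α.IsReduced S) (hα' : α'.IsReduced S)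
    (h : ResolvesTo S e R L α β) (h' : ResolvesTo S e R L α' β) : α = α' := by
  have e1 : α.EndsAt S e ↔ α'.EndsAt S e := not_iff_not.1 (h.endsAt.symm.trans h'.endsAt)
  have e2 : α.EndsAt S (S.opp e) ↔ α'.EndsAt S (S.opp e) :=
    not_iff_not.1 (h.endsAt_opp.symm.trans h'.endsAt_opp)
  have hm := mem_comps_addEdge α S e
  have hm' := mem_comps_addEdge α' S e
  rcases h.cases with ⟨a, b, c, d⟩ | ⟨a, b, c⟩ | ⟨a, b, c, d⟩ <;>
    rcases h'.cases with ⟨a', b', c', d'⟩ | ⟨a', b', c'⟩ | ⟨a', b', c', d'⟩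
  · exact hL hα.multicurve hα'.multicurve a a' (b.symm.trans b')
  · exact absurd (e1.1 (endsAt_of_comp hα.multicurve a).1) b'
  · obtain ⟨k1, k2⟩ := endsAt_of_comp hα.multicurve a
    exact absurd c (d' (e1.1 k1) (e2.1 k2))
  · exact absurd (e1.2 (endsAt_of_comp hα'.multicurve a').1) b
  · exact addEdge_inj a (hα.opp_not_comps a) a' (hα'.opp_not_comps a') (c.symm.trans c')
  · rw [← c] at hm; exact absurd hm b'
  · obtain ⟨k1, k2⟩ := endsAt_of_comp hα'.multicurve a'
    exact absurd c' (d (e1.2 k1) (e2.2 k2))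
  · rw [← c'] at hm'; exact absurd hm' b
  · exact hR h.reduced b hα hα' c c'

open Classical in
/-- A resolution with these properties gives an injective map between the sets of reduced
multicurves. -/
lemma exists_resolution_map {R : Diagram D → Diagram D → Prop} {L : Diagram D → Diagram D}
    {IsRes : Diagram D → Diagram D → Prop}
    (hR : ∀ {α β γ : Diagram D}, α.IsReduced S → e ∉ α.comps → β.IsReduced S → γ.IsReduced S →
      R α β → R α γ → β = γ)
    (hL : ∀ {α β : Diagram D}, α.IsMulticurve S → β.IsMulticurve S → e ∈ α.comps → e ∈ β.comps →
      L α = L β → α = β)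
    (hres : ∀ α : Diagram D, α.IsReduced S → ∃ β, ResolvesTo S e R L α β ∧
      ∀ γ, IsRes α γ ↔ γ = β) (j : ℕ) :
    ∃ P : RMCshare S e j → RMCshare S e (2 - j),
      (∀ (α : RMCshare S e j) (β : Diagram D), IsRes α β ↔ β = P α) ∧ Function.Injective P := by
  choose f hf hf' using hres
  refine ⟨fun α => ⟨f α α.2.1, (hf α α.2.1).reduced, ?_⟩, fun α => hf' α α.2.1, ?_⟩
  · have h2 := α.2.2
    have e1 := (hf α α.2.1).endsAt
    have e2 := (hf α α.2.1).endsAt_opp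
    by_cases a : (α : Diagram D).EndsAt S e <;> by_cases b : (α : Diagram D).EndsAt S (S.opp e) <;>
      simp only [a, b, e1, e2, not_true, not_false_iff, if_true, if_false] at h2 ⊢ <;> omega
  · intro α α' h
    have h : f α α.2.1 = f α' α'.2.1 := congrArg Subtype.val h
    have h' := hf α' α'.2.1
    rw [← h] at h'
    exact Subtype.ext (ResolvesTo.inj hR hL α.2.1 α'.2.1 (hf α α.2.1) h')

lemma exists_posResolution [Finite D] (hS : S.LocallyPlanar) (hα : α.IsReduced S) :
    ∃ β, ResolvesTo S e (NegRes S e) (encircle · S e) α β ∧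
      ∀ γ, IsPositiveResolution S e α γ ↔ γ = β := by
  have hM := hα.multicurve
  by_cases he : e ∈ α.comps
  · have hred := encircle_isReduced hS hα he
    have hends := fun d => not_endsAt_sdiff (d := d) hM he
      (fun x => (encircle_hasEnd hS.simple hM x).1) rfl
    obtain ⟨k1, k2⟩ := endsAt_of_comp hM he
    refine ⟨α.encircle S e, ⟨hred, iff_of_false (hends e (Or.inl rfl)) (not_not.2 k1),
      iff_of_false (hends _ (Or.inr rfl)) (not_not.2 k2), Or.inl ⟨he, rfl,
        encircleCnt_edge (hM.comps_cnt _ he), fun h => h.2 (Or.inl rfl)⟩⟩, fun γ => ?_⟩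
    constructor
    · rintro ⟨-, Y, ⟨-, rfl⟩ | ⟨h, -⟩, hT⟩
      · exact hred.eq_of_tighten hT
      · exact absurd he h
    · rintro rfl
      exact ⟨hred, _, Or.inl ⟨he, rfl⟩, .refl⟩
  · obtain ⟨β, hβ, hr, h1, h2, h3⟩ := hα.exists_posRes hS.simple he
    refine ⟨β, ⟨hβ, h1, h2, Or.inr (h3.imp (fun h => ⟨he, h⟩) (fun h => ⟨he, h⟩))⟩, fun γ => ?_⟩
    constructor
    · rintro ⟨hγ, Y, ⟨h, -⟩ | ⟨-, X₁, X₂, w1, w2, rfl⟩, hT⟩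
      · exact absurd h he
      · exact PosRes.unique hS.simple hα he hγ hβ ⟨_, _, w1, w2, hT⟩ hr
    · rintro rfl
      obtain ⟨X₁, X₂, w1, w2, hT⟩ := hr
      exact ⟨hβ, _, Or.inr ⟨he, _, _, w1, w2, rfl⟩, hT⟩

lemma exists_negResolution [Finite D] (hS : S.LocallyPlanar) (hα : α.IsReduced S) :
    ∃ β, ResolvesTo S e (PosRes S e) (eraseEdge · S e) α β ∧
      ∀ γ, IsNegativeResolution S e α γ ↔ γ = β := by
  have hM := hα.multicurve
  by_cases he : e ∈ α.comps
  · have hred : (α.eraseEdge S e).IsReduced S := eraseEdge_isReduced hα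
    have hends := fun d => not_endsAt_sdiff (Y := α.eraseEdge S e) (d := d) hM he
      (fun x => id) rfl
    obtain ⟨k1, k2⟩ := endsAt_of_comp hM he
    refine ⟨α.eraseEdge S e, ⟨hred, iff_of_false (hends e (Or.inl rfl)) (not_not.2 k1),
      iff_of_false (hends _ (Or.inr rfl)) (not_not.2 k2), Or.inl ⟨he, rfl,
        hM.comps_cnt _ he, fun h => h.2 (Or.inl rfl)⟩⟩, fun γ => ?_⟩
    constructor
    · rintro ⟨-, Y, ⟨-, rfl⟩ | ⟨h, -⟩, hT⟩
      · exact hred.eq_of_tighten hT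
      · exact absurd he h
    · rintro rfl
      exact ⟨hred, _, Or.inl ⟨he, rfl⟩, .refl⟩
  · obtain ⟨β, hβ, hr, h1, h2, h3⟩ := hα.exists_negRes hS.simple he
    refine ⟨β, ⟨hβ, h1, h2, Or.inr (h3.imp (fun h => ⟨he, h⟩) (fun h => ⟨he, h⟩))⟩, fun γ => ?_⟩
    constructor
    · rintro ⟨hγ, Y, ⟨h, -⟩ | ⟨-, X₁, X₂, w1, w2, rfl⟩, hT⟩
      · exact absurd h he
      · exact NegRes.unique hS.simple hα he hγ hβ ⟨_, _, w1, w2, hT⟩ hr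
    · rintro rfl
      obtain ⟨X₁, X₂, w1, w2, hT⟩ := hr
      exact ⟨hβ, _, Or.inr ⟨he, _, _, w1, w2, rfl⟩, hT⟩

end Diagram

theorem proposition7p4 {D : Type*} [Finite D] (S : TriSurface D) (hS : S.LocallyPlanar) (e : D)
    (j : ℕ) (hj : j ≤ 2) :
    (∃ P : RMCshare S e j → RMCshare S e (2 - j),
      (∀ (α : RMCshare S e j) (β : Diagram D), IsPositiveResolution S e α β ↔ β = P α) ∧
      Function.Injective P) ∧
    (∃ N : RMCshare S e j → RMCshare S e (2 - j),
      (∀ (α : RMCshare S e j) (β : Diagram D), IsNegativeResolution S e α β ↔ β = N α) ∧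
      Function.Injective N) := by
  have hS' := hS.simple
  constructor
  · exact Diagram.exists_resolution_map (R := Diagram.NegRes S e) (L := (Diagram.encircle · S e))
      (Diagram.NegRes.unique hS') (Diagram.encircle_inj hS')
      (fun α hα => Diagram.exists_posResolution hS hα) j
  · exact Diagram.exists_resolution_map (R := Diagram.PosRes S e) (L := (Diagram.eraseEdge · S e))
      (Diagram.PosRes.unique hS') Diagram.eraseEdge_inj
      (fun α hα => Diagram.exists_negResolution hS hα) j

end
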